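/- **Setting.** Let $d,k\ge 1$. Let $\mathcal T_{h,0}$ be a conforming mesh of closed $d$-simplices in $\mathbb R^d$ covering $\Omega_0$, with mesh parameter $h\in(0,h_0]$, quasi-uniform and shape regular: each element has diameter at most $h$ and contains a ball of radius $\sigma h$. Let $\Omega\subset\Omega_0$ be closed, let $\mathcal T_h=\{T\in\mathcal T_{h,0}:T\cap\Omega\ne\emptyset\}$, $\Omega_h=\bigcup_{T\in\mathcal T_h}T$, and let $V_h$ be the space of restrictions to $\Omega_h$ of the continuous functions on $\Omega_0$ that are polynomials of degree at most $k$ on every element. Let $\{\varphi_i\}_{i\in I}$ be the Lagrange basis of $V_h$, with nodes $x_i$ and degrees of freedom $\varphi_i^*(v)=v(x_i)$. For $\gamma\in(0,1]$ an element $T\in\mathcal T_h$ is large ($T\in\mathcal T_h^L$) if $|T\cap\Omega|\ge\gamma|T|$ and small ($T\in\mathcal T_h^S$) otherwise. Let $I^S$ be the set of $i\in I$ such that $\operatorname{supp}\varphi_i$ contains no large element, and $I^L=I\setminus I^S$. Let $S_h:\mathcal T_h^S\to\mathcal T_h^L$ be a map such that each $T\in\mathcal T_h^S$ is joined to $S_h(T)$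 by a path of at most $N$ consecutively face-neighboring elements of $\mathcal T_h$. For each $i\in I^S$ fix $T_i\in\mathcal T_h$ with $T_i\subset\operatorname{supp}\varphi_i$. Write $p^e$ for the extension of a polynomial $p$ on an element to $\mathbb R^d$ and $[v]_{T,T'}=(v|_T)^e-(v|_{T'})^e$. For $\tau>0$, $\alpha\in\mathbb R$ the nodal stabilization is $$s_h(v,w)=\sum_{i\in I^S}\tau h^{\alpha}\,\varphi_i^*([v]_{T_i,S_h(T_i)})\,\varphi_i^*([w]_{T_i,S_h(T_i)}),\qquad \|v\|_{s_h}=s_h(v,v)^{1/2}.$$ Let $E:L^2(\Omega)\to L^2(\mathbb R^d)$, $v\mapsto v^E$, be a linear extension operator. Let $\pi_h v=\sum_{i\in I}\varphi_i^*(P_{T_i'}v^E)\varphi_i$, where $P_T$ is the $L^2(T)$-projection onto polynomials of degree at most $k$ and $T_i'\in\mathcal T_h$ is any chosen element in $\operatorname{supp}\varphi_i$ (for instance $T_i'=T_i$ for $i\in I^S$). For $v\in V_h$ let $$\widetilde\Pi_h v=\sum_{i\in I^S}\varphi_i^*\big((v|_{S_h(T_i)})^e\big)\varphi_i+\sum_{i\in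 I^L}\varphi_i^*(v)\varphi_i,\qquad\text{and let}\quad \Pi_h=\widetilde\Pi_h\pi_h:L^2(\Omega)\to V_h.$$ Let $\mathcal T_h(T)$ be the union of the elements of $\mathcal T_h$ that share a node with $T$. For $T\in\mathcal T_h$ call a ball *admissible* if it contains $\mathcal T_h(T)$, also $\mathcal T_h(S_h(T))$ if $T$ is small, and $\mathcal T_h(T_i)\cup\mathcal T_h(S_h(T_i))$ for all $i\in I^S$ with $T\subset\operatorname{supp}\varphi_i$. **Lemma (Approximation).** All constants below depend only on $d,k,\sigma,h_0,N$ and, where indicated, on $\Lambda$; in particular they do not depend on $h$, $\gamma$, the position of $\Omega$ in the mesh, $E$, $\tau$, or $\alpha$. 1. $\widetilde\Pi_h$ maps $V_h$ into $V_h$, with $(\widetilde\Pi_h w)(x_i)=(w|_{S_h(T_i)})^e(x_i)$ for $i\in I^S$ and $(\widetilde\Pi_h w)(x_i)=w(x_i)$ for $i\in I^L$, for all $w\in V_h$. 2. For all $v\in L^2(\Omega)$, $\tau>0$ and $\alpha\in\mathbb R$ we have $\Pi_h v\in V_h$, $\|\Pi_h v\|_{s_h}=0$, and $s_h(\Pi_h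 v,w)=0$ for all $w\in V_h$. 3. There is a constant $\Lambda_0>0$ such that every $T\in\mathcal T_h$ has an admissible ball of radius $\Lambda_0h$. For every $\Lambda$ there is a constant $C_\Lambda$ such that for every $T\in\mathcal T_h$, every admissible ball $B_{\delta,T}$ for $T$ of radius $\delta=\Lambda h$, all $0\le m\le k+1$ and all $v\in L^2(\Omega)$ with $v^E\in H^{k+1}(B_{\delta,T})$, $$\|v^E-\Pi_hv\|_{H^m(T)}\le C_\Lambda\,h^{k+1-m}\,\|v^E\|_{H^{k+1}(B_{\delta,T})}.$$ 4. (Locking-freeness.) There is a constant $C'$ such that, if $\|v^E\|_{H^{k+1}(\mathbb R^d)}\le C_E\|v\|_{H^{k+1}(\Omega)}$ for all $v$, then for $m=0,1$ and all $v\in L^2(\Omega)$ with $v\in H^{k+1}(\Omega)$, $$\|v^E-\Pi_hv\|_{H^m(\Omega_h)}\le C'C_E\,h^{k+1-m}\,\|v\|_{H^{k+1}(\Omega)}.$$ Thus the kernel of $s_h$, for every $\tau>0$, contains an optimal order approximation of $v$, with constants independent of $\tau$. -/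

import Mathlib

open MeasureTheory
open scoped ENNReal NNReal

namespace CutFEM

noncomputable section

open scoped Classical

/-- Points of Euclidean space. -/
abbrev Pt (d : ℕ) : Type := EuclideanSpace ℝ (Fin d)

/-! ### Sobolev norms -/

/-- `g` is the weak derivative `∂_{i₁} ⋯ ∂_{iⱼ} f` on the open set `U`. -/
def HasWeakDeriv {d : ℕ} (U : Set (Pt d)) (f g : Pt d → ℝ) {j : ℕ} (i : Fin j → Fin d) : Prop :=
  LocallyIntegrableOn f U volume ∧ LocallyIntegrableOn g U volume ∧
    ∀ φ : Pt d → ℝ, ContDiff ℝ ((⊤ : ℕ∞) : WithTop ℕ∞) φ → HasCompactSupport φ →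
      tsupport φ ⊆ U →
        ∫ x in U, f x * iteratedFDeriv ℝ j φ x (fun l => EuclideanSpace.single (i l) (1 : ℝ)) =
          (-1) ^ j * ∫ x in U, g x * φ x

/-- The norm of `H^m(U)` for an open set `U`: the square root of `∑_{j ≤ m} ‖∇^j f‖²_{L²(U)}`, where
`‖∇^j f‖²` sums over all `j`-tuples of directions. It is `∞` if `f` is not in `H^m(U)`. Weak
derivatives are unique almost everywhere, so all families `g` in the infimum give one value. -/
def sobolevNorm {d : ℕ} (m : ℕ) (U : Set (Pt d)) (f : Pt d → ℝ) : ℝ≥0∞ :=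
  ⨅ (g : (j : ℕ) → (Fin j → Fin d) → Pt d → ℝ)
    (_ : ∀ j ≤ m, ∀ i : Fin j → Fin d, HasWeakDeriv U f (g j i) i),
    (∑ j ∈ Finset.range (m + 1), ∑ i : Fin j → Fin d,
      eLpNorm (g j i) 2 (volume.restrict U) ^ 2) ^ (1 / 2 : ℝ)

/-! ### Polynomials of degree at most `k` -/

/-- `ℙ_k(ℝ^d)`. -/
abbrev Poly (d k : ℕ) : Submodule ℝ (MvPolynomial (Fin d) ℝ) :=
  MvPolynomial.restrictTotalDegree (Fin d) ℝ k

/-- The value of a polynomial at a point. -/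
def polyVal {d : ℕ} (p : MvPolynomial (Fin d) ℝ) (x : Pt d) : ℝ :=
  MvPolynomial.eval (fun j => x j) p

/-! ### Meshes -/

/-- The closed simplex with the given vertices. -/
def simplex {d : ℕ} (T : Finset (Pt d)) : Set (Pt d) :=
  convexHull ℝ (T : Set (Pt d))

/-- A finite conforming mesh of nondegenerate `d`-simplices in `ℝ^d`. An element is given by its
set of vertices, and two elements meet in a common face or not at all. -/
structure SimplicialMesh (d : ℕ) where
  elements : Finset (Finset (Pt d))
  card_eq : ∀ T ∈ elements, T.card = d + 1
  indep : ∀ T ∈ elements, AffineIndependent ℝ ((↑) : T → Pt d)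
  conforming : ∀ T ∈ elements, ∀ T' ∈ elements,
    simplex T ∩ simplex T' ⊆ convexHull ℝ ((T : Set (Pt d)) ∩ (T' : Set (Pt d)))

/-- The polygonal domain `Ω₀` covered by the mesh. -/
def SimplicialMesh.region {d : ℕ} (𝒯 : SimplicialMesh d) : Set (Pt d) :=
  ⋃ T ∈ 𝒯.elements, simplex T

/-- Quasi-uniformity (with shape regularity) for the mesh parameter `h`: every element has diameter
at most `h` and contains a ball of radius `σ h`. -/
def SimplicialMesh.QuasiUniform {d : ℕ} (𝒯 : SimplicialMesh d) (σ h : ℝ) : Prop :=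
  ∀ T ∈ 𝒯.elements, Metric.diam (simplex T) ≤ h ∧
    ∃ z, Metric.closedBall z (σ * h) ⊆ simplex T

/-- Two elements share a face of codimension one. -/
def FaceNeighbors {d : ℕ} (T T' : Finset (Pt d)) : Prop :=
  (T ∩ T').card = d

/-- The Lagrange nodes of order `k` of the simplex `T` (its principal lattice). -/
def elementNodes {d : ℕ} (k : ℕ) (T : Finset (Pt d)) : Finset (Pt d) :=
  (Finset.piAntidiag T k).image fun a => ∑ p ∈ T, ((a p : ℝ) / (k : ℝ)) • p

/-- The space `V_{h,0}` of functions that are continuous on `Ω₀` and polynomial of degree at most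
`k` on every element (values outside `Ω₀` are irrelevant). -/
def SimplicialMesh.feSpace {d : ℕ} (𝒯 : SimplicialMesh d) (k : ℕ) : Set (Pt d → ℝ) :=
  {v | ContinuousOn v 𝒯.region ∧
    ∀ T ∈ 𝒯.elements, ∃ p ∈ Poly d k, ∀ x ∈ simplex T, v x = polyVal p x}

/-! ### The cut mesh -/

/-- A background mesh, a closed set `Ω ⊆ Ω₀`, and the threshold `γ` for large elements. -/
structure CutMesh (d : ℕ) where
  mesh : SimplicialMesh d
  Ω : Set (Pt d)
  isClosed_Ω : IsClosed Ω
  Ω_subset : Ω ⊆ mesh.region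
  γ : ℝ
  γ_pos : 0 < γ
  γ_le_one : γ ≤ 1

namespace CutMesh

variable {d : ℕ} (M : CutMesh d) (k : ℕ)

/-- The active mesh `𝒯_h`. -/
def active : Finset (Finset (Pt d)) :=
  M.mesh.elements.filter fun T => (simplex T ∩ M.Ω).Nonempty

/-- The union `Ω_h` of the active elements. -/
def activeRegion : Set (Pt d) :=
  ⋃ T ∈ M.active, simplex T

/-- The large elements `𝒯_h^L`. -/
def large : Finset (Finset (Pt d)) :=
  M.active.filter fun T =>
    ENNReal.ofReal M.γ * volume (simplex T) ≤ volume (simplex T ∩ M.Ω)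

/-- The small elements `𝒯_h^S`. -/
def small : Finset (Finset (Pt d)) :=
  M.active \ M.large

/-- The active finite element space `V_h = V_{h,0}|_{Ω_h}`. A function on `Ω_h` is represented by
its extension by zero. -/
def Vh : Set (Pt d → ℝ) :=
  {w | ∃ v ∈ M.mesh.feSpace k, w = M.activeRegion.indicator v}

/-- The index set `I` of the global basis; an index is identified with its node. -/
def nodes : Finset (Pt d) :=
  M.active.biUnion (elementNodes k)

/-- The global Lagrange basis function `φ_i`: the unique function in `V_h` that is `1` at the node
`i` and `0` at all other nodes. -/
def basis (i : Pt d) : Pt d → ℝ :=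
  if H : ∃ f ∈ M.Vh k, ∀ j ∈ M.nodes k, f j = if j = i then 1 else 0 then H.choose else 0

/-- `T ⊆ supp φ_i`. -/
def InSupport (T : Finset (Pt d)) (i : Pt d) : Prop :=
  simplex T ⊆ tsupport (M.basis k i)

/-- The indices `I^S` of the basis functions without a large element in their support. -/
def smallNodes : Finset (Pt d) :=
  (M.nodes k).filter fun i => ∀ T ∈ M.large, ¬ M.InSupport k T i

/-- The complement `I^L` of `I^S` in `I`. -/
def largeNodes : Finset (Pt d) :=
  M.nodes k \ M.smallNodes k

/-- `𝒯_h(T)`: the union of the active elements that share a node with `T`. -/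
def neighborhood (T : Finset (Pt d)) : Set (Pt d) :=
  ⋃ T' ∈ M.active.filter fun T' => (elementNodes k T ∩ elementNodes k T').Nonempty, simplex T'

end CutMesh

/-- The canonical extension `(v|_T)^e ∈ ℙ_k(ℝ^d)`: the unique polynomial of degree at most `k` that
agrees with `v` on the element `T`. -/
def polyExt {d : ℕ} (k : ℕ) (T : Finset (Pt d)) (v : Pt d → ℝ) : MvPolynomial (Fin d) ℝ :=
  if H : ∃ p ∈ Poly d k, ∀ x ∈ simplex T, v x = polyVal p x then H.choose else 0

/-- The jump `[v]_{T₁,T₂} = (v|_{T₁})^e - (v|_{T₂})^e`. -/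
def jump {d : ℕ} (k : ℕ) (T₁ T₂ : Finset (Pt d)) (v : Pt d → ℝ) : MvPolynomial (Fin d) ℝ :=
  polyExt k T₁ v - polyExt k T₂ v

/-- The local `L²`-projection `P_T v`: the unique polynomial of degree at most `k` with
`(v - P_T v, q)_T = 0` for all `q` of degree at most `k`. -/
def l2Proj {d : ℕ} (k : ℕ) (T : Finset (Pt d)) (v : Pt d → ℝ) : MvPolynomial (Fin d) ℝ :=
  if H : ∃ p ∈ Poly d k, ∀ q ∈ Poly d k,
      ∫ x in simplex T, (v x - polyVal p x) * polyVal q x = 0 then H.choose else 0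

/-! ### Nodal stabilization and interpolation -/

/-- The choices behind the nodal stabilization and the Clément operator: the map
`S_h : 𝒯_h^S → 𝒯_h^L`, an element `T_i ⊆ supp φ_i` for each `i ∈ I^S`, and the element in `supp φ_i`
that the Clément operator uses for each `i ∈ I` (which may or may not be `T_i`). -/
structure NodalChoice {d : ℕ} (M : CutMesh d) (k : ℕ) where
  S : Finset (Pt d) → Finset (Pt d)
  S_mem : ∀ T ∈ M.small, S T ∈ M.large
  stabElem : Pt d → Finset (Pt d)
  stabElem_mem : ∀ i ∈ M.smallNodes k, stabElem i ∈ M.active ∧ M.InSupport k (stabElem i) i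
  clementElem : Pt d → Finset (Pt d)
  clementElem_mem : ∀ i ∈ M.nodes k, clementElem i ∈ M.active ∧ M.InSupport k (clementElem i) i

namespace NodalChoice

variable {d : ℕ} {M : CutMesh d} {k : ℕ} (D : NodalChoice M k)

/-- Each small element `T` is joined to `S_h(T)` by a path of at most `N` active elements in which
consecutive elements are face neighbors. -/
def PathBound (N : ℕ) : Prop :=
  ∀ T ∈ M.small, ∃ n : ℕ, n + 1 ≤ N ∧ ∃ P : ℕ → Finset (Pt d),
    P 0 = T ∧ P n = D.S T ∧ (∀ j ≤ n, P j ∈ M.active) ∧ ∀ j < n, FaceNeighbors (P j) (P (j + 1))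

/-- The nodal stabilization form
`s_h(v,w) = ∑_{i ∈ I^S} τ h^α φ*_{i,T_i}([v]_{T_i,S_h(T_i)}) φ*_{i,T_i}([w]_{T_i,S_h(T_i)})`;
the degree of freedom `φ*_{i,T}` is evaluation at the node `i`. -/
def stab (h τ α : ℝ) (v w : Pt d → ℝ) : ℝ :=
  ∑ i ∈ M.smallNodes k, τ * h ^ α *
    polyVal (jump k (D.stabElem i) (D.S (D.stabElem i)) v) i *
    polyVal (jump k (D.stabElem i) (D.S (D.stabElem i)) w) i

/-- The seminorm `‖v‖_{s_h}`. -/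
def stabSeminorm (h τ α : ℝ) (v : Pt d → ℝ) : ℝ :=
  Real.sqrt (D.stab h τ α v v)

/-- The Clément operator `π_{h,Cl}`. -/
def clement (v : Pt d → ℝ) : Pt d → ℝ := fun x =>
  ∑ i ∈ M.nodes k, polyVal (l2Proj k (D.clementElem i) v) i * M.basis k i x

/-- The operator `Π̃_h`. -/
def tildePi (v : Pt d → ℝ) : Pt d → ℝ := fun x =>
  ∑ i ∈ M.smallNodes k, polyVal (polyExt k (D.S (D.stabElem i)) v) i * M.basis k i x +
    ∑ i ∈ M.largeNodes k, v i * M.basis k i x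

/-- The interpolation operator `Π_h = Π̃_h π_h` with `π_h = π_{h,Cl} E`, for an extension operator
`E : L²(Ω) → L²(ℝ^d)`. -/
def bigPi (E : Lp ℝ 2 (volume.restrict M.Ω) →ₗ[ℝ] Lp ℝ 2 (volume : Measure (Pt d)))
    (v : Lp ℝ 2 (volume.restrict M.Ω)) : Pt d → ℝ :=
  D.tildePi (D.clement (E v))

/-- The set that the ball `B_{δ,T}` has to contain: `𝒯_h(T)`, also `𝒯_h(S_h(T))` if `T` is small,
and `𝒯_h(T_i) ∪ 𝒯_h(S_h(T_i))` for each `i ∈ I^S` with `T ⊆ supp φ_i`. -/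
def dependenceRegion (T : Finset (Pt d)) : Set (Pt d) :=
  M.neighborhood k T ∪ {x | T ∈ M.small ∧ x ∈ M.neighborhood k (D.S T)} ∪
    ⋃ i ∈ (M.smallNodes k).filter fun i => M.InSupport k T i,
      (M.neighborhood k (D.stabElem i) ∪ M.neighborhood k (D.S (D.stabElem i)))

end NodalChoice

end

end CutFEM

/-! The kernel property is algebra. Every node of a large element belongs to `largeNodes`, so
`tildePi` keeps all nodal values on large elements, and unisolvence of the principal lattice
(`eq_zero_of_elementNodes`) makes `tildePi w` and `w` the same polynomial there
(`polyExt_tildePi_large`). At a small node `i` the new value is, by construction, that of this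
polynomial on `S_h(T_i)`. Hence the jump between `T_i` and `S_h(T_i)` vanishes at `i`
(`jump_tildePi`), and every summand of the stabilization is zero whatever `τ` and `α` are.

The local estimate compares both `u = v^E` and its interpolant with one polynomial `q` on the ball.
If all derivatives of `u - q` up to order `k` have mean zero, iterating the Poincaré inequality
(`poincare_ball`) bounds every derivative of `u - q` by those of order `k + 1`
(`exists_poly_approx`). On `T` the difference `Π_h u - q` is a polynomial, so it and its derivatives
are controlled by its nodal values (`exists_nodal_bound`). At a large node such a value comes from
the `L²`-projection of `u - q` on a nearby element, which an inverse estimate bounds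
(`exists_l2Proj_bound`). At a small node it is the value of a polynomial living on `S_h(T_i)`; since
that element is only a multiple of `h` away, its own nodal values, again all of Clément type,
control it (`exists_nodal_error`). No reference element is needed: an element enters only through
its diameter and an inscribed ball, and its Lagrange polynomials are bounded by `k ^ k` for every
shape.

Admissible balls of radius comparable to `h` exist because the path from `T_i` to `S_h(T_i)` has at
most `N` elements (`dependenceRegion_subset_ball`).

For the global estimate with `m ≤ 1`, the first weak derivatives of a finite element function are
its elementwise derivatives, thanks to continuity across faces (`isWeakDeriv_piecewise`). The
squared global error is then at most the sum of the squared local ones. The balls overlap boundedly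
often, since the elements have disjoint interiors of volume at least a multiple of `h ^ d`
(`exists_overlap_bound`). -/

namespace CutFEM
noncomputable section
open scoped Classical

/-! ### Calculus of polynomials -/

/-- The iterated partial derivative of a polynomial along a list of directions. -/
def listDeriv {d : ℕ} : List (Fin d) → MvPolynomial (Fin d) ℝ →ₗ[ℝ] MvPolynomial (Fin d) ℝ
  | [] => LinearMap.id
  | l :: L => listDeriv L ∘ₗ (MvPolynomial.pderiv (R := ℝ) l).toLinearMap

theorem listDeriv_nil {d : ℕ} (p : MvPolynomial (Fin d) ℝ) : listDeriv [] p = p := rfl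

theorem listDeriv_cons {d : ℕ} (l : Fin d) (L : List (Fin d)) (p : MvPolynomial (Fin d) ℝ) :
    listDeriv (l :: L) p = listDeriv L (MvPolynomial.pderiv l p) := rfl

theorem pderiv_comm {d : ℕ} (l m : Fin d) (p : MvPolynomial (Fin d) ℝ) :
    MvPolynomial.pderiv l (MvPolynomial.pderiv m p) =
      MvPolynomial.pderiv m (MvPolynomial.pderiv l p) := by
  ext n
  simp only [MvPolynomial.coeff_pderiv]
  rw [add_right_comm]
  by_cases h : l = m
  · subst h; ring
  · simp [h, Ne.symm h]; ring

theorem listDeriv_perm {d : ℕ} {L L' : List (Fin d)} (h : L.Perm L')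
    (p : MvPolynomial (Fin d) ℝ) : listDeriv L p = listDeriv L' p := by
  induction h generalizing p with
  | nil => rfl
  | cons l _ ih => simp only [listDeriv_cons, ih]
  | swap l m L => simp only [listDeriv_cons, pderiv_comm l m]
  | trans _ _ ih₁ ih₂ => rw [ih₁, ih₂]

theorem mem_Poly {d k : ℕ} {p : MvPolynomial (Fin d) ℝ} : p ∈ Poly d k ↔ p.totalDegree ≤ k :=
  MvPolynomial.mem_restrictTotalDegree _ _ _

theorem mem_Poly_iff_coeff {d k : ℕ} {p : MvPolynomial (Fin d) ℝ} :
    p ∈ Poly d k ↔ ∀ n : Fin d →₀ ℕ, k < n.degree → p.coeff n = 0 := by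
  rw [mem_Poly, MvPolynomial.totalDegree, Finset.sup_le_iff]
  constructor
  · intro h n hn
    by_contra h0
    exact absurd (h n (MvPolynomial.mem_support_iff.2 h0)) (not_le.2 hn)
  · intro h n hn
    by_contra h0
    exact MvPolynomial.mem_support_iff.1 hn (h n (not_le.1 h0))

theorem pderiv_mem_Poly {d k : ℕ} {p : MvPolynomial (Fin d) ℝ} (hp : p ∈ Poly d (k + 1))
    (l : Fin d) : MvPolynomial.pderiv l p ∈ Poly d k := by
  rw [mem_Poly_iff_coeff] at hp ⊢
  intro n hn
  rw [MvPolynomial.coeff_pderiv, hp, zero_mul]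
  simpa [map_add] using hn

theorem eq_C_of_mem_Poly_zero {d : ℕ} {p : MvPolynomial (Fin d) ℝ} (hp : p ∈ Poly d 0) :
    p = MvPolynomial.C (p.coeff 0) := by
  ext n
  rw [MvPolynomial.coeff_C]
  split_ifs with h
  · rw [h]
  · exact mem_Poly_iff_coeff.1 hp n (Nat.pos_of_ne_zero fun h0 => h
      ((Finsupp.degree_eq_zero_iff _).1 h0).symm)

/-- Characteristic zero: each nonconstant coefficient reappears in some partial derivative,
multiplied by a positive integer. -/
theorem eq_C_of_pderiv_eq_zero {d : ℕ} {p : MvPolynomial (Fin d) ℝ}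
    (hp : ∀ l, MvPolynomial.pderiv l p = 0) : p = MvPolynomial.C (p.coeff 0) := by
  ext n
  rw [MvPolynomial.coeff_C]
  split_ifs with h
  · rw [h]
  · obtain ⟨l, hl⟩ : ∃ l, n l ≠ 0 := by
      by_contra! h0
      exact h (Finsupp.ext fun l => (h0 l).symm)
    have h1 := MvPolynomial.coeff_pderiv (i := l) p (n - Finsupp.single l 1)
    rw [hp l, MvPolynomial.coeff_zero, Finsupp.sub_add_single_one_cancel hl] at h1
    rcases mul_eq_zero.1 h1.symm with h2 | h2
    · exact h2
    · exact absurd h2 (by positivity)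

theorem listDeriv_eq_zero_of_mem_Poly {d k : ℕ} {L : List (Fin d)} {p : MvPolynomial (Fin d) ℝ}
    (hp : p ∈ Poly d k) (hL : L.length = k + 1) : listDeriv L p = 0 := by
  induction k generalizing p L with
  | zero =>
    obtain ⟨l, rfl⟩ := List.length_eq_one_iff.1 hL
    rw [listDeriv_cons, listDeriv_nil, eq_C_of_mem_Poly_zero hp, MvPolynomial.pderiv_C]
  | succ k ih =>
    cases L with
    | nil => simp at hL
    | cons l L =>
      rw [listDeriv_cons]
      exact ih (pderiv_mem_Poly hp l) (by simpa using hL)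

/-! ### Polynomial functions on Euclidean space -/

section polyVal

variable {d : ℕ}

@[simp] theorem polyVal_add (p q : MvPolynomial (Fin d) ℝ) (x : Pt d) :
    polyVal (p + q) x = polyVal p x + polyVal q x := by simp [polyVal]

@[simp] theorem polyVal_sub (p q : MvPolynomial (Fin d) ℝ) (x : Pt d) :
    polyVal (p - q) x = polyVal p x - polyVal q x := by simp [polyVal]

@[simp] theorem polyVal_mul (p q : MvPolynomial (Fin d) ℝ) (x : Pt d) :
    polyVal (p * q) x = polyVal p x * polyVal q x := by simp [polyVal]

@[simp] theorem polyVal_C (c : ℝ) (x : Pt d) : polyVal (MvPolynomial.C c) x = c := by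
  simp [polyVal]

@[simp] theorem polyVal_X (j : Fin d) (x : Pt d) : polyVal (MvPolynomial.X j) x = x j := by
  simp [polyVal]

@[simp] theorem polyVal_zero (x : Pt d) : polyVal (0 : MvPolynomial (Fin d) ℝ) x = 0 := by
  simp [polyVal]

@[simp] theorem polyVal_smul (c : ℝ) (p : MvPolynomial (Fin d) ℝ) (x : Pt d) :
    polyVal (c • p) x = c * polyVal p x := by simp [polyVal, MvPolynomial.smul_eval]

theorem polyVal_sum {ι : Type*} (s : Finset ι) (p : ι → MvPolynomial (Fin d) ℝ) (x : Pt d) :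
    polyVal (∑ i ∈ s, p i) x = ∑ i ∈ s, polyVal (p i) x := by simp [polyVal]

theorem polyVal_prod {ι : Type*} (s : Finset ι) (p : ι → MvPolynomial (Fin d) ℝ) (x : Pt d) :
    polyVal (∏ i ∈ s, p i) x = ∏ i ∈ s, polyVal (p i) x := by simp [polyVal, map_prod]

theorem hasFDerivAt_polyVal (p : MvPolynomial (Fin d) ℝ) (x : Pt d) :
    HasFDerivAt (polyVal p)
      (∑ l, polyVal (MvPolynomial.pderiv l p) x • EuclideanSpace.proj (𝕜 := ℝ) l) x := by
  induction p using MvPolynomial.induction_on with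
  | C a =>
    have : polyVal (MvPolynomial.C a : MvPolynomial (Fin d) ℝ) = fun _ => a := by ext; simp
    rw [this]
    simpa using hasFDerivAt_const a x
  | add p q hp hq =>
    have : polyVal (p + q) = fun x => polyVal p x + polyVal q x := by ext; simp
    rw [this]
    refine (hp.add hq).congr_fderiv ?_
    simp [add_smul, Finset.sum_add_distrib]
  | mul_X p j hp =>
    have : polyVal (p * MvPolynomial.X j) = fun x => polyVal p x * x j := by ext; simp
    rw [this]
    have h1 : HasFDerivAt (fun x : Pt d => x j) (EuclideanSpace.proj (𝕜 := ℝ) j) x :=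
      (EuclideanSpace.proj (𝕜 := ℝ) j : Pt d →L[ℝ] ℝ).hasFDerivAt
    refine (hp.mul h1).congr_fderiv ?_
    ext y
    simp [MvPolynomial.pderiv_X, add_mul, Finset.sum_add_distrib,
      Finset.mul_sum, Pi.single_apply, apply_ite (fun q => polyVal q x)]
    refine Finset.sum_congr rfl fun l _ => by ring

theorem fderiv_polyVal_single (p : MvPolynomial (Fin d) ℝ) (x : Pt d) (l : Fin d) :
    fderiv ℝ (polyVal p) x (EuclideanSpace.single l 1) = polyVal (MvPolynomial.pderiv l p) x := by
  rw [(hasFDerivAt_polyVal p x).fderiv]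
  simp

theorem contDiff_polyVal (p : MvPolynomial (Fin d) ℝ) {n : WithTop ℕ∞} :
    ContDiff ℝ n (polyVal p) := by
  induction p using MvPolynomial.induction_on with
  | C a =>
    have : polyVal (MvPolynomial.C a : MvPolynomial (Fin d) ℝ) = fun _ => a := by ext; simp
    rw [this]; exact contDiff_const
  | add p q hp hq =>
    have : polyVal (p + q) = fun x => polyVal p x + polyVal q x := by ext; simp
    rw [this]; exact hp.add hq
  | mul_X p j hp =>
    have : polyVal (p * MvPolynomial.X j) = fun x => polyVal p x * x j := by ext; simp
    rw [this]
    exact hp.mul (EuclideanSpace.proj (𝕜 := ℝ) j : Pt d →L[ℝ] ℝ).contDiff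

theorem continuous_polyVal (p : MvPolynomial (Fin d) ℝ) : Continuous (polyVal p) :=
  (contDiff_polyVal p (n := 0)).continuous

/-- An open set contains a box, which is a product of infinite sets, and a polynomial over an
infinite domain is determined by its values on such a product. -/
theorem eq_zero_of_polyVal_eq_zero {p : MvPolynomial (Fin d) ℝ} {U : Set (Pt d)} (hU : IsOpen U)
    (hne : U.Nonempty) (h : ∀ x ∈ U, polyVal p x = 0) : p = 0 := by
  obtain ⟨z, hz⟩ := hne
  let e := (EuclideanSpace.equiv (Fin d) ℝ)
  have hV : e.symm ⁻¹' U ∈ nhds (e z) :=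
    (hU.preimage e.symm.continuous).mem_nhds (by simpa using hz)
  obtain ⟨ε, hε, hball⟩ := Metric.nhds_basis_closedBall.mem_iff.1 hV
  refine MvPolynomial.funext_set (fun j => Set.Icc (e z j - ε) (e z j + ε))
    (fun j => Set.Icc_infinite (by linarith)) fun y hy => ?_
  have : y ∈ Metric.closedBall (e z) ε := by
    rw [Metric.mem_closedBall, dist_pi_le_iff hε.le]
    intro j
    have := hy j (Set.mem_univ _)
    rw [Real.dist_eq, abs_le]
    constructor <;> linarith [this.1, this.2]
  simpa [polyVal, e] using h _ (hball this)

theorem eq_of_polyVal_eq {p q : MvPolynomial (Fin d) ℝ} {U : Set (Pt d)} (hU : IsOpen U)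
    (hne : U.Nonempty) (h : ∀ x ∈ U, polyVal p x = polyVal q x) : p = q :=
  sub_eq_zero.1 (eq_zero_of_polyVal_eq_zero hU hne fun x hx => by simp [h x hx])

end polyVal

/-! ### Affine changes of variables -/

/-- The polynomial `y ↦ p (z + t • y)`. -/
def affineSubst {d : ℕ} (z : Pt d) (t : ℝ) (p : MvPolynomial (Fin d) ℝ) :
    MvPolynomial (Fin d) ℝ :=
  MvPolynomial.bind₁ (fun j => MvPolynomial.C (z j) + MvPolynomial.C t * MvPolynomial.X j) p

theorem polyVal_affineSubst {d : ℕ} (z : Pt d) (t : ℝ) (p : MvPolynomial (Fin d) ℝ) (y : Pt d) :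
    polyVal (affineSubst z t p) y = polyVal p (z + t • y) := by
  unfold affineSubst
  induction p using MvPolynomial.induction_on with
  | C a => simp
  | add p q hp hq => simp [hp, hq]
  | mul_X p j hp => simp [hp]

theorem pderiv_affineSubst {d : ℕ} (z : Pt d) (t : ℝ) (p : MvPolynomial (Fin d) ℝ) (l : Fin d) :
    MvPolynomial.pderiv l (affineSubst z t p) =
      t • affineSubst z t (MvPolynomial.pderiv l p) := by
  unfold affineSubst
  induction p using MvPolynomial.induction_on with
  | C a => simp
  | add p q hp hq => simp [hp, hq]
  | mul_X p j hp =>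
    simp only [map_mul, MvPolynomial.bind₁_X_right, MvPolynomial.pderiv_mul, hp, map_add,
      MvPolynomial.pderiv_C, zero_mul, zero_add, MvPolynomial.pderiv_X, smul_add,
      Pi.single_apply, MvPolynomial.smul_eq_C_mul]
    split_ifs <;> simp <;> ring

theorem listDeriv_affineSubst {d : ℕ} (z : Pt d) (t : ℝ) (L : List (Fin d))
    (p : MvPolynomial (Fin d) ℝ) :
    listDeriv L (affineSubst z t p) = t ^ L.length • affineSubst z t (listDeriv L p) := by
  induction L generalizing p with
  | nil => simp [listDeriv_nil]
  | cons l L ih =>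
    rw [listDeriv_cons, pderiv_affineSubst, map_smul, ih, listDeriv_cons, smul_smul,
      List.length_cons, pow_succ']

theorem affineSubst_mem_Poly {d k : ℕ} (z : Pt d) (t : ℝ) {p : MvPolynomial (Fin d) ℝ}
    (hp : p ∈ Poly d k) : affineSubst z t p ∈ Poly d k := by
  rw [affineSubst, p.as_sum, map_sum]
  refine Submodule.sum_mem _ fun n hn => ?_
  rw [MvPolynomial.bind₁_monomial, mem_Poly]
  refine (MvPolynomial.totalDegree_mul _ _).trans ?_
  rw [MvPolynomial.totalDegree_C, zero_add]
  refine (MvPolynomial.totalDegree_finsetProd _ _).trans ?_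
  refine le_trans (Finset.sum_le_sum fun j _ => ?_) ((MvPolynomial.le_totalDegree hn).trans
    (mem_Poly.1 hp))
  refine (MvPolynomial.totalDegree_pow _ _).trans ?_
  refine (Nat.mul_le_mul_left _ (?_ : _ ≤ 1)).trans (mul_one _).le
  refine (MvPolynomial.totalDegree_add _ _).trans (max_le (by simp) ?_)
  refine (MvPolynomial.totalDegree_mul _ _).trans (by simp)

theorem lintegral_comp_affine {d : ℕ} (F : Pt d → ℝ≥0∞) (a : Pt d) {t : ℝ} (ht : t ≠ 0) :
    (∫⁻ x, F (a + t • x)) * ENNReal.ofReal |t| ^ d = ∫⁻ x, F x := by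
  have h1 : ∫⁻ x, F (a + t • x) = ∫⁻ x, F (a + x) ∂(Measure.map (t • ·) volume) := by
    exact ((Homeomorph.smulOfNeZero t ht).measurableEmbedding.lintegral_map
      (fun x => F (a + x))).symm
  rw [h1, Measure.map_addHaar_smul _ ht, lintegral_smul_measure, lintegral_add_left_eq_self]
  simp only [finrank_euclideanSpace, Fintype.card_fin, smul_eq_mul]
  rw [mul_right_comm, ← ENNReal.ofReal_pow (abs_nonneg t), ← ENNReal.ofReal_mul (abs_nonneg _),
    abs_inv, abs_pow, inv_mul_cancel₀ (by positivity)]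
  simp

/-! ### Inverse estimates -/

theorem eLpNorm_two_sq {α : Type*} [MeasurableSpace α] (f : α → ℝ) (μ : Measure α) :
    eLpNorm f 2 μ ^ 2 = ∫⁻ x, ‖f x‖ₑ ^ 2 ∂μ := by
  have := eLpNorm_nnreal_pow_eq_lintegral (μ := μ) (f := f) (p := 2) two_ne_zero
  simpa using this

theorem memLp_polyVal {d : ℕ} (p : MvPolynomial (Fin d) ℝ) {s : Set (Pt d)}
    (hs : Bornology.IsBounded s) : MemLp (polyVal p) 2 (volume.restrict s) := by
  obtain ⟨r, hr⟩ := hs.subset_closedBall 0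
  have : MemLp (polyVal p) 2 (volume.restrict (Metric.closedBall (0 : Pt d) r)) := by
    have : IsFiniteMeasure (volume.restrict (Metric.closedBall (0 : Pt d) r)) :=
      ⟨by simpa using measure_closedBall_lt_top⟩
    obtain ⟨C, hC⟩ := (isCompact_closedBall (0 : Pt d) r).exists_bound_of_continuousOn
      (continuous_polyVal p).continuousOn
    exact MemLp.of_bound (continuous_polyVal p).aestronglyMeasurable C
      ((ae_restrict_iff' measurableSet_closedBall).2 (Filter.Eventually.of_forall hC))
  exact this.mono_measure (Measure.restrict_mono hr le_rfl)

/-- On the finite-dimensional space `Poly d k` the `L²` norm over any ball is a norm, because a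
polynomial that vanishes on a ball is zero. A linear map out of a finite-dimensional normed space is
bounded, and its operator norm, squared, is the constant. -/
theorem exists_inverse_estimate_unit (d k : ℕ) {σ R : ℝ} (hσ : 0 < σ) (L : List (Fin d)) :
    ∃ C : ℝ≥0, ∀ p ∈ Poly d k, ∀ x ∈ Metric.closedBall (0 : Pt d) R,
      ‖polyVal (listDeriv L p) x‖ₑ ^ 2 ≤
        C * ∫⁻ y in Metric.ball (0 : Pt d) σ, ‖polyVal p y‖ₑ ^ 2 := by
  have : CompactSpace (Metric.closedBall (0 : Pt d) R) :=
    isCompact_iff_compactSpace.1 (isCompact_closedBall _ _)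
  let μ := volume.restrict (Metric.ball (0 : Pt d) σ)
  have hm : ∀ p : MvPolynomial (Fin d) ℝ, MemLp (polyVal p) 2 μ := fun p =>
    memLp_polyVal p Metric.isBounded_ball
  let Φ : Poly d k →ₗ[ℝ] Lp ℝ 2 μ :=
    { toFun := fun p => (hm p).toLp
      map_add' := fun p q => by
        rw [← MemLp.toLp_add]
        exact MemLp.toLp_congr _ _ (Filter.Eventually.of_forall fun x => by simp)
      map_smul' := fun c p => by
        rw [RingHom.id_apply, ← MemLp.toLp_const_smul]
        exact MemLp.toLp_congr _ _ (Filter.Eventually.of_forall fun x => by simp) }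
  have hinj : Function.Injective Φ := by
    rw [injective_iff_map_eq_zero]
    rintro ⟨p, hp⟩ h0
    have h1 : polyVal p =ᵐ[μ] 0 := (MemLp.toLp_eq_toLp_iff (hm p) (MemLp.zero (ε := ℝ))).1
      (by simpa [Φ] using h0)
    have h2 : Set.EqOn (polyVal p) 0 (Metric.ball 0 σ) :=
      Measure.eqOn_open_of_ae_eq h1 Metric.isOpen_ball (continuous_polyVal p).continuousOn
        continuousOn_const
    exact Subtype.ext (eq_zero_of_polyVal_eq_zero Metric.isOpen_ball
      ⟨0, Metric.mem_ball_self hσ⟩ h2)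
  let Ψ : Poly d k →ₗ[ℝ] C(Metric.closedBall (0 : Pt d) R, ℝ) :=
    { toFun := fun p => ⟨fun y => polyVal (listDeriv L p) y,
        (continuous_polyVal _).comp continuous_subtype_val⟩
      map_add' := fun p q => by ext; simp
      map_smul' := fun c p => by ext; simp }
  let e := LinearEquiv.ofInjective Φ hinj
  let Θ : LinearMap.range Φ →L[ℝ] C(Metric.closedBall (0 : Pt d) R, ℝ) :=
    LinearMap.toContinuousLinearMap (Ψ ∘ₗ e.symm.toLinearMap)
  refine ⟨‖Θ‖₊ ^ 2, fun p hp x hx => ?_⟩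
  have h1 : ‖polyVal (listDeriv L p) x‖ ≤ ‖Ψ ⟨p, hp⟩‖ := (Ψ ⟨p, hp⟩).norm_coe_le_norm ⟨x, hx⟩
  have h2 : Ψ ⟨p, hp⟩ = Θ (e ⟨p, hp⟩) := by simp [Θ]
  have h3 : ‖polyVal (listDeriv L p) x‖ₑ ≤ ‖Θ‖₊ * eLpNorm (polyVal p) 2 μ := by
    have h4 : ‖e ⟨p, hp⟩‖ₑ = eLpNorm (polyVal p) 2 μ := by
      rw [← Lp.enorm_toLp (hm p)]; rfl
    rw [← h4]
    calc ‖polyVal (listDeriv L p) x‖ₑ ≤ ‖Θ (e ⟨p, hp⟩)‖ₑ := by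
          rw [← h2]; exact enorm_le_iff_norm_le.2 h1
      _ ≤ ‖Θ‖ₑ * ‖e ⟨p, hp⟩‖ₑ := Θ.le_opENorm _
  calc ‖polyVal (listDeriv L p) x‖ₑ ^ 2 ≤ (‖Θ‖₊ * eLpNorm (polyVal p) 2 μ) ^ 2 := by gcongr
    _ = _ := by rw [mul_pow, eLpNorm_two_sq, ENNReal.coe_pow]

/-- Scaling `x = z + h y` reduces to the unit case: each derivative costs a factor `h` and the
integral a factor `h ^ d`. The powers of `h` stay on the left, which avoids division in `ℝ≥0∞`. -/
theorem exists_inverse_estimate (d k : ℕ) {σ : ℝ} (R : ℝ) (hσ : 0 < σ) (L : List (Fin d)) :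
    ∃ C : ℝ≥0, ∀ h : ℝ, 0 < h → ∀ p ∈ Poly d k, ∀ z, ∀ x ∈ Metric.closedBall z (R * h),
      ‖polyVal (listDeriv L p) x‖ₑ ^ 2 * ENNReal.ofReal h ^ (d + 2 * L.length) ≤
        C * ∫⁻ y in Metric.ball z (σ * h), ‖polyVal p y‖ₑ ^ 2 := by
  obtain ⟨C, hC⟩ := exists_inverse_estimate_unit d k (R := R) hσ L
  refine ⟨C, fun h hh p hp z x hx => ?_⟩
  have hx' : h⁻¹ • (x - z) ∈ Metric.closedBall (0 : Pt d) R := by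
    rw [mem_closedBall_zero_iff, norm_smul, Real.norm_of_nonneg (by positivity), inv_mul_le_iff₀ hh,
      mul_comm h]
    simpa [dist_eq_norm] using hx
  have h1 := hC _ (affineSubst_mem_Poly z h hp) _ hx'
  rw [listDeriv_affineSubst, polyVal_smul, polyVal_affineSubst, smul_smul,
    mul_inv_cancel₀ hh.ne', one_smul, add_sub_cancel, enorm_mul, mul_pow] at h1
  have h2 : (∫⁻ y in Metric.ball (0 : Pt d) σ, ‖polyVal (affineSubst z h p) y‖ₑ ^ 2) *
      ENNReal.ofReal h ^ d = ∫⁻ y in Metric.ball z (σ * h), ‖polyVal p y‖ₑ ^ 2 := by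
    rw [← lintegral_indicator measurableSet_ball, ← lintegral_indicator measurableSet_ball,
      ← lintegral_comp_affine ((Metric.ball z (σ * h)).indicator _) z hh.ne', abs_of_pos hh]
    congr 1
    refine lintegral_congr fun y => ?_
    have : z + h • y ∈ Metric.ball z (σ * h) ↔ y ∈ Metric.ball (0 : Pt d) σ := by
      rw [mem_ball_iff_norm, add_sub_cancel_left, norm_smul, Real.norm_of_nonneg hh.le,
        mem_ball_zero_iff, mul_comm σ, mul_lt_mul_iff_right₀ hh]
    simp only [Set.indicator_apply, this, polyVal_affineSubst]
  rw [← h2, ← mul_assoc, pow_add, mul_left_comm]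
  have h3 : ‖h ^ L.length‖ₑ ^ 2 = ENNReal.ofReal h ^ (2 * L.length) := by
    rw [enorm_pow, Real.enorm_of_nonneg hh.le, ← pow_mul, mul_comm]
  rw [h3] at h1
  calc _ = (ENNReal.ofReal h ^ (2 * L.length) * ‖polyVal (listDeriv L p) x‖ₑ ^ 2) *
        ENNReal.ofReal h ^ d := by ring
    _ ≤ _ := by gcongr

/-! ### Weak derivatives along lists of directions -/

/-- The partial derivative of a function in the direction `l`. -/
def dirDeriv {d : ℕ} (l : Fin d) (φ : Pt d → ℝ) : Pt d → ℝ :=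
  fun x => fderiv ℝ φ x (EuclideanSpace.single l 1)

/-- The iterated partial derivative of a function along a list of directions. -/
def testDeriv {d : ℕ} (L : List (Fin d)) (φ : Pt d → ℝ) : Pt d → ℝ := L.foldr dirDeriv φ

/-- Test functions on `U`. -/
structure IsTest {d : ℕ} (U : Set (Pt d)) (φ : Pt d → ℝ) : Prop where
  smooth : ContDiff ℝ ((⊤ : ℕ∞) : WithTop ℕ∞) φ
  compact : HasCompactSupport φ
  supp : tsupport φ ⊆ U

/-- `g` is the weak derivative of `f` along the list `L` on `U`. -/
structure IsWeakDeriv {d : ℕ} (U : Set (Pt d)) (f g : Pt d → ℝ) (L : List (Fin d)) : Prop where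
  left : LocallyIntegrableOn f U volume
  right : LocallyIntegrableOn g U volume
  eq : ∀ φ, IsTest U φ →
    ∫ x in U, f x * testDeriv L φ x = (-1) ^ L.length * ∫ x in U, g x * φ x

/-! ### Iterated derivatives of test functions along lists -/

section testDeriv

variable {d : ℕ}

theorem testDeriv_nil (φ : Pt d → ℝ) : testDeriv [] φ = φ := rfl

theorem testDeriv_cons (l : Fin d) (L : List (Fin d)) (φ : Pt d → ℝ) :
    testDeriv (l :: L) φ = dirDeriv l (testDeriv L φ) := rfl

theorem testDeriv_append (L L' : List (Fin d)) (φ : Pt d → ℝ) :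
    testDeriv (L ++ L') φ = testDeriv L (testDeriv L' φ) := List.foldr_append

theorem contDiff_dirDeriv {φ : Pt d → ℝ} (hφ : ContDiff ℝ ((⊤ : ℕ∞) : WithTop ℕ∞) φ)
    (l : Fin d) : ContDiff ℝ ((⊤ : ℕ∞) : WithTop ℕ∞) (dirDeriv l φ) :=
  (hφ.fderiv_right (m := ((⊤ : ℕ∞) : WithTop ℕ∞)) le_rfl).clm_apply contDiff_const

theorem contDiff_testDeriv {φ : Pt d → ℝ} (hφ : ContDiff ℝ ((⊤ : ℕ∞) : WithTop ℕ∞) φ)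
    (L : List (Fin d)) : ContDiff ℝ ((⊤ : ℕ∞) : WithTop ℕ∞) (testDeriv L φ) := by
  induction L with
  | nil => exact hφ
  | cons l L ih => exact contDiff_dirDeriv ih l

theorem IsTest.dirDeriv {U : Set (Pt d)} {φ : Pt d → ℝ} (hφ : IsTest U φ) (l : Fin d) :
    IsTest U (dirDeriv l φ) where
  smooth := contDiff_dirDeriv hφ.smooth l
  compact := hφ.compact.fderiv_apply ℝ _
  supp := (tsupport_fderiv_apply_subset ℝ _).trans hφ.supp

theorem IsTest.testDeriv {U : Set (Pt d)} {φ : Pt d → ℝ} (hφ : IsTest U φ) (L : List (Fin d)) :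
    IsTest U (testDeriv L φ) := by
  induction L with
  | nil => exact hφ
  | cons l L ih => exact ih.dirDeriv l

theorem IsTest.mono {U V : Set (Pt d)} {φ : Pt d → ℝ} (hφ : IsTest U φ) (h : U ⊆ V) :
    IsTest V φ := ⟨hφ.smooth, hφ.compact, hφ.supp.trans h⟩

theorem IsTest.eq_zero {U : Set (Pt d)} {φ : Pt d → ℝ} (hφ : IsTest U φ) {x : Pt d}
    (hx : x ∉ U) : φ x = 0 := image_eq_zero_of_notMem_tsupport fun h => hx (hφ.supp h)

theorem dirDeriv_comm {φ : Pt d → ℝ} (hφ : ContDiff ℝ ((⊤ : ℕ∞) : WithTop ℕ∞) φ) (l m : Fin d) :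
    dirDeriv l (dirDeriv m φ) = dirDeriv m (dirDeriv l φ) := by
  have h1 : Differentiable ℝ (fderiv ℝ φ) :=
    (hφ.fderiv_right (m := ((⊤ : ℕ∞) : WithTop ℕ∞)) le_rfl).differentiable (by simp)
  have h2 : ∀ (l m : Fin d) x, dirDeriv l (dirDeriv m φ) x =
      fderiv ℝ (fderiv ℝ φ) x (EuclideanSpace.single l 1) (EuclideanSpace.single m 1) := by
    intro l m x
    unfold dirDeriv
    rw [fderiv_clm_apply (h1 x) (differentiableAt_const _)]
    simp
  ext x
  rw [h2, h2]
  exact (hφ.contDiffAt (x := x)).isSymmSndFDerivAt (by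
    simpa using (WithTop.coe_le_coe.2 le_top :
      ((2 : ℕ∞) : WithTop ℕ∞) ≤ ((⊤ : ℕ∞) : WithTop ℕ∞))) _ _

theorem testDeriv_perm {L L' : List (Fin d)} (h : L.Perm L') {φ : Pt d → ℝ}
    (hφ : ContDiff ℝ ((⊤ : ℕ∞) : WithTop ℕ∞) φ) : testDeriv L φ = testDeriv L' φ := by
  induction h with
  | nil => rfl
  | cons l _ ih => simp only [testDeriv_cons, ih]
  | swap l m L => exact dirDeriv_comm (contDiff_testDeriv hφ L) _ _
  | trans _ _ ih₁ ih₂ => rw [ih₁, ih₂]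

theorem iteratedFDeriv_single_eq_testDeriv {φ : Pt d → ℝ}
    (hφ : ContDiff ℝ ((⊤ : ℕ∞) : WithTop ℕ∞) φ) {j : ℕ} (i : Fin j → Fin d) (x : Pt d) :
    iteratedFDeriv ℝ j φ x (fun l => EuclideanSpace.single (i l) (1 : ℝ)) =
      testDeriv (List.ofFn i) φ x := by
  induction j generalizing x with
  | zero => simp [testDeriv_nil]
  | succ j ih =>
    have h1 : testDeriv (List.ofFn (Fin.tail i)) φ =
        fun y => iteratedFDeriv ℝ j φ y (fun l => EuclideanSpace.single (Fin.tail i l) (1 : ℝ)) :=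
      funext fun y => (ih _ y).symm
    have h2 : List.ofFn i = i 0 :: List.ofFn (Fin.tail i) := List.ofFn_succ
    rw [iteratedFDeriv_succ_apply_left, h2, testDeriv_cons, h1, dirDeriv,
      fderiv_continuousMultilinear_apply_const_apply
        (hφ.differentiable_iteratedFDeriv (by exact_mod_cast ENat.natCast_lt_top j) x)]
    rfl

/-- The bridge from tuples of directions to lists, which are easier to permute and to extend. -/
theorem hasWeakDeriv_iff {U : Set (Pt d)} {f g : Pt d → ℝ} {j : ℕ} {i : Fin j → Fin d} :
    HasWeakDeriv U f g i ↔ IsWeakDeriv U f g (List.ofFn i) := by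
  constructor
  · rintro ⟨h1, h2, h3⟩
    refine ⟨h1, h2, fun φ hφ => ?_⟩
    rw [List.length_ofFn, ← h3 φ hφ.smooth hφ.compact hφ.supp]
    simp only [iteratedFDeriv_single_eq_testDeriv hφ.smooth]
  · rintro ⟨h1, h2, h3⟩
    refine ⟨h1, h2, fun φ hs hc ht => ?_⟩
    have := h3 φ ⟨hs, hc, ht⟩
    rw [List.length_ofFn] at this
    simp only [iteratedFDeriv_single_eq_testDeriv hs, this]

end testDeriv

namespace IsWeakDeriv

variable {d : ℕ} {U V : Set (Pt d)} {f f' g g' : Pt d → ℝ} {L L' : List (Fin d)}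

theorem _root_.CutFEM.integrableOn_mul_test (hf : LocallyIntegrableOn f U volume)
    {φ : Pt d → ℝ} (hφ : IsTest U φ) : Integrable fun x => f x * φ x := by
  rw [← integrableOn_iff_integrable_of_support_subset (s := tsupport φ)]
  · exact (hf.integrableOn_compact_subset hφ.supp hφ.compact).mul_continuousOn
      hφ.smooth.continuous.continuousOn hφ.compact
  · intro x hx
    exact subset_tsupport _ (right_ne_zero_of_mul hx)

theorem _root_.CutFEM.setIntegral_mul_test {φ : Pt d → ℝ} (hφ : IsTest U φ) (f : Pt d → ℝ) :
    ∫ x in U, f x * φ x = ∫ x, f x * φ x :=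
  setIntegral_eq_integral_of_forall_compl_eq_zero fun x hx => by rw [hφ.eq_zero hx, mul_zero]

theorem mono (h : IsWeakDeriv V f g L) (hUV : U ⊆ V) : IsWeakDeriv U f g L where
  left := h.left.mono_set hUV
  right := h.right.mono_set hUV
  eq φ hφ := by
    rw [setIntegral_mul_test (hφ.testDeriv L), setIntegral_mul_test hφ,
      ← setIntegral_mul_test ((hφ.mono hUV).testDeriv L), ← setIntegral_mul_test (hφ.mono hUV),
      h.eq φ (hφ.mono hUV)]

theorem congr (h : IsWeakDeriv U f g L) (hf : f =ᵐ[volume.restrict U] f')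
    (hg : g =ᵐ[volume.restrict U] g') : IsWeakDeriv U f' g' L where
  left := h.left.congr hf
  right := h.right.congr hg
  eq φ hφ := by
    have h1 : ∀ {a b : Pt d → ℝ}, a =ᵐ[volume.restrict U] b → ∀ ψ : Pt d → ℝ,
        ∫ x in U, b x * ψ x = ∫ x in U, a x * ψ x := fun hab ψ =>
      integral_congr_ae (by filter_upwards [hab] with x hx using by rw [hx])
    rw [h1 hf, h1 hg, h.eq φ hφ]

theorem sub (h : IsWeakDeriv U f g L) (h' : IsWeakDeriv U f' g' L) :
    IsWeakDeriv U (fun x => f x - f' x) (fun x => g x - g' x) L where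
  left := h.left.sub h'.left
  right := h.right.sub h'.right
  eq φ hφ := by
    simp only [sub_mul]
    rw [integral_sub (integrableOn_mul_test h.left (hφ.testDeriv L)).integrableOn
      (integrableOn_mul_test h'.left (hφ.testDeriv L)).integrableOn,
      integral_sub (integrableOn_mul_test h.right hφ).integrableOn
      (integrableOn_mul_test h'.right hφ).integrableOn, h.eq φ hφ, h'.eq φ hφ, mul_sub]

theorem perm (h : IsWeakDeriv U f g L) (hL : L.Perm L') : IsWeakDeriv U f g L' where
  left := h.left
  right := h.right
  eq φ hφ := by rw [← testDeriv_perm hL hφ.smooth, ← hL.length_eq, h.eq φ hφ]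

/-- The fundamental lemma of the calculus of variations, applied to `g - g'`. -/
theorem unique (hU : IsOpen U) (h : IsWeakDeriv U f g L) (h' : IsWeakDeriv U f g' L) :
    g =ᵐ[volume.restrict U] g' := by
  have := IsOpen.ae_eq_zero_of_integral_contDiff_smul_eq_zero (μ := volume) hU
    (h.right.sub h'.right) fun φ hs hc ht => ?_
  · rw [Filter.EventuallyEq, ae_restrict_iff' hU.measurableSet]
    filter_upwards [this] with x hx hxU
    exact sub_eq_zero.1 (hx hxU)
  · have hφ : IsTest U φ := ⟨hs, hc, ht⟩
    have h1 := (h.eq φ hφ).symm.trans (h'.eq φ hφ)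
    rw [setIntegral_mul_test hφ, setIntegral_mul_test hφ] at h1
    have h2 := mul_left_cancel₀ (pow_ne_zero _ (by norm_num : (-1 : ℝ) ≠ 0)) h1
    simp only [smul_eq_mul, Pi.sub_apply, mul_comm (φ _), sub_mul]
    rw [integral_sub (integrableOn_mul_test h.right hφ) (integrableOn_mul_test h'.right hφ), h2,
      sub_self]

/-- A derivative of a test function is again a test function, so the identity for `L ++ [l]` is the
identity for `L` tested with `∂_l φ`. This lets the Poincaré inequality act on one derivative at a
time. -/
theorem next (h : IsWeakDeriv U f g L) {l : Fin d} (h' : IsWeakDeriv U f g' (L ++ [l])) :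
    IsWeakDeriv U g g' [l] where
  left := h.right
  right := h'.right
  eq φ hφ := by
    have h1 := h'.eq φ hφ
    rw [testDeriv_append, h.eq _ (hφ.testDeriv [l]), List.length_append, List.length_singleton,
      pow_succ, mul_assoc] at h1
    simpa using mul_left_cancel₀ (pow_ne_zero _ (by norm_num : (-1 : ℝ) ≠ 0)) h1

theorem nil (hf : LocallyIntegrableOn f U volume) : IsWeakDeriv U f f [] :=
  ⟨hf, hf, fun φ _ => by simp [testDeriv_nil]⟩

theorem ae_eq_of_nil (hU : IsOpen U) (h : IsWeakDeriv U f g []) :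
    f =ᵐ[volume.restrict U] g := (IsWeakDeriv.nil h.left).unique hU h

end IsWeakDeriv

theorem locallyIntegrableOn_polyVal {d : ℕ} (p : MvPolynomial (Fin d) ℝ) (U : Set (Pt d)) :
    LocallyIntegrableOn (polyVal p) U volume :=
  (continuous_polyVal p).locallyIntegrable.locallyIntegrableOn U

theorem integral_polyVal_mul_dirDeriv {d : ℕ} (p : MvPolynomial (Fin d) ℝ) {U : Set (Pt d)}
    {φ : Pt d → ℝ} (hφ : IsTest U φ) (l : Fin d) :
    ∫ x, polyVal p x * dirDeriv l φ x = -∫ x, polyVal (MvPolynomial.pderiv l p) x * φ x := by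
  unfold dirDeriv
  rw [integral_mul_fderiv_eq_neg_fderiv_mul_of_integrable]
  · simp only [fderiv_polyVal_single]
  · simp only [fderiv_polyVal_single]
    exact integrableOn_mul_test (locallyIntegrableOn_polyVal _ U) hφ
  · exact integrableOn_mul_test (locallyIntegrableOn_polyVal _ U) (hφ.dirDeriv l)
  · exact integrableOn_mul_test (locallyIntegrableOn_polyVal _ U) hφ
  · exact fun x _ => (hasFDerivAt_polyVal p x).differentiableAt
  · exact fun x _ => (hφ.smooth.differentiable (by simp)) x

theorem isWeakDeriv_polyVal {d : ℕ} (p : MvPolynomial (Fin d) ℝ) (U : Set (Pt d))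
    (L : List (Fin d)) : IsWeakDeriv U (polyVal p) (polyVal (listDeriv L p)) L where
  left := locallyIntegrableOn_polyVal _ U
  right := locallyIntegrableOn_polyVal _ U
  eq φ hφ := by
    rw [setIntegral_mul_test hφ, setIntegral_mul_test (hφ.testDeriv L)]
    induction L generalizing p with
    | nil => simp [testDeriv_nil, listDeriv_nil]
    | cons l L ih =>
      rw [testDeriv_cons, integral_polyVal_mul_dirDeriv _ (hφ.testDeriv L), ih, listDeriv_cons,
        List.length_cons, pow_succ]
      ring

/-! ### The Poincaré inequality on balls -/

/-- Cauchy–Schwarz against the constant `1`. -/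
theorem sq_lintegral_le {α : Type*} [MeasurableSpace α] (μ : Measure α) {F : α → ℝ≥0∞}
    (hF : AEMeasurable F μ) : (∫⁻ x, F x ∂μ) ^ 2 ≤ μ Set.univ * ∫⁻ x, F x ^ 2 ∂μ := by
  have h := ENNReal.lintegral_mul_le_Lp_mul_Lq μ Real.HolderConjugate.two_two hF
    (aemeasurable_const (b := (1 : ℝ≥0∞)))
  simp only [Pi.mul_apply, mul_one, ENNReal.one_rpow, lintegral_const, one_mul] at h
  have h2 : ∀ a : ℝ≥0∞, (a ^ (1 / 2 : ℝ)) ^ 2 = a := fun a => by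
    rw [← ENNReal.rpow_natCast, ← ENNReal.rpow_mul]; simp
  calc _ ≤ ((∫⁻ x, F x ^ (2 : ℝ) ∂μ) ^ (1 / 2 : ℝ) * (μ Set.univ) ^ (1 / 2 : ℝ)) ^ 2 := by gcongr
    _ = _ := by rw [mul_pow, h2, h2, mul_comm]; simp

/-- The fundamental theorem of calculus along the segment from `y` to `x`, followed by
Cauchy–Schwarz on the unit interval. -/
theorem enorm_sub_sq_le_lintegral {d : ℕ} {f : Pt d → ℝ} (hf : ContDiff ℝ 1 f) {r : ℝ}
    {x y : Pt d} (hxy : dist x y ≤ r) :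
    ‖f x - f y‖ₑ ^ 2 ≤ ENNReal.ofReal r ^ 2 *
      ∫⁻ t in Set.Ioc (0 : ℝ) 1, ‖fderiv ℝ f (y + t • (x - y))‖ₑ ^ 2 := by
  have hcont : Continuous fun t : ℝ => fderiv ℝ f (y + t • (x - y)) :=
    (hf.continuous_fderiv (by simp)).comp (by fun_prop)
  have h1 : f x - f y = ∫ t in (0 : ℝ)..1, fderiv ℝ f (y + t • (x - y)) (x - y) := by
    rw [intervalIntegral.integral_eq_sub_of_hasDerivAt (f := fun t : ℝ => f (y + t • (x - y)))]
    · simp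
    · intro t _
      have h2 : HasDerivAt (fun t : ℝ => y + t • (x - y)) (x - y) t := by
        simpa using ((hasDerivAt_id t).smul_const (x - y)).const_add y
      exact ((hf.differentiable (by simp)) _).hasFDerivAt.comp_hasDerivAt t h2
    · exact (hcont.clm_apply continuous_const).intervalIntegrable _ _
  rw [h1, intervalIntegral.integral_of_le zero_le_one]
  have h3 : ‖∫ t in Set.Ioc (0 : ℝ) 1, fderiv ℝ f (y + t • (x - y)) (x - y)‖ₑ ≤
      ENNReal.ofReal r * ∫⁻ t in Set.Ioc (0 : ℝ) 1, ‖fderiv ℝ f (y + t • (x - y))‖ₑ := by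
    refine (enorm_integral_le_lintegral_enorm _).trans ?_
    rw [← lintegral_const_mul' _ _ ENNReal.ofReal_ne_top]
    refine lintegral_mono fun t => ?_
    refine (ContinuousLinearMap.le_opENorm _ _).trans ?_
    rw [mul_comm]
    gcongr
    rw [← ofReal_norm]
    exact ENNReal.ofReal_le_ofReal (by rwa [← dist_eq_norm])
  calc _ ≤ (ENNReal.ofReal r *
        ∫⁻ t in Set.Ioc (0 : ℝ) 1, ‖fderiv ℝ f (y + t • (x - y))‖ₑ) ^ 2 := by gcongr
    _ ≤ _ := by
      rw [mul_pow]
      gcongr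
      refine (sq_lintegral_le _ hcont.enorm.measurable.aemeasurable).trans ?_
      simp

theorem lintegral_comp_affine_le {d : ℕ} (F : Pt d → ℝ≥0∞) (a : Pt d) {t : ℝ}
    (ht : 1 / 2 ≤ t) : ∫⁻ x, F (a + t • x) ≤ 2 ^ d * ∫⁻ x, F x := by
  rw [← lintegral_comp_affine F a (by linarith : t ≠ 0), abs_of_nonneg (by linarith),
    mul_left_comm, ← mul_pow]
  refine le_mul_of_one_le_right' (one_le_pow₀ ?_)
  rw [← ENNReal.ofReal_ofNat 2, ← ENNReal.ofReal_mul (by norm_num), ENNReal.one_le_ofReal]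
  linarith

/-- At the point `(1 - t) y + t x` one of the two weights is at least `1/2`. Substituting in the
variable with that weight costs a Jacobian factor of at most `2 ^ d`, uniformly in `t`; the other
variable contributes the volume of `B`. -/
theorem lintegral_segment_le {d : ℕ} {G : Pt d → ℝ≥0∞} (hG : Measurable G) (B : Set (Pt d))
    (t : ℝ) :
    ∫⁻ x in B, ∫⁻ y in B, G (y + t • (x - y)) ≤ 2 ^ d * volume B * ∫⁻ w, G w := by
  have key : ∀ s : ℝ, 1 / 2 ≤ s →
      ∫⁻ x in B, ∫⁻ y in B, G ((1 - s) • x + s • y) ≤ 2 ^ d * volume B * ∫⁻ w, G w := by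
    intro s hs
    calc ∫⁻ x in B, ∫⁻ y in B, G ((1 - s) • x + s • y)
        ≤ ∫⁻ x in B, 2 ^ d * ∫⁻ w, G w :=
          lintegral_mono fun x => (setLIntegral_le_lintegral _ _).trans
            (lintegral_comp_affine_le G _ hs)
      _ = _ := by simp; ring
  rcases le_total (1 / 2) t with ht | ht
  · rw [lintegral_lintegral_swap (Measurable.aemeasurable (by fun_prop))]
    refine (key t ht).trans' (le_of_eq ?_)
    refine lintegral_congr fun y => lintegral_congr fun x => congrArg G ?_
    module
  · refine (key (1 - t) (by linarith)).trans' (le_of_eq ?_)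
    refine lintegral_congr fun y => lintegral_congr fun x => congrArg G ?_
    module

/-- Convexity keeps each segment inside the ball, so the gradient may be cut off outside it.
Exchanging the integrals leaves the estimate at fixed `t` from `lintegral_segment_le`. -/
theorem lintegral_enorm_sub_sq_le_of_contDiff {d : ℕ} {f : Pt d → ℝ} (hf : ContDiff ℝ 1 f)
    (z : Pt d) (s : ℝ) :
    ∫⁻ x in Metric.ball z s, ∫⁻ y in Metric.ball z s, ‖f x - f y‖ₑ ^ 2 ≤
      ENNReal.ofReal (2 * s) ^ 2 * 2 ^ d * volume (Metric.ball z s) *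
        ∫⁻ w in Metric.ball z s, ‖fderiv ℝ f w‖ₑ ^ 2 := by
  set B := Metric.ball z s
  let G : Pt d → ℝ≥0∞ := B.indicator fun w => ‖fderiv ℝ f w‖ₑ ^ 2
  have hG : Measurable G := Measurable.indicator
    ((hf.continuous_fderiv (by simp)).enorm.measurable.pow_const 2) measurableSet_ball
  have h1 : ∀ x ∈ B, ∀ y ∈ B, ‖f x - f y‖ₑ ^ 2 ≤ ENNReal.ofReal (2 * s) ^ 2 *
      ∫⁻ t in Set.Ioc (0 : ℝ) 1, G (y + t • (x - y)) := by
    intro x hx y hy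
    refine (enorm_sub_sq_le_lintegral hf (r := 2 * s) ?_).trans ?_
    · have := dist_triangle_right x y z
      rw [Metric.mem_ball] at hx hy
      linarith
    · gcongr ENNReal.ofReal (2 * s) ^ 2 * ?_
      refine setLIntegral_mono_ae' measurableSet_Ioc (Filter.Eventually.of_forall fun t ht => ?_)
      have : y + t • (x - y) ∈ B :=
        (convex_ball z s).add_smul_sub_mem hy hx ⟨ht.1.le, ht.2⟩
      simp [G, this]
  calc _ ≤ ∫⁻ x in B, ∫⁻ y in B, ENNReal.ofReal (2 * s) ^ 2 *
        ∫⁻ t in Set.Ioc (0 : ℝ) 1, G (y + t • (x - y)) :=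
        setLIntegral_mono' measurableSet_ball fun x hx =>
          setLIntegral_mono' measurableSet_ball fun y hy => h1 x hx y hy
    _ = ENNReal.ofReal (2 * s) ^ 2 * ∫⁻ t in Set.Ioc (0 : ℝ) 1, ∫⁻ x in B, ∫⁻ y in B,
        G (y + t • (x - y)) := by
        have hne : ENNReal.ofReal (2 * s) ^ 2 ≠ ∞ := ENNReal.pow_ne_top ENNReal.ofReal_ne_top
        simp only [lintegral_const_mul' _ _ hne]
        congr 1
        rw [lintegral_lintegral_swap
          (f := fun (t : ℝ) (x : Pt d) => ∫⁻ y in B, G (y + t • (x - y)))]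
        · refine lintegral_congr fun x => ?_
          rw [lintegral_lintegral_swap (Measurable.aemeasurable (by fun_prop))]
        · refine Measurable.aemeasurable (Measurable.lintegral_prod_right'
            (f := fun p : (ℝ × Pt d) × Pt d => G (p.2 + p.1.1 • (p.1.2 - p.2))) (by fun_prop))
    _ ≤ ENNReal.ofReal (2 * s) ^ 2 * ∫⁻ t in Set.Ioc (0 : ℝ) 1,
        2 ^ d * volume B * ∫⁻ w, G w := by
        gcongr with t
        exact lintegral_segment_le hG B t
    _ = _ := by
        rw [lintegral_indicator measurableSet_ball]
        simp; ring

/-- The operator norm of a functional is at most the Euclidean norm of its components. -/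
theorem enorm_clm_sq_le_sum {d : ℕ} (A : Pt d →L[ℝ] ℝ) :
    ‖A‖ₑ ^ 2 ≤ ∑ l, ‖A (EuclideanSpace.single l 1)‖ₑ ^ 2 := by
  have h1 : ‖A‖ ≤ √(∑ l, ‖A (EuclideanSpace.single l 1)‖ ^ 2) := by
    refine A.opNorm_le_bound (Real.sqrt_nonneg _) fun v => ?_
    have hv : A v = ∑ l, A (EuclideanSpace.single l 1) * v l := by
      conv_lhs => rw [← (EuclideanSpace.basisFun (Fin d) ℝ).sum_repr v]
      simp [map_sum, mul_comm]
    rw [hv, EuclideanSpace.norm_eq, Real.norm_eq_abs]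
    refine (Finset.abs_sum_le_sum_abs _ _).trans ?_
    simp only [abs_mul]
    simpa using Real.sum_mul_le_sqrt_mul_sqrt Finset.univ
      (fun l => |A (EuclideanSpace.single l 1)|) fun l => |v l|
  have h2 : ‖A‖ ^ 2 ≤ ∑ l, ‖A (EuclideanSpace.single l 1)‖ ^ 2 := by
    calc _ ≤ √(∑ l, ‖A (EuclideanSpace.single l 1)‖ ^ 2) ^ 2 := by gcongr
      _ = _ := Real.sq_sqrt (Finset.sum_nonneg fun _ _ => by positivity)
  rw [← ofReal_norm, ← ENNReal.ofReal_pow (norm_nonneg _)]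
  simp only [← ofReal_norm (A _), ← ENNReal.ofReal_pow (norm_nonneg (A _))]
  rw [← ENNReal.ofReal_sum_of_nonneg fun _ _ => by positivity]
  exact ENNReal.ofReal_le_ofReal h2

/-! ### Mollification -/

section mollifier

variable {d : ℕ} (η : ContDiffBump (0 : Pt d))

theorem lintegral_bump : ∫⁻ t, ENNReal.ofReal (η.normed volume t) = 1 := by
  rw [← ofReal_integral_eq_lintegral_ofReal η.integrable_normed
    (Filter.Eventually.of_forall fun x => η.nonneg_normed x), η.integral_normed,
    ENNReal.ofReal_one]

theorem lintegral_bump_sub (x : Pt d) :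
    ∫⁻ t, ENNReal.ofReal (η.normed volume (x - t)) = 1 :=
  (lintegral_sub_left_eq_self (fun t => ENNReal.ofReal (η.normed volume t)) x).trans
    (lintegral_bump η)

theorem lintegral_bump_sub' (t : Pt d) :
    ∫⁻ x, ENNReal.ofReal (η.normed volume (x - t)) = 1 :=
  (lintegral_sub_right_eq_self (fun t => ENNReal.ofReal (η.normed volume t)) t).trans
    (lintegral_bump η)

/-- Jensen's inequality for the probability density `t ↦ η (x - t)`, then Fubini, since the bump
also integrates to `1` in `x`. -/
theorem lintegral_mollify_sq_le {G : Pt d → ℝ} (hG : AEStronglyMeasurable G volume) :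
    ∫⁻ x, ‖∫ t, G t * η.normed volume (x - t)‖ₑ ^ 2 ≤ ∫⁻ t, ‖G t‖ₑ ^ 2 := by
  have hη : Measurable fun t => ENNReal.ofReal (η.normed volume t) :=
    (η.continuous_normed).measurable.ennreal_ofReal
  have h1 : ∀ x, ‖∫ t, G t * η.normed volume (x - t)‖ₑ ^ 2 ≤
      ∫⁻ t, ENNReal.ofReal (η.normed volume (x - t)) * ‖G t‖ₑ ^ 2 := by
    intro x
    have hm : Measurable fun t => ENNReal.ofReal (η.normed volume (x - t)) :=
      hη.comp (measurable_const.sub measurable_id)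
    calc _ ≤ (∫⁻ t, ENNReal.ofReal (η.normed volume (x - t)) * ‖G t‖ₑ) ^ 2 := by
          gcongr
          refine (enorm_integral_le_lintegral_enorm _).trans (le_of_eq ?_)
          refine lintegral_congr fun t => ?_
          rw [enorm_mul, mul_comm, Real.enorm_of_nonneg (η.nonneg_normed _)]
      _ = (∫⁻ t, ‖G t‖ₑ ∂(volume.withDensity
            fun t => ENNReal.ofReal (η.normed volume (x - t)))) ^ 2 := by
          rw [lintegral_withDensity_eq_lintegral_mul₀ hm.aemeasurable hG.enorm]
          rfl
      _ ≤ _ := by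
          refine (sq_lintegral_le _ (hG.enorm.mono_ac (withDensity_absolutelyContinuous _ _))).trans
            (le_of_eq ?_)
          rw [lintegral_withDensity_eq_lintegral_mul₀ hm.aemeasurable (hG.enorm.pow_const 2),
            withDensity_apply _ MeasurableSet.univ, Measure.restrict_univ, lintegral_bump_sub,
            one_mul]
          rfl
  refine (lintegral_mono h1).trans ?_
  rw [lintegral_lintegral_swap]
  · refine le_of_eq (lintegral_congr fun t => ?_)
    have hm : Measurable fun x => ENNReal.ofReal (η.normed volume (x - t)) :=
      hη.comp (measurable_id.sub measurable_const)
    rw [lintegral_mul_const _ hm, lintegral_bump_sub', one_mul]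
  · refine AEMeasurable.mul (hη.comp (measurable_fst.sub measurable_snd)).aemeasurable ?_
    exact (hG.enorm.pow_const 2).comp_snd

theorem contDiff_mollify {F : Pt d → ℝ} (hF : LocallyIntegrable F volume) :
    ContDiff ℝ 1 fun x => ∫ t, F t * η.normed volume (x - t) :=
  η.hasCompactSupport_normed.contDiff_convolution_right (ContinuousLinearMap.lsmul ℝ ℝ) hF
    (η.contDiff_normed (n := 1))

theorem fderiv_mollify {F : Pt d → ℝ} (hF : LocallyIntegrable F volume) (x v : Pt d) :
    fderiv ℝ (fun x => ∫ t, F t * η.normed volume (x - t)) x v =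
      ∫ t, F t * fderiv ℝ (η.normed volume) (x - t) v := by
  have h := η.hasCompactSupport_normed (μ := volume)|>.hasFDerivAt_convolution_right
    (ContinuousLinearMap.lsmul ℝ ℝ) hF (η.contDiff_normed (n := 1)) x
  have h2 := h.fderiv
  have h3 := congrArg (fun A : Pt d →L[ℝ] ℝ => A v) h2
  rw [convolution_precompR_apply _ hF (η.hasCompactSupport_normed.fderiv ℝ)
    ((η.contDiff_normed (n := 1)).continuous_fderiv (by simp))] at h3
  exact h3

theorem isTest_bump_sub {U : Set (Pt d)} {x : Pt d} (hx : Metric.closedBall x η.rOut ⊆ U) :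
    IsTest U fun t => η.normed volume (x - t) := by
  have h1 : tsupport (fun t => η.normed volume (x - t)) ⊆ Metric.closedBall x η.rOut := by
    refine closure_minimal (fun t ht => ?_) Metric.isClosed_closedBall
    have : x - t ∈ Function.support (η.normed volume) := ht
    rw [η.support_normed_eq, mem_ball_zero_iff, ← dist_eq_norm, dist_comm] at this
    exact this.le
  exact ⟨η.contDiff_normed.comp (contDiff_const.sub contDiff_id),
    HasCompactSupport.of_support_subset_isCompact (isCompact_closedBall x η.rOut)
      ((subset_tsupport _).trans h1), h1.trans hx⟩

/-- As long as the mollification ball stays in `U`, the function `t ↦ η (x - t)` is a test function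
on `U`; the two minus signs, one from `x - t` and one from integration by parts, cancel. -/
theorem fderiv_mollify_of_isWeakDeriv {U : Set (Pt d)} (hU : MeasurableSet U) {f g : Pt d → ℝ}
    {l : Fin d} (hf : IntegrableOn f U) (h : IsWeakDeriv U f g [l]) {x : Pt d}
    (hx : Metric.closedBall x η.rOut ⊆ U) :
    fderiv ℝ (fun x => ∫ t, U.indicator f t * η.normed volume (x - t)) x
      (EuclideanSpace.single l 1) = ∫ t, U.indicator g t * η.normed volume (x - t) := by
  rw [fderiv_mollify η (hf.integrable_indicator hU).locallyIntegrable]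
  have h1 := h.eq _ (isTest_bump_sub η hx)
  have h2 : ∀ t, testDeriv [l] (fun t => η.normed volume (x - t)) t =
      -fderiv ℝ (η.normed volume) (x - t) (EuclideanSpace.single l 1) := by
    intro t
    change fderiv ℝ (fun t => η.normed volume (x - t)) t _ = _
    have h3 : HasFDerivAt (fun t => η.normed volume (x - t)) _ t := ((η.contDiff_normed (μ := volume) (n := 1)).differentiable (by simp)
      (x - t)).hasFDerivAt.comp t ((hasFDerivAt_id t).const_sub x)
    rw [h3.fderiv]
    simp
  simp only [h2, List.length_singleton, pow_one, neg_mul, one_mul, mul_neg, integral_neg,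
    neg_inj] at h1
  have h3 : ∀ (a b : Pt d → ℝ), ∫ t, U.indicator a t * b t = ∫ t in U, a t * b t := by
    intro a b
    rw [← integral_indicator hU]
    refine integral_congr_ae (Filter.Eventually.of_forall fun t => ?_)
    simp [Set.indicator_apply, ite_mul]
  rw [h3, h3, h1]

end mollifier

/-- The smooth inequality holds for the mollifications on slightly smaller balls with a bound that
does not depend on the mollification. They converge to `f` almost everywhere, and Fatou's lemma,
used once for each variable, passes to the limit. -/
theorem lintegral_enorm_sub_sq_le_of_isWeakDeriv {d : ℕ} {z : Pt d} {R : ℝ} {f : Pt d → ℝ}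
    {G : Fin d → Pt d → ℝ} (hf : IntegrableOn f (Metric.ball z R))
    (hG : ∀ l, IntegrableOn (G l) (Metric.ball z R))
    (hw : ∀ l, IsWeakDeriv (Metric.ball z R) f (G l) [l]) :
    ∫⁻ x in Metric.ball z R, ∫⁻ y in Metric.ball z R, ‖f x - f y‖ₑ ^ 2 ≤
      ENNReal.ofReal (2 * R) ^ 2 * 2 ^ d * volume (Metric.ball z R) *
        ∑ l, ∫⁻ w in Metric.ball z R, ‖G l w‖ₑ ^ 2 := by
  rcases le_or_gt R 0 with hR | hR
  · simp [Metric.ball_eq_empty.2 hR]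
  set B := Metric.ball z R with hB
  have hBm : MeasurableSet B := measurableSet_ball
  have hFi : LocallyIntegrable (B.indicator f) volume :=
    (hf.integrable_indicator hBm).locallyIntegrable
  -- The offset `2` keeps every radius at most `R / 2`, and in particular below `R`.
  let ε : ℕ → ℝ := fun n => R / (n + 2)
  have hε : ∀ n, 0 < ε n := fun n => by positivity
  -- The ratio of outer to inner radius is always `2`, as the almost everywhere convergence below
  -- requires a bounded ratio (`K := 2`).
  let η : ℕ → ContDiffBump (0 : Pt d) := fun n => ⟨ε n / 2, ε n, by linarith [hε n],
    by linarith [hε n]⟩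
  let F : ℕ → Pt d → ℝ := fun n x => ∫ t, B.indicator f t * (η n).normed volume (x - t)
  have hFc : ∀ n, ContDiff ℝ 1 (F n) := fun n => contDiff_mollify (η n) hFi
  let Bn : ℕ → Set (Pt d) := fun n => Metric.ball z (R - ε n)
  have hBnm : ∀ n, MeasurableSet (Bn n) := fun n => measurableSet_ball
  have hBnB : ∀ n, Bn n ⊆ B := fun n => Metric.ball_subset_ball (by linarith [hε n])
  have hε0 : Filter.Tendsto ε Filter.atTop (nhds 0) := by
    have := (tendsto_const_div_atTop_nhds_zero_nat R).comp (Filter.tendsto_add_atTop_nat 2)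
    refine this.congr fun n => ?_
    simp [ε]
  have hbound : ∀ n, ∫⁻ x in Bn n, ∫⁻ y in Bn n, ‖F n x - F n y‖ₑ ^ 2 ≤
      ENNReal.ofReal (2 * R) ^ 2 * 2 ^ d * volume B * ∑ l, ∫⁻ w in B, ‖G l w‖ₑ ^ 2 := by
    intro n
    refine (lintegral_enorm_sub_sq_le_of_contDiff (hFc n) z (R - ε n)).trans ?_
    gcongr ?_ ^ 2 * _ * ?_ * ?_
    · exact ENNReal.ofReal_le_ofReal (by linarith [hε n])
    · exact measure_mono (hBnB n)
    · calc ∫⁻ w in Bn n, ‖fderiv ℝ (F n) w‖ₑ ^ 2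
          ≤ ∫⁻ w in Bn n, ∑ l, ‖∫ t, B.indicator (G l) t * (η n).normed volume (w - t)‖ₑ ^ 2 := by
            refine setLIntegral_mono' measurableSet_ball fun w hw' => ?_
            refine (enorm_clm_sq_le_sum _).trans (le_of_eq (Finset.sum_congr rfl fun l _ => ?_))
            rw [fderiv_mollify_of_isWeakDeriv (η n) hBm hf (hw l)]
            intro y hy
            rw [Metric.mem_ball] at hw' ⊢
            have := dist_triangle y w z
            have h2 : dist y w ≤ ε n := hy
            linarith
        _ ≤ ∑ l, ∫⁻ w, ‖∫ t, B.indicator (G l) t * (η n).normed volume (w - t)‖ₑ ^ 2 := by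
            refine (setLIntegral_le_lintegral _ _).trans ?_
            rw [lintegral_finsetSum _ fun l _ => ?_]
            exact (((contDiff_mollify (η n)
              ((hG l).integrable_indicator hBm).locallyIntegrable).continuous).enorm.measurable).pow_const 2
        _ ≤ _ := by
            refine Finset.sum_le_sum fun l _ => ?_
            refine (lintegral_mollify_sq_le (η n) ?_).trans (le_of_eq ?_)
            · exact (aestronglyMeasurable_indicator_iff hBm).2 ((hw l).right.aestronglyMeasurable)
            · rw [← lintegral_indicator hBm]
              refine lintegral_congr fun t => ?_
              by_cases ht : t ∈ B <;> simp [ht]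
  -- Truncation to `Bn n ×ˢ Bn n` puts all the integrands on the whole space, where Fatou's lemma
  -- applies; each pair of points of `B` is eventually inside.
  let H : ℕ → Pt d → Pt d → ℝ≥0∞ := fun n x y =>
    (Bn n ×ˢ Bn n).indicator (fun p => ‖F n p.1 - F n p.2‖ₑ ^ 2) (x, y)
  have hHm : ∀ n, Measurable (Function.uncurry (H n)) := fun n => by
    refine Measurable.indicator ?_ (measurableSet_ball.prod measurableSet_ball)
    exact ((((hFc n).continuous.comp continuous_fst).sub
      ((hFc n).continuous.comp continuous_snd)).enorm.measurable).pow_const 2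
  have hH : ∀ n, ∫⁻ x, ∫⁻ y, H n x y ≤
      ENNReal.ofReal (2 * R) ^ 2 * 2 ^ d * volume B * ∑ l, ∫⁻ w in B, ‖G l w‖ₑ ^ 2 := by
    intro n
    refine (hbound n).trans' (le_of_eq ?_)
    rw [← lintegral_indicator (hBnm n)]
    refine lintegral_congr fun x => ?_
    by_cases hx : x ∈ Bn n
    · rw [Set.indicator_of_mem hx, ← lintegral_indicator (hBnm n)]
      refine lintegral_congr fun y => ?_
      by_cases hy : y ∈ Bn n <;> simp [H, hx, hy]
    · simp [H, hx]
  have hconv : ∀ᵐ x, Filter.Tendsto (fun n => F n x) Filter.atTop (nhds (B.indicator f x)) := by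
    have := ContDiffBump.ae_convolution_tendsto_right_of_locallyIntegrable (φ := η)
      (l := Filter.atTop) (K := 2) (μ := volume) hε0
      (Filter.Eventually.of_forall fun n => by change ε n ≤ 2 * (ε n / 2); linarith) hFi
    filter_upwards [this] with x hx
    refine hx.congr fun n => ?_
    rw [convolution_eq_swap]
    refine integral_congr_ae (Filter.Eventually.of_forall fun t => ?_)
    simp [mul_comm]
  have hBev : ∀ x ∈ B, ∀ᶠ n in Filter.atTop, x ∈ Bn n := by
    intro x hx
    have : 0 < R - dist x z := by linarith [Metric.mem_ball.1 hx]
    filter_upwards [hε0.eventually (gt_mem_nhds this)] with n hn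
    rw [Metric.mem_ball]
    linarith
  have hlim : ∀ᵐ x, ∀ᵐ y, x ∈ B → y ∈ B →
      ‖f x - f y‖ₑ ^ 2 ≤ Filter.liminf (fun n => H n x y) Filter.atTop := by
    filter_upwards [hconv] with x hx
    filter_upwards [hconv] with y hy hxB hyB
    rw [Set.indicator_of_mem hxB] at hx
    rw [Set.indicator_of_mem hyB] at hy
    have h1 : Filter.Tendsto (fun n => ‖F n x - F n y‖ₑ ^ 2) Filter.atTop
        (nhds (‖f x - f y‖ₑ ^ 2)) := ENNReal.Tendsto.pow (hx.sub hy).enorm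
    have h2 : Filter.Tendsto (fun n => H n x y) Filter.atTop (nhds (‖f x - f y‖ₑ ^ 2)) := by
      refine h1.congr' ?_
      filter_upwards [hBev x hxB, hBev y hyB] with n h3 h4
      simp [H, h3, h4]
    exact h2.liminf_eq.ge
  calc ∫⁻ x in B, ∫⁻ y in B, ‖f x - f y‖ₑ ^ 2
      ≤ ∫⁻ x, ∫⁻ y, Filter.liminf (fun n => H n x y) Filter.atTop := by
        rw [← lintegral_indicator hBm]
        refine lintegral_mono_ae ?_
        filter_upwards [hlim] with x hx
        by_cases hxB : x ∈ B
        · rw [Set.indicator_of_mem hxB, ← lintegral_indicator hBm]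
          refine lintegral_mono_ae ?_
          filter_upwards [hx] with y hy
          by_cases hyB : y ∈ B
          · rw [Set.indicator_of_mem hyB]; exact hy hxB hyB
          · simp [hyB]
        · simp [hxB]
    _ ≤ ∫⁻ x, Filter.liminf (fun n => ∫⁻ y, H n x y) Filter.atTop :=
        lintegral_mono fun x => lintegral_liminf_le fun n => (hHm n).of_uncurry_left
    _ ≤ Filter.liminf (fun n => ∫⁻ x, ∫⁻ y, H n x y) Filter.atTop :=
        lintegral_liminf_le fun n => (hHm n).lintegral_prod_right'
    _ ≤ _ := Filter.liminf_le_of_le (by isBoundedDefault) fun b hb => by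
        obtain ⟨n, hn⟩ := hb.exists
        exact hn.trans (hH n)

/-- The Poincaré inequality on a ball, for functions of mean zero. -/
theorem poincare_ball {d : ℕ} {z : Pt d} {R : ℝ} {f : Pt d → ℝ} {G : Fin d → Pt d → ℝ}
    (hf : IntegrableOn f (Metric.ball z R))
    (hG : ∀ l, IntegrableOn (G l) (Metric.ball z R))
    (hw : ∀ l, IsWeakDeriv (Metric.ball z R) f (G l) [l])
    (hmean : ∫ x in Metric.ball z R, f x = 0) :
    ∫⁻ x in Metric.ball z R, ‖f x‖ₑ ^ 2 ≤ ENNReal.ofReal (2 * R) ^ 2 * 2 ^ d *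
      ∑ l, ∫⁻ x in Metric.ball z R, ‖G l x‖ₑ ^ 2 := by
  rcases le_or_gt R 0 with hR | hR
  · simp [Metric.ball_eq_empty.2 hR]
  set B := Metric.ball z R with hB
  have hV0 : volume B ≠ 0 := (Metric.measure_ball_pos volume z hR).ne'
  have hVt : volume B ≠ ⊤ := measure_ball_lt_top.ne
  have : IsFiniteMeasure (volume.restrict B) := ⟨by simpa using hVt.lt_top⟩
  -- The mean is zero, so averaging `f x - f y` over `y` returns `f x`; Cauchy–Schwarz then reduces
  -- to the double integral.
  have h1 : ∀ x, volume B * ‖f x‖ₑ ^ 2 ≤ ∫⁻ y in B, ‖f x - f y‖ₑ ^ 2 := by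
    intro x
    have h2 : (volume B).toReal * f x = ∫ y in B, (f x - f y) := by
      rw [integral_sub (integrable_const _) hf, hmean]
      simp [Measure.real]
    have h3 : volume B * ‖f x‖ₑ ≤ ∫⁻ y in B, ‖f x - f y‖ₑ := by
      refine le_trans (le_of_eq ?_) (enorm_integral_le_lintegral_enorm _)
      rw [← h2, enorm_mul, Real.enorm_of_nonneg ENNReal.toReal_nonneg, ENNReal.ofReal_toReal hVt]
    have h4 : (volume B * ‖f x‖ₑ) ^ 2 ≤ volume B * ∫⁻ y in B, ‖f x - f y‖ₑ ^ 2 := by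
      calc _ ≤ (∫⁻ y in B, ‖f x - f y‖ₑ) ^ 2 := by gcongr
        _ ≤ _ := by
          refine (sq_lintegral_le _ ?_).trans (by simp)
          exact (aestronglyMeasurable_const.sub hf.aestronglyMeasurable).enorm
    rw [mul_pow, sq (volume B), mul_assoc] at h4
    exact (ENNReal.mul_le_mul_iff_right hV0 hVt).1 h4
  have h5 : volume B * ∫⁻ x in B, ‖f x‖ₑ ^ 2 ≤ volume B * (ENNReal.ofReal (2 * R) ^ 2 * 2 ^ d *
      ∑ l, ∫⁻ x in B, ‖G l x‖ₑ ^ 2) := by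
    rw [← lintegral_const_mul' _ _ hVt]
    refine (lintegral_mono h1).trans
      ((lintegral_enorm_sub_sq_le_of_isWeakDeriv hf hG hw).trans (le_of_eq ?_))
    ring
  exact (ENNReal.mul_le_mul_iff_right hV0 hVt).1 h5

/-! ### Polynomial approximation on balls -/

theorem integrableOn_polyVal {d : ℕ} (p : MvPolynomial (Fin d) ℝ) {s : Set (Pt d)}
    (hs : Bornology.IsBounded s) : IntegrableOn (polyVal p) s := by
  obtain ⟨r, hr⟩ := hs.subset_closedBall 0
  exact ((continuous_polyVal p).continuousOn.integrableOn_compact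
    (isCompact_closedBall (0 : Pt d) r)).mono_set hr

/-- Induction on the degree: the partial derivatives satisfy the same condition one degree lower,
hence vanish, and a constant with integral zero is zero. -/
theorem eq_zero_of_moments_eq_zero {d k : ℕ} {z : Pt d} {R : ℝ} (hR : 0 < R)
    {q : MvPolynomial (Fin d) ℝ} (hq : q ∈ Poly d k)
    (h : ∀ L : List (Fin d), L.length ≤ k →
      ∫ x in Metric.ball z R, polyVal (listDeriv L q) x = 0) : q = 0 := by
  have hV : volume.real (Metric.ball z R) ≠ 0 :=
    (ENNReal.toReal_pos (Metric.measure_ball_pos volume z hR).ne' measure_ball_lt_top.ne).ne'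
  have hconst : ∀ p : MvPolynomial (Fin d) ℝ, p = MvPolynomial.C (p.coeff 0) →
      ∫ x in Metric.ball z R, polyVal p x = 0 → p = 0 := by
    intro p hC h0
    rw [hC] at h0
    simp only [polyVal_C, integral_const, MeasurableSet.univ, measureReal_restrict_apply,
      Set.univ_inter, smul_eq_mul, mul_eq_zero] at h0
    rw [hC, h0.resolve_left hV, map_zero]
  induction k generalizing q with
  | zero => exact hconst q (eq_C_of_mem_Poly_zero hq) (h [] le_rfl)
  | succ k ih =>
    refine hconst q (eq_C_of_pderiv_eq_zero fun l => ih (pderiv_mem_Poly hq l) fun L hL => ?_)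
      (h [] (Nat.zero_le _))
    exact h (l :: L) (by simpa using hL)

/-- A square linear system, with one unknown coefficient and one condition for each exponent of
total degree at most `k`. Uniqueness (`eq_zero_of_moments_eq_zero`) therefore gives existence. -/
theorem exists_poly_with_moments {d k : ℕ} {z : Pt d} {R : ℝ} (hR : 0 < R)
    (c : (Fin d →₀ ℕ) → ℝ) :
    ∃ q ∈ Poly d k, ∀ n : Fin d →₀ ℕ, (n.sum fun _ e => e) ≤ k →
      ∫ x in Metric.ball z R, polyVal (listDeriv n.toMultiset.toList q) x = c n := by
  let s : Set (Fin d →₀ ℕ) := {n | (n.sum fun _ e => e) ≤ k}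
  let b : Module.Basis s ℝ (Poly d k) := MvPolynomial.basisRestrictSupport ℝ s
  have : Finite s := Module.Finite.finite_basis b
  have : Fintype s := Fintype.ofFinite s
  let A : Poly d k →ₗ[ℝ] (s → ℝ) :=
    { toFun := fun q n => ∫ x in Metric.ball z R, polyVal (listDeriv n.1.toMultiset.toList q) x
      map_add' := fun p q => by
        ext n
        simp only [Submodule.coe_add, map_add, polyVal_add, Pi.add_apply]
        exact integral_add (integrableOn_polyVal _ Metric.isBounded_ball)
          (integrableOn_polyVal _ Metric.isBounded_ball)
      map_smul' := fun a p => by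
        ext n
        simp [integral_const_mul] }
  have hinj : Function.Injective A := by
    rw [injective_iff_map_eq_zero]
    rintro ⟨q, hq⟩ h0
    refine Subtype.ext (eq_zero_of_moments_eq_zero (z := z) hR hq fun L hL => ?_)
    have hn : (Multiset.toFinsupp (L : Multiset (Fin d))).sum (fun _ e => e) ≤ k :=
      (Finsupp.card_toMultiset _).symm.trans_le (by simpa using hL)
    have h1 := congrFun h0 ⟨_, hn⟩
    have h2 : L.Perm (Multiset.toFinsupp (L : Multiset (Fin d))).toMultiset.toList := by
      rw [← Multiset.coe_eq_coe]; simp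
    rw [listDeriv_perm h2]
    exact h1
  have hsurj : Function.Surjective A :=
    (LinearMap.injective_iff_surjective_of_finrank_eq_finrank
      (by rw [Module.finrank_eq_card_basis b, Module.finrank_fintype_fun_eq_card])).1 hinj
  obtain ⟨⟨q, hq⟩, hAq⟩ := hsurj fun n => c n.1
  exact ⟨q, hq, fun n hn => congrFun hAq ⟨n, hn⟩⟩

theorem sum_tuple_succ {d j : ℕ} {M : Type*} [AddCommMonoid M] (F : (Fin (j + 1) → Fin d) → M) :
    ∑ i, F i = ∑ i : Fin j → Fin d, ∑ l : Fin d, F (Fin.snoc (α := fun _ => Fin d) i l) := by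
  rw [← (Fin.snocEquiv fun _ => Fin d).sum_comp, Fintype.sum_prod_type, Finset.sum_comm]
  rfl

theorem ofFn_snoc {α : Type*} {j : ℕ} (i : Fin j → α) (l : α) :
    List.ofFn (Fin.snoc (α := fun _ => α) i l) = List.ofFn i ++ [l] := by
  rw [List.ofFn_succ', List.concat_eq_append]
  simp

/-- The factor in the Poincaré inequality on a ball of radius `R` in dimension `d`. -/
def poincareConst (d : ℕ) (R : ℝ) : ℝ≥0∞ := ENNReal.ofReal (2 * R) ^ 2 * 2 ^ d

/-- Simultaneous approximation of a Sobolev function and its derivatives by a polynomial. -/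
theorem exists_poly_approx {d k : ℕ} {z : Pt d} {R : ℝ} (hR : 0 < R) {u : Pt d → ℝ}
    {g : (j : ℕ) → (Fin j → Fin d) → Pt d → ℝ}
    (hg : ∀ j ≤ k + 1, ∀ i : Fin j → Fin d,
      IsWeakDeriv (Metric.ball z R) u (g j i) (List.ofFn i))
    (hL2 : ∀ j ≤ k + 1, ∀ i : Fin j → Fin d, MemLp (g j i) 2 (volume.restrict (Metric.ball z R))) :
    ∃ q ∈ Poly d k, ∀ j ≤ k + 1,
      ∑ i : Fin j → Fin d,
          ∫⁻ x in Metric.ball z R, ‖g j i x - polyVal (listDeriv (List.ofFn i) q) x‖ₑ ^ 2 ≤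
        poincareConst d R ^ (k + 1 - j) *
          ∑ i : Fin (k + 1) → Fin d, ∫⁻ x in Metric.ball z R, ‖g (k + 1) i x‖ₑ ^ 2 := by
  set B := Metric.ball z R
  have hfin : IsFiniteMeasure (volume.restrict B) :=
    ⟨by simpa using measure_ball_lt_top⟩
  -- The polynomial is chosen so that `u - q` and its derivatives up to order `k` have mean zero.
  -- One list represents all orderings of a multi-index.
  obtain ⟨q, hq, hmom⟩ := exists_poly_with_moments (k := k) (z := z) hR
    fun n => ∫ x in B, g n.toMultiset.toList.length n.toMultiset.toList.get x
  have hint : ∀ j ≤ k + 1, ∀ i : Fin j → Fin d, IntegrableOn (g j i) B := fun j hj i =>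
    (hL2 j hj i).integrable (by norm_num)
  have hpint : ∀ p : MvPolynomial (Fin d) ℝ, IntegrableOn (polyVal p) B := fun p =>
    integrableOn_polyVal p Metric.isBounded_ball
  have hmean : ∀ j ≤ k, ∀ i : Fin j → Fin d,
      ∫ x in B, (g j i x - polyVal (listDeriv (List.ofFn i) q) x) = 0 := by
    intro j hj i
    rw [integral_sub (hint j (by omega) i) (hpint _), sub_eq_zero]
    set n := Multiset.toFinsupp (List.ofFn i : Multiset (Fin d)) with hn
    have h2 : n.toMultiset.toList.Perm (List.ofFn i) := by
      rw [← Multiset.coe_eq_coe, hn]; simp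
    have hlen : n.toMultiset.toList.length = j := by rw [h2.length_eq, List.length_ofFn]
    have h3 := hmom n ((Finsupp.card_toMultiset n).symm.trans_le (by simpa [hn] using hj))
    rw [← listDeriv_perm h2, h3]
    -- The weak derivatives along two orderings of the same multi-index agree almost everywhere, by
    -- uniqueness.
    have h4 := hg _ (by omega) n.toMultiset.toList.get
    rw [List.ofFn_get] at h4
    exact integral_congr_ae ((hg j (by omega) i).unique Metric.isOpen_ball (h4.perm h2))
  refine ⟨q, hq, fun j hj => ?_⟩
  -- Downward induction on the order, with `m` counting the uses of the Poincaré inequality. Beyond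
  -- `k + 1` the truncated difference stays at `0`, hence the `min`.
  obtain ⟨m, rfl⟩ : ∃ m, j = k + 1 - m := ⟨k + 1 - j, by omega⟩
  have hm : k + 1 - (k + 1 - m) = min m (k + 1) := by omega
  rw [hm]
  clear hj
  induction m with
  | zero =>
    refine le_of_eq ?_
    simp only [Nat.sub_zero, Nat.zero_min, pow_zero, one_mul]
    refine Finset.sum_congr rfl fun i _ => lintegral_congr fun x => ?_
    rw [listDeriv_eq_zero_of_mem_Poly hq (List.length_ofFn), polyVal_zero, sub_zero]
  | succ m ih =>
    rcases lt_or_ge k m with hkm | hkm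
    · have h1 : k + 1 - (m + 1) = k + 1 - m := by omega
      have h2 : min (m + 1) (k + 1) = min m (k + 1) := by omega
      rw [h1, h2]
      exact ih (by omega)
    · have h1 : k + 1 - m = (k + 1 - (m + 1)) + 1 := by omega
      have h2 : min (m + 1) (k + 1) = min m (k + 1) + 1 := by omega
      have ih' := ih (by omega)
      rw [h1] at ih'
      have hjk : k + 1 - (m + 1) ≤ k := by omega
      generalize k + 1 - (m + 1) = j at *
      rw [h2, pow_succ', mul_assoc]
      refine le_trans ?_ (mul_le_mul_right ih' _)
      rw [sum_tuple_succ, Finset.mul_sum]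
      refine Finset.sum_le_sum fun i _ => ?_
      simp only [ofFn_snoc]
      refine poincare_ball ((hint j (by omega) i).sub (hpint _))
        (fun l => (hint (j + 1) (by omega) _).sub (hpint _)) (fun l => ?_) (hmean j hjk i)
      have h3 := hg (j + 1) (by omega) (Fin.snoc (α := fun _ => Fin d) i l)
      rw [ofFn_snoc] at h3
      exact ((hg j (by omega) i).sub (isWeakDeriv_polyVal q B _)).next
        (h3.sub (isWeakDeriv_polyVal q B _))

/-! ### Simplices and barycentric coordinates -/

/-- The finite set `T` is the vertex set of a nondegenerate simplex of full dimension. -/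
structure IsSimplex {d : ℕ} (T : Finset (Pt d)) : Prop where
  card_eq : T.card = d + 1
  indep : AffineIndependent ℝ ((↑) : T → Pt d)

theorem SimplicialMesh.isSimplex {d : ℕ} (𝒯 : SimplicialMesh d) {T : Finset (Pt d)}
    (hT : T ∈ 𝒯.elements) : IsSimplex T := ⟨𝒯.card_eq T hT, 𝒯.indep T hT⟩

namespace IsSimplex

variable {d : ℕ} {T : Finset (Pt d)}

theorem affineSpan_eq_top (hT : IsSimplex T) : affineSpan ℝ (T : Set (Pt d)) = ⊤ := by
  have := (hT.indep.affineSpan_eq_top_iff_card_eq_finrank_add_one).2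
    (by simp [hT.card_eq])
  simpa using this

theorem interior_nonempty (hT : IsSimplex T) : (interior (simplex T)).Nonempty :=
  interior_convexHull_nonempty_iff_affineSpan_eq_top.2 hT.affineSpan_eq_top

theorem exists_bary (hT : IsSimplex T) : ∃ b : Pt d → (Pt d →ᵃ[ℝ] ℝ),
    (∀ p, ∀ q ∈ T, b p q = if p = q then 1 else 0) ∧ (∀ p ∉ T, b p = 0) ∧
      (∀ x, ∑ p ∈ T, b p x = 1) ∧ ∀ x, ∑ p ∈ T, b p x • p = x := by
  let B : AffineBasis T ℝ (Pt d) := ⟨(↑), hT.indep, by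
    simpa using hT.affineSpan_eq_top⟩
  refine ⟨fun p => if h : p ∈ T then B.coord ⟨p, h⟩ else 0, fun p q hq => ?_, fun p hp => ?_,
    fun x => ?_, fun x => ?_⟩
  · by_cases hp : p ∈ T
    · simp only [hp, dite_true]
      have := B.coord_apply ⟨p, hp⟩ ⟨q, hq⟩
      simp only [Subtype.mk.injEq] at this
      exact this
    · have : p ≠ q := fun h => hp (h ▸ hq)
      simp [hp, this]
  · simp [hp]
  · rw [← Finset.sum_attach, ← B.sum_coord_apply_eq_one x]
    exact Finset.sum_congr rfl fun p _ => by simp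
  · rw [← Finset.sum_attach]
    conv_rhs => rw [← B.linear_combination_coord_eq_self x]
    refine Finset.sum_congr rfl fun p _ => ?_
    simp only [Finset.coe_mem, dite_true]
    rfl

end IsSimplex

/-- The barycentric coordinates of a simplex, indexed by all points; they vanish for points that
are not vertices. -/
def bary {d : ℕ} (T : Finset (Pt d)) : Pt d → (Pt d →ᵃ[ℝ] ℝ) :=
  if hT : IsSimplex T then hT.exists_bary.choose else 0

section bary

variable {d : ℕ} {T : Finset (Pt d)}

theorem bary_vertex (hT : IsSimplex T) (p : Pt d) {q : Pt d} (hq : q ∈ T) :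
    bary T p q = if p = q then 1 else 0 := by
  rw [bary, dif_pos hT]; exact hT.exists_bary.choose_spec.1 p q hq

theorem bary_of_notMem (hT : IsSimplex T) {p : Pt d} (hp : p ∉ T) : bary T p = 0 := by
  rw [bary, dif_pos hT]; exact hT.exists_bary.choose_spec.2.1 p hp

theorem affine_map_sum {ι : Type*} (f : Pt d →ᵃ[ℝ] ℝ) (s : Finset ι) (w : ι → ℝ) (p : ι → Pt d)
    (hw : ∑ i ∈ s, w i = 1) : f (∑ i ∈ s, w i • p i) = ∑ i ∈ s, w i * f (p i) := by
  have h : ∀ x, f x = f.linear x + f 0 := fun x => by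
    have := f.map_vadd 0 x
    simpa using this
  rw [h, map_sum]
  simp only [h (p _), mul_add, Finset.sum_add_distrib, ← Finset.sum_mul, hw, map_smul, smul_eq_mul,
    one_mul]

theorem bary_mem_Icc (hT : IsSimplex T) (p : Pt d) {x : Pt d} (hx : x ∈ simplex T) :
    bary T p x ∈ Set.Icc (0 : ℝ) 1 := by
  have : Convex ℝ (bary T p ⁻¹' Set.Icc (0 : ℝ) 1) := (convex_Icc 0 1).affine_preimage _
  refine convexHull_min (fun q hq => ?_) this hx
  rw [Set.mem_preimage, bary_vertex hT p hq]
  split_ifs <;> simp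

/-- Two affine functions with equal values at all common vertices agree on their convex hull. With
conformity, this makes the hat functions well defined. -/
theorem bary_eq_bary {S : Finset (Pt d)} (hT : IsSimplex T) (hS : IsSimplex S) (p : Pt d)
    {x : Pt d} (hx : x ∈ convexHull ℝ ((T : Set (Pt d)) ∩ (S : Set (Pt d)))) :
    bary T p x = bary S p x := by
  have h : Convex ℝ ((bary T p - bary S p) ⁻¹' {(0 : ℝ)}) := (convex_singleton 0).affine_preimage _
  have := convexHull_min (fun q hq => ?_) h hx
  · simpa [sub_eq_zero] using this
  · rw [Set.mem_preimage]
    simp [bary_vertex hT p hq.1, bary_vertex hS p hq.2]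

/-- An affine function as a polynomial. -/
def affPoly (f : Pt d →ᵃ[ℝ] ℝ) : MvPolynomial (Fin d) ℝ :=
  MvPolynomial.C (f 0) +
    ∑ j, MvPolynomial.C (f.linear (EuclideanSpace.single j 1)) * MvPolynomial.X j

theorem polyVal_affPoly (f : Pt d →ᵃ[ℝ] ℝ) (x : Pt d) : polyVal (affPoly f) x = f x := by
  have h : f x = f.linear x + f 0 := by
    have := f.map_vadd 0 x
    simpa using this
  have hx : f.linear x = ∑ j, f.linear (EuclideanSpace.single j 1) * x j := by
    conv_lhs => rw [← (EuclideanSpace.basisFun (Fin d) ℝ).sum_repr x]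
    simp [map_sum, mul_comm]
  rw [affPoly, polyVal_add, polyVal_C, polyVal_sum, h, hx, add_comm]
  simp

theorem totalDegree_affPoly (f : Pt d →ᵃ[ℝ] ℝ) : (affPoly f).totalDegree ≤ 1 := by
  refine (MvPolynomial.totalDegree_add _ _).trans (max_le (by simp) ?_)
  refine MvPolynomial.totalDegree_finsetSum_le fun j _ => ?_
  exact (MvPolynomial.totalDegree_mul _ _).trans (by simp)

end bary

/-! ### The principal lattice and Lagrange polynomials -/

section lattice

variable {d k : ℕ} {T : Finset (Pt d)}

/-- The point of the principal lattice with barycentric coordinates `a p / k`. -/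
def latticePt (k : ℕ) (T : Finset (Pt d)) (a : Pt d → ℕ) : Pt d :=
  ∑ p ∈ T, ((a p : ℝ) / (k : ℝ)) • p

theorem mem_elementNodes {i : Pt d} :
    i ∈ elementNodes k T ↔ ∃ a ∈ Finset.piAntidiag T k, latticePt k T a = i := by
  simp only [elementNodes, Finset.mem_image]; rfl

theorem sum_div_eq_one (hk : 1 ≤ k) {a : Pt d → ℕ} (ha : a ∈ Finset.piAntidiag T k) :
    ∑ p ∈ T, (a p : ℝ) / k = 1 := by
  rw [← Finset.sum_div, ← Nat.cast_sum, (Finset.mem_piAntidiag.1 ha).1]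
  exact div_self (by positivity)

theorem bary_latticePt (hk : 1 ≤ k) (hT : IsSimplex T) {a : Pt d → ℕ}
    (ha : a ∈ Finset.piAntidiag T k) (p : Pt d) : bary T p (latticePt k T a) = (a p : ℝ) / k := by
  by_cases hp : p ∈ T
  · rw [latticePt, affine_map_sum _ _ _ _ (sum_div_eq_one hk ha),
      Finset.sum_congr rfl fun q hq => by rw [bary_vertex hT p hq]]
    simp [hp]
  · have : a p = 0 := by
      by_contra h
      exact hp ((Finset.mem_piAntidiag.1 ha).2 p h)
    simp [bary_of_notMem hT hp, this]

theorem latticePt_mem_simplex (hk : 1 ≤ k) {a : Pt d → ℕ} (ha : a ∈ Finset.piAntidiag T k) :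
    latticePt k T a ∈ simplex T :=
  (convex_convexHull ℝ _).sum_mem (fun p _ => by positivity) (sum_div_eq_one hk ha)
    fun p hp => subset_convexHull ℝ _ hp

theorem elementNodes_subset_simplex (hk : 1 ≤ k) {i : Pt d} (hi : i ∈ elementNodes k T) :
    i ∈ simplex T := by
  obtain ⟨a, ha, rfl⟩ := mem_elementNodes.1 hi
  exact latticePt_mem_simplex hk ha

/-- The product `∏_{p ∈ T} ∏_{l < a p} (k b_p - l) / (a p - l)` for numbers `b_p`. -/
def lagProd (k : ℕ) (T : Finset (Pt d)) (a : Pt d → ℕ) (b : Pt d → ℝ) : ℝ :=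
  ∏ p ∈ T, ∏ l ∈ Finset.range (a p), ((k : ℝ) * b p - l) / ((a p : ℝ) - l)

theorem lagProd_self (hk : 1 ≤ k) (a : Pt d → ℕ) {b : Pt d → ℝ}
    (hb : ∀ p ∈ T, b p = (a p : ℝ) / k) : lagProd k T a b = 1 := by
  refine Finset.prod_eq_one fun p hp => Finset.prod_eq_one fun l hl => ?_
  have h1 : (k : ℝ) ≠ 0 := by positivity
  have h2 : (l : ℝ) < a p := by exact_mod_cast Finset.mem_range.1 hl
  rw [hb p hp, mul_div_cancel₀ _ h1, div_self (by linarith)]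

/-- The factor with `l = c p` vanishes. -/
theorem lagProd_eq_zero (hk : 1 ≤ k) {a c : Pt d → ℕ} {b : Pt d → ℝ} {p : Pt d} (hp : p ∈ T)
    (hb : b p = (c p : ℝ) / k) (hlt : c p < a p) : lagProd k T a b = 0 := by
  refine Finset.prod_eq_zero hp (Finset.prod_eq_zero (Finset.mem_range.2 hlt) ?_)
  have h1 : (k : ℝ) ≠ 0 := by positivity
  rw [hb, mul_div_cancel₀ _ h1, sub_self, zero_div]

/-- There are `k` factors in all, each with numerator at most `k` and denominator at least `1` in
absolute value. The bound does not see the shape of the simplex. -/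
theorem abs_lagProd_le {a : Pt d → ℕ} (ha : a ∈ Finset.piAntidiag T k) {b : Pt d → ℝ}
    (hb : ∀ p, b p ∈ Set.Icc (0 : ℝ) 1) : |lagProd k T a b| ≤ (k : ℝ) ^ k := by
  have ha' := (Finset.mem_piAntidiag.1 ha).1
  conv_rhs => rw [← ha', ← Finset.prod_pow_eq_pow_sum, ha']
  rw [lagProd, Finset.abs_prod]
  refine Finset.prod_le_prod (fun _ _ => abs_nonneg _) fun p hp => ?_
  rw [Finset.abs_prod]
  have hak : a p ≤ k := ha' ▸ Finset.single_le_sum (fun _ _ => Nat.zero_le _) hp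
  calc _ ≤ ∏ l ∈ Finset.range (a p), (k : ℝ) := by
        refine Finset.prod_le_prod (fun _ _ => abs_nonneg _) fun l hl => ?_
        have hl' := Finset.mem_range.1 hl
        have h1 : (1 : ℝ) ≤ (a p : ℝ) - l := by
          have : (l : ℝ) + 1 ≤ a p := by exact_mod_cast hl'
          linarith
        have h2 : (l : ℝ) ≤ k := by exact_mod_cast (hl'.le.trans hak)
        have h3 : (k : ℝ) * b p ≤ k := mul_le_of_le_one_right (by positivity) (hb p).2
        have h4 : 0 ≤ (k : ℝ) * b p := mul_nonneg (by positivity) (hb p).1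
        rw [abs_div, abs_of_pos (by linarith : 0 < (a p : ℝ) - l)]
        refine (div_le_self (abs_nonneg _) h1).trans (abs_le.2 ⟨?_, ?_⟩)
        · linarith
        · have : (0 : ℝ) ≤ l := by positivity
          linarith
    _ = _ := by simp

/-- The polynomial `lagProd` of the barycentric coordinates of the simplex `S`. -/
def lagPoly (k : ℕ) (S T : Finset (Pt d)) (a : Pt d → ℕ) : MvPolynomial (Fin d) ℝ :=
  ∏ p ∈ T, ∏ l ∈ Finset.range (a p), MvPolynomial.C (((a p : ℝ) - l)⁻¹) *
    (MvPolynomial.C (k : ℝ) * affPoly (bary S p) - MvPolynomial.C (l : ℝ))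

theorem polyVal_lagPoly (S : Finset (Pt d)) (a : Pt d → ℕ) (x : Pt d) :
    polyVal (lagPoly k S T a) x = lagProd k T a fun p => bary S p x := by
  simp only [lagPoly, polyVal_prod, polyVal_mul, polyVal_C, polyVal_sub, polyVal_affPoly, lagProd]
  refine Finset.prod_congr rfl fun p _ => Finset.prod_congr rfl fun l _ => ?_
  rw [div_eq_inv_mul]

theorem lagPoly_mem_Poly (S : Finset (Pt d)) {a : Pt d → ℕ} (ha : a ∈ Finset.piAntidiag T k) :
    lagPoly k S T a ∈ Poly d k := by
  rw [mem_Poly, lagPoly]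
  refine (MvPolynomial.totalDegree_finsetProd _ _).trans ?_
  conv_rhs => rw [← (Finset.mem_piAntidiag.1 ha).1]
  refine Finset.sum_le_sum fun p _ => (MvPolynomial.totalDegree_finsetProd _ _).trans ?_
  refine (Finset.sum_le_card_nsmul _ _ 1 fun l _ => ?_).trans (by simp)
  refine (MvPolynomial.totalDegree_mul _ _).trans ?_
  rw [MvPolynomial.totalDegree_C, zero_add]
  refine (MvPolynomial.totalDegree_sub _ _).trans (max_le ?_ ?_)
  · refine (MvPolynomial.totalDegree_mul _ _).trans ?_
    rw [MvPolynomial.totalDegree_C, zero_add]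
    exact totalDegree_affPoly _
  · rw [MvPolynomial.totalDegree_C]; exact zero_le_one

theorem exists_lt_of_ne {a b : Pt d → ℕ} (ha : a ∈ Finset.piAntidiag T k)
    (hb : b ∈ Finset.piAntidiag T k) (hne : a ≠ b) : ∃ p ∈ T, b p < a p := by
  rw [Finset.mem_piAntidiag] at ha hb
  by_contra! h
  refine hne (funext fun p => ?_)
  by_cases hp : p ∈ T
  · exact (Finset.sum_eq_sum_iff_of_le h).1 (ha.1.trans hb.1.symm) p hp
  · rw [not_imp_comm.1 (ha.2 p) hp, not_imp_comm.1 (hb.2 p) hp]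

theorem lagPoly_latticePt (hk : 1 ≤ k) (hT : IsSimplex T) {a b : Pt d → ℕ}
    (ha : a ∈ Finset.piAntidiag T k) (hb : b ∈ Finset.piAntidiag T k) :
    polyVal (lagPoly k T T a) (latticePt k T b) = if a = b then 1 else 0 := by
  rw [polyVal_lagPoly]
  split_ifs with h
  · subst h
    exact lagProd_self hk a fun p _ => bary_latticePt hk hT ha p
  · obtain ⟨p, hp, hlt⟩ := exists_lt_of_ne ha hb h
    exact lagProd_eq_zero hk hp (bary_latticePt hk hT hb p) hlt

/-- An exponent of total degree at most `k` in `d` variables becomes a multi-index of sum exactly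
`k` on the `d + 1` vertices when the missing degree is put on one vertex; this map is injective. -/
theorem finrank_Poly_le (hT : IsSimplex T) :
    Module.finrank ℝ (Poly d k) ≤ (Finset.piAntidiag T k).card := by
  let s : Set (Fin d →₀ ℕ) := {n | (n.sum fun _ e => e) ≤ k}
  let b : Module.Basis s ℝ (Poly d k) := MvPolynomial.basisRestrictSupport ℝ s
  have : Finite s := Module.Finite.finite_basis b
  have : Fintype s := Fintype.ofFinite s
  rw [Module.finrank_eq_card_basis b, ← Fintype.card_coe]
  let e : T ≃ Fin (d + 1) := T.equivFinOfCardEq hT.card_eq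
  let F : s → Pt d → ℕ := fun n p =>
    if h : p ∈ T then (Fin.cons (k - n.1.sum fun _ e => e) n.1 : Fin (d + 1) → ℕ) (e ⟨p, h⟩) else 0
  have hF : ∀ n, F n ∈ Finset.piAntidiag T k := by
    intro n
    rw [Finset.mem_piAntidiag]
    constructor
    · rw [← Finset.sum_attach]
      have h1 : ∑ p ∈ T.attach, F n p =
          ∑ p : T, (Fin.cons (k - n.1.sum fun _ e => e) n.1 : Fin (d + 1) → ℕ) (e p) :=
        Finset.sum_congr rfl fun p _ => by simp [F]
      rw [h1, e.sum_comp, Fin.sum_univ_succ]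
      simp only [Fin.cons_zero, Fin.cons_succ]
      rw [Finsupp.sum_fintype _ _ fun _ => rfl]
      have h2 : (n.1.sum fun _ e => e) ≤ k := n.2
      rw [Finsupp.sum_fintype _ _ fun _ => rfl] at h2
      omega
    · intro p hp
      by_contra h
      exact hp (by simp [F, h])
  refine Fintype.card_le_of_injective (fun n => ⟨F n, hF n⟩) fun n m h => ?_
  refine Subtype.ext (Finsupp.ext fun j => ?_)
  have h1 := congrFun (Subtype.ext_iff.1 h) (e.symm j.succ).1
  simpa [F] using h1

theorem exists_surjective_eval (hk : 1 ≤ k) (hT : IsSimplex T) :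
    ∃ ev : Poly d k →ₗ[ℝ] (Finset.piAntidiag T k → ℝ), Function.Surjective ev ∧
      ∀ p a, ev p a = polyVal p.1 (latticePt k T a) := by
  refine ⟨{ toFun := fun p a => polyVal p (latticePt k T a)
            map_add' := fun p q => by ext; simp
            map_smul' := fun c p => by ext; simp }, fun c => ?_, fun _ _ => rfl⟩
  refine ⟨∑ a, c a • ⟨lagPoly k T T a, lagPoly_mem_Poly T a.2⟩, ?_⟩
  ext b
  change polyVal _ _ = _
  simp only [Submodule.coe_sum, Submodule.coe_smul, polyVal_sum, polyVal_smul]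
  rw [Finset.sum_eq_single b]
  · rw [lagPoly_latticePt hk hT b.2 b.2, if_pos rfl, mul_one]
  · intro a _ hab
    rw [lagPoly_latticePt hk hT a.2 b.2, if_neg fun h => hab (Subtype.ext h), mul_zero]
  · simp

theorem card_piAntidiag_le (hk : 1 ≤ k) (hT : IsSimplex T) :
    (Finset.piAntidiag T k).card ≤ Module.finrank ℝ (Poly d k) := by
  obtain ⟨ev, hsurj, -⟩ := exists_surjective_eval (d := d) hk hT
  simpa using LinearMap.finrank_le_finrank_of_surjective hsurj

theorem card_elementNodes_le (hk : 1 ≤ k) (hT : IsSimplex T) :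
    (elementNodes k T).card ≤ Module.finrank ℝ (Poly d k) :=
  Finset.card_image_le.trans (card_piAntidiag_le hk hT)

/-- Evaluation at the lattice is surjective, as the Lagrange polynomials hit the unit vectors;
equality of dimensions makes it injective. -/
theorem eq_zero_of_elementNodes (hk : 1 ≤ k) (hT : IsSimplex T) {p : MvPolynomial (Fin d) ℝ}
    (hp : p ∈ Poly d k) (h : ∀ i ∈ elementNodes k T, polyVal p i = 0) : p = 0 := by
  obtain ⟨ev, hsurj, hev⟩ := exists_surjective_eval (d := d) hk hT
  have hinj : Function.Injective ev := by
    refine (LinearMap.injective_iff_surjective_of_finrank_eq_finrank (le_antisymm ?_ ?_)).2 hsurj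
    · rw [Module.finrank_fintype_fun_eq_card, Fintype.card_coe]
      exact finrank_Poly_le hT
    · exact LinearMap.finrank_le_finrank_of_surjective hsurj
  have h0 : ev ⟨p, hp⟩ = 0 := by
    ext a
    rw [hev]
    exact h _ (mem_elementNodes.2 ⟨a, a.2, rfl⟩)
  exact congrArg Subtype.val ((map_eq_zero_iff ev hinj).1 h0)

theorem exists_lagrange (hk : 1 ≤ k) (hT : IsSimplex T) {i : Pt d} (hi : i ∈ elementNodes k T) :
    ∃ ψ ∈ Poly d k, (∀ j ∈ elementNodes k T, polyVal ψ j = if j = i then 1 else 0) ∧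
      ∀ x ∈ simplex T, |polyVal ψ x| ≤ (k : ℝ) ^ k := by
  obtain ⟨a, ha, rfl⟩ := mem_elementNodes.1 hi
  refine ⟨lagPoly k T T a, lagPoly_mem_Poly T ha, fun j hj => ?_, fun x hx => ?_⟩
  · obtain ⟨b, hb, rfl⟩ := mem_elementNodes.1 hj
    rw [lagPoly_latticePt hk hT ha hb]
    by_cases h : a = b
    · simp [h]
    · rw [if_neg h, if_neg]
      -- Barycentric coordinates recover the multi-index from the point, so distinct multi-indices
      -- give distinct nodes.
      intro h2
      refine h (funext fun p => ?_)
      have h3 := bary_latticePt hk hT ha p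
      rw [← h2, bary_latticePt hk hT hb p] at h3
      have h1 : (k : ℝ) ≠ 0 := by positivity
      field_simp at h3
      exact_mod_cast h3.symm
  · rw [polyVal_lagPoly]
    exact abs_lagProd_le ha fun p => bary_mem_Icc hT p hx

end lattice

/-! ### The global Lagrange basis -/

theorem isCompact_simplex {d : ℕ} (T : Finset (Pt d)) : IsCompact (simplex T) :=
  T.finite_toSet.isCompact_convexHull (𝕜 := ℝ)

theorem convex_simplex {d : ℕ} (T : Finset (Pt d)) : Convex ℝ (simplex T) := convex_convexHull ℝ _

/-! ### Hat functions and global Lagrange functions -/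

namespace SimplicialMesh

variable {d : ℕ} (𝒯 : SimplicialMesh d)

/-- The piecewise affine function that is `1` at the vertex `p` and `0` at all others. -/
def hat (p x : Pt d) : ℝ :=
  if h : ∃ T ∈ 𝒯.elements, x ∈ simplex T then bary h.choose p x else 0

theorem hat_eq {T : Finset (Pt d)} (hT : T ∈ 𝒯.elements) (p : Pt d) {x : Pt d}
    (hx : x ∈ simplex T) : 𝒯.hat p x = bary T p x := by
  have h : ∃ T ∈ 𝒯.elements, x ∈ simplex T := ⟨T, hT, hx⟩
  rw [hat, dif_pos h]
  exact bary_eq_bary (𝒯.isSimplex h.choose_spec.1) (𝒯.isSimplex hT) p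
    (𝒯.conforming _ h.choose_spec.1 _ hT ⟨h.choose_spec.2, hx⟩)

theorem continuousOn_region {f : Pt d → ℝ}
    (hf : ∀ T ∈ 𝒯.elements, ContinuousOn f (simplex T)) : ContinuousOn f 𝒯.region := by
  have : 𝒯.region = ⋃ T : 𝒯.elements, simplex T.1 := by
    simp [region, Set.iUnion_subtype]
  rw [this]
  exact (locallyFinite_of_finite _).continuousOn_iUnion
    (fun T => (isCompact_simplex T.1).isClosed) fun T => hf T.1 T.2

/-- The global Lagrange function of the lattice point of `T` with multi-index `a`. -/
def globalLag (k : ℕ) (T : Finset (Pt d)) (a : Pt d → ℕ) (x : Pt d) : ℝ :=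
  lagProd k T a fun p => 𝒯.hat p x

/-- On every element the hat functions are barycentric coordinates, including those of vertices
outside it, which vanish. So one formula is a polynomial on each element and automatically
single-valued on shared faces. -/
theorem globalLag_eq (k : ℕ) (T : Finset (Pt d)) (a : Pt d → ℕ) {S : Finset (Pt d)}
    (hS : S ∈ 𝒯.elements) {x : Pt d} (hx : x ∈ simplex S) :
    𝒯.globalLag k T a x = polyVal (lagPoly k S T a) x := by
  rw [polyVal_lagPoly, globalLag]
  congr 1
  exact funext fun p => 𝒯.hat_eq hS p hx

theorem globalLag_mem_feSpace (k : ℕ) {T : Finset (Pt d)} {a : Pt d → ℕ}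
    (ha : a ∈ Finset.piAntidiag T k) : 𝒯.globalLag k T a ∈ 𝒯.feSpace k := by
  refine ⟨𝒯.continuousOn_region fun S hS => ?_, fun S hS => ⟨_, lagPoly_mem_Poly S ha, fun x hx =>
    𝒯.globalLag_eq k T a hS hx⟩⟩
  exact (continuous_polyVal _).continuousOn.congr fun x hx => 𝒯.globalLag_eq k T a hS hx

/-- A node of another element `S` may have a multi-index `b` with `a ≤ b` on `T`. Both sums are `k`,
so then `b = a` on `T` and `b` vanishes off `T`: the two nodes coincide. Otherwise some `b p < a p`
and a factor vanishes. -/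
theorem globalLag_node {k : ℕ} (hk : 1 ≤ k) {T S : Finset (Pt d)} (hT : T ∈ 𝒯.elements)
    (hS : S ∈ 𝒯.elements) {a : Pt d → ℕ} (ha : a ∈ Finset.piAntidiag T k) {j : Pt d}
    (hj : j ∈ elementNodes k S) :
    𝒯.globalLag k T a j = if j = latticePt k T a then 1 else 0 := by
  split_ifs with h
  · subst h
    exact lagProd_self hk a fun p _ => by
      rw [𝒯.hat_eq hT p (latticePt_mem_simplex hk ha), bary_latticePt hk (𝒯.isSimplex hT) ha]
  · obtain ⟨b, hb, rfl⟩ := mem_elementNodes.1 hj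
    have hb' : ∀ p, 𝒯.hat p (latticePt k S b) = (b p : ℝ) / k := fun p => by
      rw [𝒯.hat_eq hS p (latticePt_mem_simplex hk hb), bary_latticePt hk (𝒯.isSimplex hS) hb]
    obtain ⟨p, hp, hlt⟩ : ∃ p ∈ T, b p < a p := by
      by_contra! hle
      have ha1 : ∑ p ∈ T, a p = k := (Finset.mem_piAntidiag.1 ha).1
      have hb1 : ∑ p ∈ S, b p = k := (Finset.mem_piAntidiag.1 hb).1
      have hb0 : ∀ p ∉ S, b p = 0 := fun p hp => not_imp_comm.1 ((Finset.mem_piAntidiag.1 hb).2 p) hp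
      have hU : ∑ p ∈ T ∪ S, b p = k := by
        rw [← hb1]
        exact (Finset.sum_subset Finset.subset_union_right fun p _ hp => hb0 p hp).symm
      have hTle : ∑ p ∈ T, b p ≤ ∑ p ∈ T ∪ S, b p :=
        Finset.sum_le_sum_of_subset Finset.subset_union_left
      have haT : ∑ p ∈ T, a p ≤ ∑ p ∈ T, b p := Finset.sum_le_sum hle
      have hEq : ∑ p ∈ T, a p = ∑ p ∈ T, b p := by omega
      have hab := (Finset.sum_eq_sum_iff_of_le hle).1 hEq
      have hz : ∀ p ∈ T ∪ S, p ∉ T → b p = 0 := by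
        have h1 : ∑ p ∈ T ∪ S, b p = ∑ p ∈ T, b p + ∑ p ∈ (T ∪ S) \ T, b p := by
          rw [add_comm, Finset.sum_sdiff Finset.subset_union_left]
        have h2 : ∑ p ∈ (T ∪ S) \ T, b p = 0 := by omega
        intro p hp hpT
        exact Finset.sum_eq_zero_iff.1 h2 p (Finset.mem_sdiff.2 ⟨hp, hpT⟩)
      apply h
      calc latticePt k S b = ∑ p ∈ T ∪ S, ((b p : ℝ) / k) • p :=
            Finset.sum_subset Finset.subset_union_right fun p _ hp => by simp [hb0 p hp]
        _ = ∑ p ∈ T, ((b p : ℝ) / k) • p :=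
            (Finset.sum_subset Finset.subset_union_left fun p hp hpT => by simp [hz p hp hpT]).symm
        _ = latticePt k T a := Finset.sum_congr rfl fun p hp => by rw [hab p hp]
    exact lagProd_eq_zero hk hp (hb' p) hlt

end SimplicialMesh

/-! ### The active space, its nodes and the supports of its basis -/

namespace CutMesh

variable {d k : ℕ} {M : CutMesh d}

theorem isSimplex {T : Finset (Pt d)} (hT : T ∈ M.active) : IsSimplex T :=
  M.mesh.isSimplex (Finset.mem_filter.1 hT).1

theorem active_subset {T : Finset (Pt d)} (hT : T ∈ M.active) : T ∈ M.mesh.elements :=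
  (Finset.mem_filter.1 hT).1

theorem large_subset {T : Finset (Pt d)} (hT : T ∈ M.large) : T ∈ M.active :=
  (Finset.mem_filter.1 hT).1

theorem simplex_subset_activeRegion {T : Finset (Pt d)} (hT : T ∈ M.active) :
    simplex T ⊆ M.activeRegion := Set.subset_biUnion_of_mem (u := fun T => simplex T) hT

theorem mem_nodes {T : Finset (Pt d)} (hT : T ∈ M.active) {i : Pt d}
    (hi : i ∈ elementNodes k T) : i ∈ M.nodes k := Finset.mem_biUnion.2 ⟨T, hT, hi⟩

theorem exists_basis (hk : 1 ≤ k) {i : Pt d} (hi : i ∈ M.nodes k) :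
    ∃ f ∈ M.Vh k, ∀ j ∈ M.nodes k, f j = if j = i then 1 else 0 := by
  obtain ⟨T, hT, hiT⟩ := Finset.mem_biUnion.1 hi
  obtain ⟨a, ha, rfl⟩ := mem_elementNodes.1 hiT
  refine ⟨_, ⟨_, M.mesh.globalLag_mem_feSpace k ha, rfl⟩, fun j hj => ?_⟩
  obtain ⟨S, hS, hjS⟩ := Finset.mem_biUnion.1 hj
  rw [Set.indicator_of_mem (simplex_subset_activeRegion hS (elementNodes_subset_simplex hk hjS)),
    M.mesh.globalLag_node hk (active_subset hT) (active_subset hS) ha hjS]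

theorem basis_mem (hk : 1 ≤ k) {i : Pt d} (hi : i ∈ M.nodes k) : M.basis k i ∈ M.Vh k := by
  rw [basis, dif_pos (exists_basis hk hi)]
  exact (exists_basis hk hi).choose_spec.1

theorem basis_node (hk : 1 ≤ k) {i j : Pt d} (hi : i ∈ M.nodes k) (hj : j ∈ M.nodes k) :
    M.basis k i j = if j = i then 1 else 0 := by
  rw [basis, dif_pos (exists_basis hk hi)]
  exact (exists_basis hk hi).choose_spec.2 j hj

theorem sum_mem_Vh {ι : Type*} (s : Finset ι) (c : ι → ℝ) (f : ι → Pt d → ℝ)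
    (hf : ∀ i ∈ s, f i ∈ M.Vh k) : (fun x => ∑ i ∈ s, c i * f i x) ∈ M.Vh k := by
  choose! v hv hfv using hf
  refine ⟨fun x => ∑ i ∈ s, c i * v i x, ⟨?_, fun T hT => ?_⟩, ?_⟩
  · exact continuousOn_finsetSum _ fun i hi => continuousOn_const.mul (hv i hi).1
  · have h1 : ∀ i ∈ s, ∃ p ∈ Poly d k, ∀ x ∈ simplex T, v i x = polyVal p x := fun i hi =>
      (hv i hi).2 T hT
    choose! p hp hvp using h1
    refine ⟨∑ i ∈ s, c i • p i, Submodule.sum_mem _ fun i hi => Submodule.smul_mem _ _ (hp i hi),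
      fun x hx => ?_⟩
    rw [polyVal_sum]
    exact Finset.sum_congr rfl fun i hi => by rw [polyVal_smul, hvp i hi x hx]
  · ext x
    by_cases hx : x ∈ M.activeRegion
    · rw [Set.indicator_of_mem hx]
      exact Finset.sum_congr rfl fun i hi => by rw [hfv i hi, Set.indicator_of_mem hx]
    · rw [Set.indicator_of_notMem hx]
      exact Finset.sum_eq_zero fun i hi => by rw [hfv i hi, Set.indicator_of_notMem hx, mul_zero]

theorem exists_poly_of_mem_Vh {w : Pt d → ℝ} (hw : w ∈ M.Vh k) {T : Finset (Pt d)}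
    (hT : T ∈ M.active) : ∃ p ∈ Poly d k, ∀ x ∈ simplex T, w x = polyVal p x := by
  obtain ⟨v, hv, rfl⟩ := hw
  obtain ⟨p, hp, hvp⟩ := hv.2 T (active_subset hT)
  exact ⟨p, hp, fun x hx => by
    rw [Set.indicator_of_mem (simplex_subset_activeRegion hT hx), hvp x hx]⟩

theorem polyExt_mem {w : Pt d → ℝ} (hw : w ∈ M.Vh k) {T : Finset (Pt d)} (hT : T ∈ M.active) :
    polyExt k T w ∈ Poly d k := by
  rw [polyExt, dif_pos (exists_poly_of_mem_Vh hw hT)]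
  exact (exists_poly_of_mem_Vh hw hT).choose_spec.1

theorem eq_polyExt {w : Pt d → ℝ} (hw : w ∈ M.Vh k) {T : Finset (Pt d)} (hT : T ∈ M.active)
    {x : Pt d} (hx : x ∈ simplex T) : w x = polyVal (polyExt k T w) x := by
  rw [polyExt, dif_pos (exists_poly_of_mem_Vh hw hT)]
  exact (exists_poly_of_mem_Vh hw hT).choose_spec.2 x hx

theorem polyExt_eq_of_nodes (hk : 1 ≤ k) {w w' : Pt d → ℝ} (hw : w ∈ M.Vh k) (hw' : w' ∈ M.Vh k)
    {T : Finset (Pt d)} (hT : T ∈ M.active) (h : ∀ j ∈ elementNodes k T, w j = w' j) :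
    polyExt k T w = polyExt k T w' := by
  refine sub_eq_zero.1 (eq_zero_of_elementNodes hk (isSimplex hT)
    (Submodule.sub_mem _ (polyExt_mem hw hT) (polyExt_mem hw' hT)) fun j hj => ?_)
  have hjT := elementNodes_subset_simplex hk hj
  rw [polyVal_sub, ← eq_polyExt hw hT hjT, ← eq_polyExt hw' hT hjT, h j hj, sub_self]

/-- On `T` the basis function is a nonzero polynomial, being `1` at `i`, so its zero set contains no
nonempty open set. The simplex is contained in the closure of its interior and thus lies in the
support. -/
theorem inSupport_of_mem (hk : 1 ≤ k) {T : Finset (Pt d)} (hT : T ∈ M.active) {i : Pt d}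
    (hi : i ∈ elementNodes k T) : M.InSupport k T i := by
  have hiM := mem_nodes hT hi
  have hb := basis_mem hk hiM
  have hne : polyExt k T (M.basis k i) ≠ 0 := by
    intro h0
    have h1 := eq_polyExt hb hT (elementNodes_subset_simplex hk hi)
    rw [h0, polyVal_zero, basis_node hk hiM hiM, if_pos rfl] at h1
    exact one_ne_zero h1
  have hcl : simplex T ⊆ closure (interior (simplex T)) := by
    rw [(convex_simplex T).closure_interior_eq_closure_of_nonempty_interior
      (isSimplex hT).interior_nonempty]
    exact subset_closure
  refine hcl.trans (closure_minimal (fun x hx => ?_) (isClosed_tsupport _))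
  rw [tsupport, mem_closure_iff]
  intro O hO hxO
  by_contra hemp
  refine hne (eq_zero_of_polyVal_eq_zero (hO.inter isOpen_interior) ⟨x, hxO, hx⟩ fun y hy => ?_)
  rw [← eq_polyExt hb hT (interior_subset hy.2)]
  by_contra h0
  exact hemp ⟨y, hy.1, h0⟩

/-- If `i` is not a node of `T`, all nodal values on `T` are zero; the basis function then vanishes
on `T`, and the interior of `T` misses its support. -/
theorem mem_of_inSupport (hk : 1 ≤ k) {T : Finset (Pt d)} (hT : T ∈ M.active) {i : Pt d}
    (hi : i ∈ M.nodes k) (h : M.InSupport k T i) : i ∈ elementNodes k T := by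
  by_contra hiT
  have hb := basis_mem hk hi
  have h0 : polyExt k T (M.basis k i) = 0 := by
    refine eq_zero_of_elementNodes hk (isSimplex hT) (polyExt_mem hb hT) fun j hj => ?_
    rw [← eq_polyExt hb hT (elementNodes_subset_simplex hk hj),
      basis_node hk hi (mem_nodes hT hj), if_neg]
    rintro rfl
    exact hiT hj
  obtain ⟨x, hx⟩ := (isSimplex hT).interior_nonempty
  obtain ⟨y, hy, hy0⟩ := mem_closure_iff.1 (h (interior_subset hx)) _ isOpen_interior hx
  rw [Function.mem_support, eq_polyExt hb hT (interior_subset hy), h0, polyVal_zero] at hy0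
  exact hy0 rfl

theorem smallNodes_subset {i : Pt d} (hi : i ∈ M.smallNodes k) : i ∈ M.nodes k :=
  (Finset.mem_filter.1 hi).1

theorem largeNodes_subset {i : Pt d} (hi : i ∈ M.largeNodes k) : i ∈ M.nodes k :=
  (Finset.mem_sdiff.1 hi).1

theorem mem_largeNodes_of_large (hk : 1 ≤ k) {T : Finset (Pt d)} (hT : T ∈ M.large) {j : Pt d}
    (hj : j ∈ elementNodes k T) : j ∈ M.largeNodes k :=
  Finset.mem_sdiff.2 ⟨mem_nodes (large_subset hT) hj, fun h =>
    (Finset.mem_filter.1 h).2 T hT (inSupport_of_mem hk (large_subset hT) hj)⟩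

theorem sum_basis_node (hk : 1 ≤ k) {s : Finset (Pt d)} (hs : s ⊆ M.nodes k) (c : Pt d → ℝ)
    {j : Pt d} (hj : j ∈ M.nodes k) :
    ∑ i ∈ s, c i * M.basis k i j = if j ∈ s then c j else 0 := by
  rw [Finset.sum_congr rfl fun i hi => by rw [basis_node hk (hs hi) hj]]
  simp

theorem neighborhood_of_mem {T S : Finset (Pt d)} (hS : S ∈ M.active) {i : Pt d}
    (hi : i ∈ elementNodes k T) (hi' : i ∈ elementNodes k S) :
    simplex S ⊆ M.neighborhood k T :=
  Set.subset_biUnion_of_mem (u := fun T => simplex T)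
    (Finset.mem_filter.2 ⟨hS, ⟨i, Finset.mem_inter.2 ⟨hi, hi'⟩⟩⟩)

end CutMesh

/-! ### Nodal values of `tildePi` and the kernel of the stabilization -/

namespace NodalChoice

open CutMesh

variable {d k : ℕ} {M : CutMesh d} (D : NodalChoice M k)

/-- The support of `φ_i` contains no large element, so `T_i` is small and `S_h` may be applied to
it. -/
theorem stabElem_mem_small {i : Pt d} (hi : i ∈ M.smallNodes k) : D.stabElem i ∈ M.small :=
  Finset.mem_sdiff.2 ⟨(D.stabElem_mem i hi).1, fun h =>
    (Finset.mem_filter.1 hi).2 _ h (D.stabElem_mem i hi).2⟩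

theorem S_stabElem_mem {i : Pt d} (hi : i ∈ M.smallNodes k) :
    D.S (D.stabElem i) ∈ M.large := D.S_mem _ (D.stabElem_mem_small hi)

theorem node_mem_stabElem (hk : 1 ≤ k) {i : Pt d} (hi : i ∈ M.smallNodes k) :
    i ∈ elementNodes k (D.stabElem i) :=
  mem_of_inSupport hk (D.stabElem_mem i hi).1 (smallNodes_subset hi) (D.stabElem_mem i hi).2

theorem node_mem_clementElem (hk : 1 ≤ k) {i : Pt d} (hi : i ∈ M.nodes k) :
    i ∈ elementNodes k (D.clementElem i) :=
  mem_of_inSupport hk (D.clementElem_mem i hi).1 hi (D.clementElem_mem i hi).2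

theorem clement_mem (hk : 1 ≤ k) (v : Pt d → ℝ) : D.clement v ∈ M.Vh k :=
  sum_mem_Vh _ _ _ fun _ hi => basis_mem hk hi

theorem clement_node (hk : 1 ≤ k) (v : Pt d → ℝ) {j : Pt d} (hj : j ∈ M.nodes k) :
    D.clement v j = polyVal (l2Proj k (D.clementElem j) v) j := by
  rw [clement, sum_basis_node hk (Finset.Subset.refl _)
    (fun i => polyVal (l2Proj k (D.clementElem i) v) i) hj, if_pos hj]

theorem tildePi_mem (hk : 1 ≤ k) (w : Pt d → ℝ) : D.tildePi w ∈ M.Vh k := by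
  have h1 := sum_mem_Vh (M := M) (k := k) (M.smallNodes k)
    (fun i => polyVal (polyExt k (D.S (D.stabElem i)) w) i) (M.basis k)
    fun i hi => basis_mem hk (smallNodes_subset hi)
  have h2 := sum_mem_Vh (M := M) (k := k) (M.largeNodes k) w (M.basis k)
    fun i hi => basis_mem hk (largeNodes_subset hi)
  -- Closure under addition, obtained as a sum over the two elements of `Bool`.
  have h3 := sum_mem_Vh (M := M) (k := k) (Finset.univ : Finset Bool) (fun _ => 1)
    (fun b => if b then _ else _) fun b _ => by
      cases b
      · simpa using h2
      · simpa using h1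
  have h4 : D.tildePi w = fun x => ∑ b : Bool, 1 * (if b then
      fun x => ∑ i ∈ M.smallNodes k, polyVal (polyExt k (D.S (D.stabElem i)) w) i * M.basis k i x
      else fun x => ∑ i ∈ M.largeNodes k, w i * M.basis k i x) x := by
    ext x; simp [tildePi]
  rw [h4]
  exact h3

theorem tildePi_smallNode (hk : 1 ≤ k) (w : Pt d → ℝ) {j : Pt d} (hj : j ∈ M.smallNodes k) :
    D.tildePi w j = polyVal (polyExt k (D.S (D.stabElem j)) w) j := by
  rw [tildePi, sum_basis_node hk (fun i hi => smallNodes_subset hi)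
    (fun i => polyVal (polyExt k (D.S (D.stabElem i)) w) i) (smallNodes_subset hj), if_pos hj,
    sum_basis_node hk (fun i hi => largeNodes_subset hi) w (smallNodes_subset hj), if_neg, add_zero]
  exact fun h => (Finset.mem_sdiff.1 h).2 hj

theorem tildePi_largeNode (hk : 1 ≤ k) (w : Pt d → ℝ) {j : Pt d} (hj : j ∈ M.largeNodes k) :
    D.tildePi w j = w j := by
  rw [tildePi, sum_basis_node hk (fun i hi => smallNodes_subset hi)
    (fun i => polyVal (polyExt k (D.S (D.stabElem i)) w) i) (largeNodes_subset hj),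
    if_neg (Finset.mem_sdiff.1 hj).2,
    sum_basis_node hk (fun i hi => largeNodes_subset hi) w (largeNodes_subset hj), if_pos hj,
    zero_add]

/-- A node of a large element has that element in the support of its basis function and so is never
a small node. `tildePi` changes nothing there, and nodal values determine the polynomial. -/
theorem polyExt_tildePi_large (hk : 1 ≤ k) {w : Pt d → ℝ} (hw : w ∈ M.Vh k)
    {T : Finset (Pt d)} (hT : T ∈ M.large) : polyExt k T (D.tildePi w) = polyExt k T w :=
  polyExt_eq_of_nodes hk (D.tildePi_mem hk w) hw (large_subset hT) fun _ hj =>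
    D.tildePi_largeNode hk w (mem_largeNodes_of_large hk hT hj)

/-- The value at `i` seen from `T_i` was defined as the extension from `S_h(T_i)`, and `tildePi`
does not alter the latter. -/
theorem jump_tildePi (hk : 1 ≤ k) {w : Pt d → ℝ} (hw : w ∈ M.Vh k) {i : Pt d}
    (hi : i ∈ M.smallNodes k) :
    polyVal (jump k (D.stabElem i) (D.S (D.stabElem i)) (D.tildePi w)) i = 0 := by
  rw [jump, polyVal_sub, D.polyExt_tildePi_large hk hw (D.S_stabElem_mem hi),
    ← eq_polyExt (D.tildePi_mem hk w) (D.stabElem_mem i hi).1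
      (elementNodes_subset_simplex hk (D.node_mem_stabElem hk hi)),
    D.tildePi_smallNode hk w hi, sub_self]

theorem stab_tildePi (hk : 1 ≤ k) {w : Pt d → ℝ} (hw : w ∈ M.Vh k) (h τ α : ℝ) (v : Pt d → ℝ) :
    D.stab h τ α (D.tildePi w) v = 0 :=
  Finset.sum_eq_zero fun i hi => by rw [D.jump_tildePi hk hw hi]; ring

/-! ### Balls that contain the dependence region -/

theorem _root_.CutFEM.SimplicialMesh.QuasiUniform.dist_le {𝒯 : SimplicialMesh d} {σ h : ℝ}
    (hQ : 𝒯.QuasiUniform σ h) {T : Finset (Pt d)} (hT : T ∈ 𝒯.elements) {x y : Pt d}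
    (hx : x ∈ simplex T) (hy : y ∈ simplex T) : dist x y ≤ h :=
  (Metric.dist_le_diam_of_mem (isCompact_simplex T).isBounded hx hy).trans (hQ T hT).1

theorem dist_le_of_mem_neighborhood (hk : 1 ≤ k) {σ h : ℝ} (hQ : M.mesh.QuasiUniform σ h)
    {T : Finset (Pt d)} (hT : T ∈ M.active) {x y : Pt d} (hx : x ∈ simplex T)
    (hy : y ∈ M.neighborhood k T) : dist x y ≤ 2 * h := by
  obtain ⟨S, hS, hyS⟩ := Set.mem_iUnion₂.1 hy
  obtain ⟨hSa, i, hi⟩ := Finset.mem_filter.1 hS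
  rw [Finset.mem_inter] at hi
  have h1 := hQ.dist_le (active_subset hT) hx (elementNodes_subset_simplex hk hi.1)
  have h2 := hQ.dist_le (active_subset hSa) (elementNodes_subset_simplex hk hi.2) hyS
  linarith [dist_triangle x i y]

/-- Face neighbors share `d ≥ 1` vertices, so one can walk from vertex to vertex, at a cost of at
most `h` in each of the `n + 1` elements. -/
theorem dist_le_of_path (hd : 1 ≤ d) {σ h : ℝ} (hQ : M.mesh.QuasiUniform σ h)
    {P : ℕ → Finset (Pt d)} {n : ℕ} (hP : ∀ j ≤ n, P j ∈ M.active)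
    (hF : ∀ j < n, FaceNeighbors (P j) (P (j + 1))) {x y : Pt d} (hx : x ∈ simplex (P 0))
    (hy : y ∈ simplex (P n)) : dist x y ≤ (n + 1) * h := by
  induction n generalizing y with
  | zero => simpa using hQ.dist_le (active_subset (hP 0 le_rfl)) hx hy
  | succ n ih =>
    obtain ⟨q, hq⟩ : (P n ∩ P (n + 1)).Nonempty :=
      Finset.card_pos.1 (by rw [hF n n.lt_succ_self]; exact hd)
    rw [Finset.mem_inter] at hq
    have h1 := ih (fun j hj => hP j (by omega)) (fun j hj => hF j (by omega))
      (y := q) (subset_convexHull ℝ _ hq.1)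
    have h2 := hQ.dist_le (active_subset (hP (n + 1) le_rfl)) (subset_convexHull ℝ _ hq.2) hy
    push_cast
    linarith [dist_triangle x q y]

theorem dist_le_of_mem_S (hd : 1 ≤ d) {σ h : ℝ} (hh : 0 < h) (hQ : M.mesh.QuasiUniform σ h)
    {N : ℕ} (hD : D.PathBound N) {T : Finset (Pt d)} (hT : T ∈ M.small) {x y : Pt d}
    (hx : x ∈ simplex T) (hy : y ∈ simplex (D.S T)) : dist x y ≤ N * h := by
  obtain ⟨n, hn, P, h0, hPn, hP, hF⟩ := hD T hT
  rw [← h0] at hx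
  rw [← hPn] at hy
  refine (dist_le_of_path hd hQ hP hF hx hy).trans ?_
  gcongr
  exact_mod_cast hn

theorem exists_vertex {T : Finset (Pt d)} (hT : T ∈ M.active) : ∃ p ∈ T, p ∈ simplex T := by
  obtain ⟨p, hp⟩ : T.Nonempty := Finset.card_pos.1 (by rw [(isSimplex hT).card_eq]; omega)
  exact ⟨p, hp, subset_convexHull ℝ _ hp⟩

/-- The longest route goes from `z` to the node `i` (`h`), along the path from `T_i` to `S_h(T_i)`
(`N h`), and on to a neighbor of that element (`2 h`). The remaining `h` makes the inequality
strict, as the ball is open. -/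
theorem dependenceRegion_subset_ball (hd : 1 ≤ d) (hk : 1 ≤ k) {σ h : ℝ} (hh : 0 < h)
    (hQ : M.mesh.QuasiUniform σ h) {N : ℕ} (hD : D.PathBound N) {T : Finset (Pt d)}
    (hT : T ∈ M.active) {z : Pt d} (hz : z ∈ simplex T) :
    D.dependenceRegion T ⊆ Metric.ball z ((N + 4) * h) := by
  have key : ∀ S ∈ M.small, ∀ x ∈ simplex S, ∀ y ∈ M.neighborhood k (D.S S),
      dist x y ≤ (N + 2) * h := by
    intro S hS x hx y hy
    have hL := large_subset (D.S_mem S hS)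
    obtain ⟨q, -, hq⟩ := exists_vertex hL
    have h1 := D.dist_le_of_mem_S hd hh hQ hD hS hx hq
    have h2 := dist_le_of_mem_neighborhood hk hQ hL hq hy
    linarith [dist_triangle x q y]
  have hN : 0 ≤ (N : ℝ) * h := by positivity
  rintro y ((hy | ⟨hTs, hy⟩) | hy)
  · have := dist_le_of_mem_neighborhood hk hQ hT hz hy
    rw [Metric.mem_ball, dist_comm]; linarith
  · have := key T hTs z hz y hy
    rw [Metric.mem_ball, dist_comm]; linarith
  · obtain ⟨i, hi, hy⟩ := Set.mem_iUnion₂.1 hy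
    obtain ⟨hi, hiT⟩ := Finset.mem_filter.1 hi
    have hiT' := elementNodes_subset_simplex hk (mem_of_inSupport hk hT (smallNodes_subset hi) hiT)
    have hiS := elementNodes_subset_simplex hk (D.node_mem_stabElem hk hi)
    have h1 := hQ.dist_le (active_subset hT) hz hiT'
    have h2 := dist_triangle z i y
    rw [Metric.mem_ball, dist_comm]
    rcases hy with hy | hy
    · have := dist_le_of_mem_neighborhood hk hQ (D.stabElem_mem i hi).1 hiS hy
      linarith
    · have := key _ (D.stabElem_mem_small hi) i hiS y hy
      linarith

end NodalChoice

/-! ### The local projection -/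

theorem lintegral_enorm_sq_eq {α : Type*} [MeasurableSpace α] {μ : Measure α} {f : α → ℝ}
    (hf : MemLp f 2 μ) : ∫⁻ x, ‖f x‖ₑ ^ 2 ∂μ = ENNReal.ofReal (∫ x, f x ^ 2 ∂μ) := by
  rw [ofReal_integral_eq_lintegral_ofReal hf.integrable_sq
    (Filter.Eventually.of_forall fun x => sq_nonneg _)]
  refine lintegral_congr fun x => ?_
  rw [← Real.enorm_of_nonneg (sq_nonneg _), enorm_pow]

/-- The Gram form on `Poly d k` is definite because the simplex has interior points; in finite
dimension it therefore represents every functional. -/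
theorem exists_l2Proj {d k : ℕ} {T : Finset (Pt d)} (hT : IsSimplex T) {u : Pt d → ℝ}
    (hu : MemLp u 2 (volume.restrict (simplex T))) :
    ∃ p ∈ Poly d k, ∀ q ∈ Poly d k,
      ∫ x in simplex T, (u x - polyVal p x) * polyVal q x = 0 := by
  have hb := (isCompact_simplex T).isBounded
  have hm : ∀ p : MvPolynomial (Fin d) ℝ, MemLp (polyVal p) 2 (volume.restrict (simplex T)) :=
    fun p => memLp_polyVal p hb
  have hmul : ∀ {f g : Pt d → ℝ}, MemLp f 2 (volume.restrict (simplex T)) →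
      MemLp g 2 (volume.restrict (simplex T)) →
      Integrable (fun x => f x * g x) (volume.restrict (simplex T)) := fun hf hg =>
    hf.integrable_mul hg
  let A : Poly d k →ₗ[ℝ] Module.Dual ℝ (Poly d k) := LinearMap.mk₂ ℝ
    (fun p q => ∫ x in simplex T, polyVal p.1 x * polyVal q.1 x)
    (fun p p' q => by
      rw [← integral_add (hmul (hm _) (hm _)) (hmul (hm _) (hm _))]
      simp [add_mul])
    (fun c p q => by
      rw [smul_eq_mul, ← integral_const_mul]
      simp [mul_assoc])
    (fun p q q' => by
      rw [← integral_add (hmul (hm _) (hm _)) (hmul (hm _) (hm _))]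
      simp [mul_add])
    (fun c p q => by
      rw [smul_eq_mul, ← integral_const_mul]
      simp [mul_left_comm])
  have hinj : Function.Injective A := by
    rw [injective_iff_map_eq_zero]
    rintro ⟨p, hp⟩ h0
    have h1 : ∫ x in simplex T, polyVal p x * polyVal p x = 0 := LinearMap.congr_fun h0 ⟨p, hp⟩
    rw [integral_eq_zero_iff_of_nonneg (fun x => mul_self_nonneg _) (hmul (hm _) (hm _))] at h1
    have h2 : polyVal p =ᵐ[volume.restrict (interior (simplex T))] 0 := by
      filter_upwards [ae_mono (Measure.restrict_mono interior_subset le_rfl) h1] with x hx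
      exact mul_self_eq_zero.1 hx
    exact Subtype.ext (eq_zero_of_polyVal_eq_zero isOpen_interior hT.interior_nonempty
      (Measure.eqOn_open_of_ae_eq h2 isOpen_interior (continuous_polyVal p).continuousOn
        continuousOn_const))
  have hsurj : Function.Surjective A :=
    (LinearMap.injective_iff_surjective_of_finrank_eq_finrank Subspace.dual_finrank_eq.symm).1 hinj
  let ℓ : Module.Dual ℝ (Poly d k) :=
    { toFun := fun q => ∫ x in simplex T, u x * polyVal q.1 x
      map_add' := fun p q => by
        rw [← integral_add (hmul hu (hm _)) (hmul hu (hm _))]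
        simp [mul_add]
      map_smul' := fun c p => by
        rw [RingHom.id_apply, smul_eq_mul, ← integral_const_mul]
        simp [mul_left_comm] }
  obtain ⟨⟨p, hp⟩, hAp⟩ := hsurj ℓ
  refine ⟨p, hp, fun q hq => ?_⟩
  have h1 : ∫ x in simplex T, polyVal p x * polyVal q x = ∫ x in simplex T, u x * polyVal q x :=
    LinearMap.congr_fun hAp ⟨q, hq⟩
  simp only [sub_mul]
  rw [integral_sub (hmul hu (hm _)) (hmul (hm _) (hm _)), h1, sub_self]

theorem l2Proj_mem {d k : ℕ} {T : Finset (Pt d)} (hT : IsSimplex T) {u : Pt d → ℝ}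
    (hu : MemLp u 2 (volume.restrict (simplex T))) : l2Proj k T u ∈ Poly d k := by
  rw [l2Proj, dif_pos (exists_l2Proj hT hu)]
  exact (exists_l2Proj hT hu).choose_spec.1

theorem integral_sub_l2Proj_mul {d k : ℕ} {T : Finset (Pt d)} (hT : IsSimplex T) {u : Pt d → ℝ}
    (hu : MemLp u 2 (volume.restrict (simplex T))) {q : MvPolynomial (Fin d) ℝ}
    (hq : q ∈ Poly d k) :
    ∫ x in simplex T, (u x - polyVal (l2Proj k T u) x) * polyVal q x = 0 := by
  rw [l2Proj, dif_pos (exists_l2Proj hT hu)]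
  exact (exists_l2Proj hT hu).choose_spec.2 q hq

/-- Pythagoras: `u - q` is the orthogonal sum of `u - P u` and `P u - q`. -/
theorem lintegral_l2Proj_sub_le {d k : ℕ} {T : Finset (Pt d)} (hT : IsSimplex T) {u : Pt d → ℝ}
    (hu : MemLp u 2 (volume.restrict (simplex T))) {q : MvPolynomial (Fin d) ℝ}
    (hq : q ∈ Poly d k) :
    ∫⁻ x in simplex T, ‖polyVal (l2Proj k T u - q) x‖ₑ ^ 2 ≤
      ∫⁻ x in simplex T, ‖u x - polyVal q x‖ₑ ^ 2 := by
  have hb := (isCompact_simplex T).isBounded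
  have hm : ∀ p : MvPolynomial (Fin d) ℝ, MemLp (polyVal p) 2 (volume.restrict (simplex T)) :=
    fun p => memLp_polyVal p hb
  set r := l2Proj k T u - q
  have hr : r ∈ Poly d k := Submodule.sub_mem _ (l2Proj_mem hT hu) hq
  have h1 := hu.sub (hm (l2Proj k T u))
  rw [lintegral_enorm_sq_eq (hm r), lintegral_enorm_sq_eq (f := fun x => u x - polyVal q x)
    (hu.sub (hm q))]
  refine ENNReal.ofReal_le_ofReal ?_
  have h2 : ∫ x in simplex T, (u x - polyVal q x) ^ 2 =
      (∫ x in simplex T, (u x - polyVal (l2Proj k T u) x) ^ 2) +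
        ∫ x in simplex T, polyVal r x ^ 2 := by
    have h3 : ∀ x, (u x - polyVal q x) ^ 2 = (u x - polyVal (l2Proj k T u) x) ^ 2 +
        (2 * ((u x - polyVal (l2Proj k T u) x) * polyVal r x) + polyVal r x ^ 2) := fun x => by
      simp only [r, polyVal_sub]; ring
    have i1 : Integrable (fun x => (u x - polyVal (l2Proj k T u) x) ^ 2)
      (volume.restrict (simplex T)) := h1.integrable_sq
    have i2 : Integrable (fun x => (u x - polyVal (l2Proj k T u) x) * polyVal r x)
      (volume.restrict (simplex T)) := h1.integrable_mul (hm r)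
    have i3 := (hm r).integrable_sq
    have i4 : Integrable (fun x => 2 * ((u x - polyVal (l2Proj k T u) x) * polyVal r x) +
      polyVal r x ^ 2) (volume.restrict (simplex T)) := (i2.const_mul 2).add i3
    simp only [h3]
    rw [integral_add i1 i4, integral_add (i2.const_mul 2) i3,
      integral_const_mul, integral_sub_l2Proj_mul hT hu hr]
    ring
  rw [h2]
  have : 0 ≤ ∫ x in simplex T, (u x - polyVal (l2Proj k T u) x) ^ 2 :=
    integral_nonneg fun x => sq_nonneg _
  linarith

theorem ofReal_pow_ne_zero {h : ℝ} (hh : 0 < h) (n : ℕ) : ENNReal.ofReal h ^ n ≠ 0 :=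
  pow_ne_zero _ (ENNReal.ofReal_pos.2 hh).ne'

theorem ofReal_pow_ne_top (h : ℝ) (n : ℕ) : ENNReal.ofReal h ^ n ≠ ⊤ :=
  ENNReal.pow_ne_top ENNReal.ofReal_ne_top

/-- Values of the local projection error at points of the element. -/
theorem exists_l2Proj_bound (d k : ℕ) {σ : ℝ} (hσ : 0 < σ) :
    ∃ C : ℝ≥0, ∀ h : ℝ, 0 < h → ∀ T : Finset (Pt d), IsSimplex T →
      Metric.diam (simplex T) ≤ h → (∃ z, Metric.closedBall z (σ * h) ⊆ simplex T) →
      ∀ u : Pt d → ℝ, MemLp u 2 (volume.restrict (simplex T)) → ∀ q ∈ Poly d k,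
      ∀ x ∈ simplex T, ‖polyVal (l2Proj k T u - q) x‖ₑ ^ 2 * ENNReal.ofReal h ^ d ≤
        C * ∫⁻ y in simplex T, ‖u y - polyVal q y‖ₑ ^ 2 := by
  obtain ⟨C, hC⟩ := exists_inverse_estimate d k 1 hσ []
  refine ⟨C, fun h hh T hT hdiam ⟨z, hz⟩ u hu q hq x hx => ?_⟩
  have hzT : z ∈ simplex T := hz (Metric.mem_closedBall_self (by positivity))
  -- The center of the inscribed ball lies in `T`, so the diameter bound puts all of `T` within
  -- distance `h` of it; this is the ratio `1` passed to the inverse estimate.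
  have hxz : x ∈ Metric.closedBall z (1 * h) := by
    rw [one_mul]
    exact (Metric.dist_le_diam_of_mem (isCompact_simplex T).isBounded hx hzT).trans hdiam
  have h1 := hC h hh _ (Submodule.sub_mem _ (l2Proj_mem hT hu) hq) z x hxz
  rw [listDeriv_nil, List.length_nil, mul_zero, add_zero] at h1
  refine h1.trans ?_
  gcongr (C : ℝ≥0∞) * ?_
  exact (lintegral_mono_set (Metric.ball_subset_closedBall.trans hz)).trans
    (lintegral_l2Proj_sub_le hT hu hq)

theorem eq_sum_lagrange {d k : ℕ} (hk : 1 ≤ k) {T : Finset (Pt d)} (hT : IsSimplex T)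
    {ψ : Pt d → MvPolynomial (Fin d) ℝ} (hψ : ∀ i ∈ elementNodes k T, ψ i ∈ Poly d k)
    (hδ : ∀ i ∈ elementNodes k T, ∀ j ∈ elementNodes k T,
      polyVal (ψ i) j = if j = i then 1 else 0)
    {r : MvPolynomial (Fin d) ℝ} (hr : r ∈ Poly d k) :
    r = ∑ i ∈ elementNodes k T, polyVal r i • ψ i := by
  refine sub_eq_zero.1 (eq_zero_of_elementNodes hk hT (Submodule.sub_mem _ hr
    (Submodule.sum_mem _ fun i hi => Submodule.smul_mem _ _ (hψ i hi))) fun j hj => ?_)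
  rw [polyVal_sub, polyVal_sum, Finset.sum_eq_single j]
  · rw [polyVal_smul, hδ j hj j hj, if_pos rfl, mul_one, sub_self]
  · intro i hi hij
    rw [polyVal_smul, hδ i hi j hj, if_neg hij.symm, mul_zero]
  · exact fun h => absurd hj h

theorem volume_ball_mul {d : ℕ} (z : Pt d) {h : ℝ} (hh : 0 < h) (σ : ℝ) :
    volume (Metric.ball z (σ * h)) =
      ENNReal.ofReal h ^ d * volume (Metric.ball (0 : Pt d) σ) := by
  rw [mul_comm, Measure.addHaar_ball_mul_of_pos _ _ hh, finrank_euclideanSpace, Fintype.card_fin,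
    ENNReal.ofReal_pow hh.le]

/-- The inverse estimate from the inscribed ball turns the bound `k ^ k` on the element into bounds
for derivatives; the volume of the ball cancels the factor `h ^ d`. -/
theorem exists_lagrange_bound (d k : ℕ) {σ : ℝ} (R : ℝ) (hσ : 0 < σ) (L : List (Fin d)) :
    ∃ C : ℝ≥0, ∀ h : ℝ, 0 < h → ∀ T : Finset (Pt d), ∀ z,
      Metric.closedBall z (σ * h) ⊆ simplex T → ∀ ψ ∈ Poly d k,
      (∀ x ∈ simplex T, |polyVal ψ x| ≤ (k : ℝ) ^ k) → ∀ x ∈ Metric.closedBall z (R * h),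
        ‖polyVal (listDeriv L ψ) x‖ₑ ^ 2 * ENNReal.ofReal h ^ (2 * L.length) ≤ C := by
  obtain ⟨C, hC⟩ := exists_inverse_estimate d k R hσ L
  have hV : volume (Metric.ball (0 : Pt d) σ) ≠ ⊤ := measure_ball_lt_top.ne
  refine ⟨C * (((k : ℝ≥0) ^ k) ^ 2 * (volume (Metric.ball (0 : Pt d) σ)).toNNReal),
    fun h hh T z hz ψ hψ hb x hx => ?_⟩
  have h1 := hC h hh ψ hψ z x hx
  have h2 : ∫⁻ y in Metric.ball z (σ * h), ‖polyVal ψ y‖ₑ ^ 2 ≤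
      ENNReal.ofReal h ^ d * (((k : ℝ≥0∞) ^ k) ^ 2 * volume (Metric.ball (0 : Pt d) σ)) := by
    calc _ ≤ ∫⁻ y in Metric.ball z (σ * h), ((k : ℝ≥0∞) ^ k) ^ 2 := by
          refine setLIntegral_mono' measurableSet_ball fun y hy => ?_
          gcongr
          have := hb y (hz (Metric.ball_subset_closedBall hy))
          rw [← ofReal_norm, Real.norm_eq_abs]
          refine (ENNReal.ofReal_le_ofReal this).trans ?_
          rw [ENNReal.ofReal_pow (by positivity), ENNReal.ofReal_natCast]
      _ = _ := by
          rw [setLIntegral_const, volume_ball_mul z hh]; ring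
  have h3 : ENNReal.ofReal h ^ d *
      (‖polyVal (listDeriv L ψ) x‖ₑ ^ 2 * ENNReal.ofReal h ^ (2 * L.length)) ≤
      ENNReal.ofReal h ^ d * (C * (((k : ℝ≥0∞) ^ k) ^ 2 * volume (Metric.ball (0 : Pt d) σ))) := by
    calc _ = ‖polyVal (listDeriv L ψ) x‖ₑ ^ 2 * ENNReal.ofReal h ^ (d + 2 * L.length) := by
          rw [pow_add]; ring
      _ ≤ _ := h1.trans ((mul_le_mul_right h2 _).trans (le_of_eq (by ring)))
  have h4 := (ENNReal.mul_le_mul_iff_right (ofReal_pow_ne_zero hh d) (ofReal_pow_ne_top h d)).1 h3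
  refine h4.trans (le_of_eq ?_)
  push_cast
  rw [ENNReal.coe_toNNReal hV]

theorem sum_sq_mul_le {ι : Type*} (s : Finset ι) (f : ι → ℝ≥0∞) (a c : ℝ≥0∞)
    (h : ∀ i ∈ s, f i ^ 2 * a ≤ c) : (∑ i ∈ s, f i) ^ 2 * a ≤ (s.card : ℝ≥0∞) ^ 2 * c := by
  rcases s.eq_empty_or_nonempty with rfl | hs
  · simp
  obtain ⟨i, hi, hmax⟩ := s.exists_max_image f hs
  calc (∑ i ∈ s, f i) ^ 2 * a ≤ (s.card • f i) ^ 2 * a := by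
        gcongr
        exact Finset.sum_le_card_nsmul _ _ _ hmax
    _ = (s.card : ℝ≥0∞) ^ 2 * (f i ^ 2 * a) := by rw [nsmul_eq_mul]; ring
    _ ≤ _ := by gcongr; exact h i hi

/-- Expansion in the Lagrange polynomials of `T`, whose number is at most the dimension of `Poly d
k`. The point `x` may lie outside `T`, as is needed when a polynomial on `S_h(T_i)` is evaluated at
`x_i`. -/
theorem exists_nodal_bound_list (d k : ℕ) (hk : 1 ≤ k) {σ : ℝ} (R : ℝ) (hσ : 0 < σ)
    (L : List (Fin d)) :
    ∃ C : ℝ≥0, ∀ h : ℝ, 0 < h → ∀ T : Finset (Pt d), IsSimplex T → ∀ z,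
      Metric.closedBall z (σ * h) ⊆ simplex T → ∀ r ∈ Poly d k, ∀ K : ℝ≥0∞,
      (∀ j ∈ elementNodes k T, ‖polyVal r j‖ₑ ^ 2 * ENNReal.ofReal h ^ d ≤ K) →
      ∀ x ∈ Metric.closedBall z (R * h),
        ‖polyVal (listDeriv L r) x‖ₑ ^ 2 * ENNReal.ofReal h ^ (d + 2 * L.length) ≤ C * K := by
  obtain ⟨C, hC⟩ := exists_lagrange_bound d k R hσ L
  refine ⟨(Module.finrank ℝ (Poly d k) : ℝ≥0) ^ 2 * C, fun h hh T hT z hz r hr K hK x hx => ?_⟩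
  have hψ : ∀ i ∈ elementNodes k T, ∃ ψ ∈ Poly d k,
      (∀ j ∈ elementNodes k T, polyVal ψ j = if j = i then 1 else 0) ∧
      ∀ x ∈ simplex T, |polyVal ψ x| ≤ (k : ℝ) ^ k := fun i hi => exists_lagrange hk hT hi
  choose! ψ hψP hψδ hψb using hψ
  have h1 : polyVal (listDeriv L r) x =
      ∑ i ∈ elementNodes k T, polyVal r i * polyVal (listDeriv L (ψ i)) x := by
    conv_lhs => rw [eq_sum_lagrange hk hT hψP hψδ hr]
    rw [map_sum, polyVal_sum]
    exact Finset.sum_congr rfl fun i _ => by rw [map_smul, polyVal_smul]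
  calc ‖polyVal (listDeriv L r) x‖ₑ ^ 2 * ENNReal.ofReal h ^ (d + 2 * L.length)
      ≤ (∑ i ∈ elementNodes k T, ‖polyVal r i * polyVal (listDeriv L (ψ i)) x‖ₑ) ^ 2 *
        ENNReal.ofReal h ^ (d + 2 * L.length) := by
        rw [h1]; gcongr; exact enorm_sum_le _ _
    _ ≤ ((elementNodes k T).card : ℝ≥0∞) ^ 2 * (C * K) := by
        refine sum_sq_mul_le _ _ _ _ fun i hi => ?_
        calc _ = (‖polyVal (listDeriv L (ψ i)) x‖ₑ ^ 2 * ENNReal.ofReal h ^ (2 * L.length)) *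
              (‖polyVal r i‖ₑ ^ 2 * ENNReal.ofReal h ^ d) := by
              rw [enorm_mul, pow_add]; ring
          _ ≤ _ := mul_le_mul' (hC h hh T z hz _ (hψP i hi) (hψb i hi) x hx) (hK i hi)
    _ ≤ (Module.finrank ℝ (Poly d k) : ℝ≥0∞) ^ 2 * (C * K) := by
        gcongr; exact card_elementNodes_le hk hT
    _ = _ := by push_cast; ring

/-- A polynomial and its derivatives are controlled, near an element, by its nodal values. -/
theorem exists_nodal_bound (d k n : ℕ) (hk : 1 ≤ k) {σ : ℝ} (R : ℝ) (hσ : 0 < σ) :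
    ∃ C : ℝ≥0, ∀ L : List (Fin d), L.length ≤ n → ∀ h : ℝ, 0 < h →
      ∀ T : Finset (Pt d), IsSimplex T → ∀ z,
      Metric.closedBall z (σ * h) ⊆ simplex T → ∀ r ∈ Poly d k, ∀ K : ℝ≥0∞,
      (∀ j ∈ elementNodes k T, ‖polyVal r j‖ₑ ^ 2 * ENNReal.ofReal h ^ d ≤ K) →
      ∀ x ∈ Metric.closedBall z (R * h),
        ‖polyVal (listDeriv L r) x‖ₑ ^ 2 * ENNReal.ofReal h ^ (d + 2 * L.length) ≤ C * K := by
  choose C hC using exists_nodal_bound_list d k hk R hσ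
  -- Only finitely many lists of bounded length exist, so one constant serves all of them.
  have hfin : {L : List (Fin d) | L.length ≤ n}.Finite := List.finite_length_le _ _
  refine ⟨hfin.toFinset.sup C, fun L hL h hh T hT z hz r hr K hK x hx => ?_⟩
  refine (hC L h hh T hT z hz r hr K hK x hx).trans ?_
  gcongr
  exact Finset.le_sup (f := C) (hfin.mem_toFinset.2 hL)

/-! ### The local error estimate -/

namespace NodalChoice

open CutMesh

variable {d k : ℕ}

theorem simplex_subset_neighborhood {M : CutMesh d} (hk : 1 ≤ k) {T : Finset (Pt d)}
    (hT : T ∈ M.active) : simplex T ⊆ M.neighborhood k T := by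
  obtain ⟨i, hi⟩ : (elementNodes k T).Nonempty := by
    by_contra h
    rw [Finset.not_nonempty_iff_eq_empty] at h
    have := eq_zero_of_elementNodes hk (isSimplex hT) (p := 1)
      (mem_Poly.2 (by simp [MvPolynomial.totalDegree_one])) (by simp [h])
    exact one_ne_zero this
  exact neighborhood_of_mem hT hi hi

theorem neighborhood_subset_dependenceRegion {M : CutMesh d} (D : NodalChoice M k)
    (T : Finset (Pt d)) : M.neighborhood k T ⊆ D.dependenceRegion T :=
  fun _ hx => Or.inl (Or.inl hx)

theorem neighborhood_S_subset_dependenceRegion {M : CutMesh d} (D : NodalChoice M k)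
    (hk : 1 ≤ k) {T : Finset (Pt d)} (hT : T ∈ M.active) {i : Pt d} (hi : i ∈ M.smallNodes k)
    (hiT : i ∈ elementNodes k T) :
    M.neighborhood k (D.S (D.stabElem i)) ⊆ D.dependenceRegion T := fun _ hx =>
  Or.inr (Set.mem_iUnion₂.2 ⟨i, Finset.mem_filter.2 ⟨hi, inSupport_of_mem hk hT hiT⟩, Or.inr hx⟩)

/-- A large node has a Clément value, bounded through the local projection. A small node takes its
value from the polynomial on `S_h(T_i)`, whose nodal values are themselves Clément values; hence the
extra summand `C₂ * C₁`. The ratio `2 * Λ` arises because both elements lie in one ball of radius `Λ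
h`. -/
theorem exists_nodal_error (d k : ℕ) (hk : 1 ≤ k) {σ : ℝ} (hσ : 0 < σ) (Λ : ℝ) :
    ∃ C : ℝ≥0, ∀ (M : CutMesh d) (h : ℝ), 0 < h → M.mesh.QuasiUniform σ h →
      ∀ D : NodalChoice M k, ∀ T ∈ M.active, ∀ z,
      D.dependenceRegion T ⊆ Metric.ball z (Λ * h) → ∀ u : Pt d → ℝ,
      MemLp u 2 (volume.restrict (Metric.ball z (Λ * h))) → ∀ q ∈ Poly d k,
      ∀ i ∈ elementNodes k T,
        ‖polyVal (polyExt k T (D.tildePi (D.clement u)) - q) i‖ₑ ^ 2 * ENNReal.ofReal h ^ d ≤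
          C * ∫⁻ x in Metric.ball z (Λ * h), ‖u x - polyVal q x‖ₑ ^ 2 := by
  obtain ⟨C₁, hC₁⟩ := exists_l2Proj_bound d k hσ
  obtain ⟨C₂, hC₂⟩ := exists_nodal_bound d k 0 hk (2 * Λ) hσ
  refine ⟨C₁ + C₂ * C₁, fun M h hh hQ D T hT z hz u hu q hq i hi => ?_⟩
  set B := Metric.ball z (Λ * h)
  set e := ∫⁻ x in B, ‖u x - polyVal q x‖ₑ ^ 2
  have hw := D.clement_mem hk u
  -- The element used for the Clément value at `j` has `j` as a node, so it belongs to the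
  -- neighborhood of `S` and lies in the ball.
  have hclement : ∀ S : Finset (Pt d), S ∈ M.active → M.neighborhood k S ⊆ B →
      ∀ j ∈ elementNodes k S,
        ‖D.clement u j - polyVal q j‖ₑ ^ 2 * ENNReal.ofReal h ^ d ≤ C₁ * e := by
    intro S hS hSB j hj
    have hjM := mem_nodes hS hj
    have hT' := (D.clementElem_mem j hjM).1
    have hj' := D.node_mem_clementElem hk hjM
    have hsub : simplex (D.clementElem j) ⊆ B := (neighborhood_of_mem hT' hj hj').trans hSB
    obtain ⟨hdiam, hball⟩ := hQ _ (active_subset hT')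
    rw [D.clement_node hk u hjM, ← polyVal_sub]
    refine (hC₁ h hh _ (isSimplex hT') hdiam hball u
      (hu.mono_measure (Measure.restrict_mono hsub le_rfl)) q hq j
      (elementNodes_subset_simplex hk hj')).trans ?_
    gcongr (C₁ : ℝ≥0∞) * ?_
    exact lintegral_mono_set hsub
  have hTB : M.neighborhood k T ⊆ B := (D.neighborhood_subset_dependenceRegion T).trans hz
  have hiM := mem_nodes hT hi
  rw [polyVal_sub, ← eq_polyExt (D.tildePi_mem hk _) hT (elementNodes_subset_simplex hk hi),
    ENNReal.coe_add, ENNReal.coe_mul, add_mul]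
  by_cases his : i ∈ M.smallNodes k
  · rw [D.tildePi_smallNode hk _ his, ← polyVal_sub]
    set S := D.S (D.stabElem i)
    have hS : S ∈ M.active := large_subset (D.S_stabElem_mem his)
    have hSB : M.neighborhood k S ⊆ B :=
      (D.neighborhood_S_subset_dependenceRegion hk hT his hi).trans hz
    obtain ⟨-, y, hy⟩ := hQ _ (active_subset hS)
    have hyB : y ∈ B := hSB (simplex_subset_neighborhood hk hS
      (hy (Metric.mem_closedBall_self (by positivity))))
    have hiB : i ∈ B :=
      hTB (simplex_subset_neighborhood hk hT (elementNodes_subset_simplex hk hi))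
    have hiy : i ∈ Metric.closedBall y (2 * Λ * h) := by
      rw [Metric.mem_closedBall]
      have := dist_triangle_right i y z
      rw [Metric.mem_ball] at hyB hiB
      linarith
    have h1 := hC₂ [] le_rfl h hh S (isSimplex hS) y hy (polyExt k S (D.clement u) - q)
      (Submodule.sub_mem _ (polyExt_mem hw hS) hq) (C₁ * e) (fun j hj => by
        rw [polyVal_sub, ← eq_polyExt hw hS (elementNodes_subset_simplex hk hj)]
        exact hclement S hS hSB j hj) i hiy
    rw [listDeriv_nil, List.length_nil, mul_zero, add_zero, ← mul_assoc] at h1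
    exact h1.trans (le_add_of_nonneg_left zero_le)
  · rw [D.tildePi_largeNode hk _ (Finset.mem_sdiff.2 ⟨hiM, his⟩)]
    exact (hclement T hT hTB i hi).trans (le_add_of_nonneg_right zero_le)

/-- The nodal errors bound all derivatives pointwise on `T`; integrating over `T`, whose volume is
at most a multiple of `h ^ d`, removes the factor `h ^ d`. -/
theorem exists_poly_error (d k : ℕ) (hk : 1 ≤ k) {σ : ℝ} (hσ : 0 < σ) (Λ : ℝ) :
    ∃ C : ℝ≥0, ∀ (M : CutMesh d) (h : ℝ), 0 < h → M.mesh.QuasiUniform σ h →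
      ∀ D : NodalChoice M k, ∀ T ∈ M.active, ∀ z,
      D.dependenceRegion T ⊆ Metric.ball z (Λ * h) → ∀ u : Pt d → ℝ,
      MemLp u 2 (volume.restrict (Metric.ball z (Λ * h))) → ∀ q ∈ Poly d k,
      ∀ L : List (Fin d), L.length ≤ k + 1 →
        (∫⁻ x in simplex T,
          ‖polyVal (listDeriv L (polyExt k T (D.tildePi (D.clement u)) - q)) x‖ₑ ^ 2) *
            ENNReal.ofReal h ^ (2 * L.length) ≤
          C * ∫⁻ x in Metric.ball z (Λ * h), ‖u x - polyVal q x‖ₑ ^ 2 := by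
  obtain ⟨C₁, hC₁⟩ := exists_nodal_error d k hk hσ Λ
  obtain ⟨C₂, hC₂⟩ := exists_nodal_bound d k (k + 1) hk (2 * Λ) hσ
  have hV : volume (Metric.ball (0 : Pt d) Λ) ≠ ⊤ := measure_ball_lt_top.ne
  refine ⟨C₂ * C₁ * (volume (Metric.ball (0 : Pt d) Λ)).toNNReal,
    fun M h hh hQ D T hT z hz u hu q hq L hL => ?_⟩
  have hnode := hC₁ M h hh hQ D T hT z hz u hu q hq
  set B := Metric.ball z (Λ * h)
  set e := ∫⁻ x in B, ‖u x - polyVal q x‖ₑ ^ 2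
  set r := polyExt k T (D.tildePi (D.clement u)) - q
  have hr : r ∈ Poly d k := Submodule.sub_mem _ (polyExt_mem (D.tildePi_mem hk _) hT) hq
  have hTB : simplex T ⊆ B := (simplex_subset_neighborhood hk hT).trans
    ((D.neighborhood_subset_dependenceRegion T).trans hz)
  obtain ⟨-, y, hy⟩ := hQ _ (active_subset hT)
  have hyB : y ∈ B := hTB (hy (Metric.mem_closedBall_self (by positivity)))
  have h1 : ∀ x ∈ simplex T, ‖polyVal (listDeriv L r) x‖ₑ ^ 2 *
      ENNReal.ofReal h ^ (d + 2 * L.length) ≤ C₂ * (C₁ * e) := fun x hx => by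
    refine hC₂ L hL h hh T (isSimplex hT) y hy r hr _ hnode x ?_
    rw [Metric.mem_closedBall]
    have := dist_triangle_right x y z
    have hxB := hTB hx
    rw [Metric.mem_ball] at hyB hxB
    linarith
  have h2 : ENNReal.ofReal h ^ d * ((∫⁻ x in simplex T, ‖polyVal (listDeriv L r) x‖ₑ ^ 2) *
      ENNReal.ofReal h ^ (2 * L.length)) ≤ ENNReal.ofReal h ^ d *
      (C₂ * C₁ * volume (Metric.ball (0 : Pt d) Λ) * e) := by
    calc _ = ∫⁻ x in simplex T, ‖polyVal (listDeriv L r) x‖ₑ ^ 2 *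
          ENNReal.ofReal h ^ (d + 2 * L.length) := by
          rw [lintegral_mul_const' _ _ (ofReal_pow_ne_top h _), pow_add]; ring
      _ ≤ ∫⁻ x in simplex T, C₂ * (C₁ * e) :=
          setLIntegral_mono' (isCompact_simplex T).measurableSet h1
      _ = C₂ * (C₁ * e) * volume (simplex T) := by rw [setLIntegral_const]
      _ ≤ C₂ * (C₁ * e) * (ENNReal.ofReal h ^ d * volume (Metric.ball (0 : Pt d) Λ)) := by
          gcongr
          rw [← volume_ball_mul z hh]
          exact measure_mono hTB
      _ = _ := by ring
  have h3 := (ENNReal.mul_le_mul_iff_right (ofReal_pow_ne_zero hh d) (ofReal_pow_ne_top h d)).1 h2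
  refine h3.trans (le_of_eq ?_)
  push_cast
  rw [ENNReal.coe_toNNReal hV]

theorem enorm_sub_sq_le (a b c : ℝ) : ‖a - c‖ₑ ^ 2 ≤ 4 * (‖a - b‖ₑ ^ 2 + ‖c - b‖ₑ ^ 2) := by
  have h1 : ‖a - c‖ₑ ≤ ‖a - b‖ₑ + ‖c - b‖ₑ := by
    have : a - c = (a - b) - (c - b) := by ring
    rw [this]; exact enorm_sub_le
  have h2 : ∀ x y : ℝ≥0∞, (x + y) ^ 2 ≤ 4 * (x ^ 2 + y ^ 2) := fun x y => by
    have h3 : x + y ≤ 2 * max x y := by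
      rw [two_mul]; exact add_le_add (le_max_left _ _) (le_max_right _ _)
    calc (x + y) ^ 2 ≤ (2 * max x y) ^ 2 := by gcongr
      _ = 4 * max x y ^ 2 := by rw [mul_pow]; norm_num
      _ ≤ _ := by
        gcongr
        rcases max_cases x y with h | h <;> rw [h.1]
        · exact le_add_of_nonneg_right zero_le
        · exact le_add_of_nonneg_left zero_le
  calc _ ≤ (‖a - b‖ₑ + ‖c - b‖ₑ) ^ 2 := by gcongr
    _ ≤ _ := h2 _ _

/-- Derivatives of order below `m` converge faster than required; the surplus powers of `h ≤ h₀` go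
into the constant. -/
theorem ofReal_pow_le {h h₀ : ℝ} (hh₀ : h ≤ h₀) {a b n : ℕ} (hab : b ≤ a) (ha : a ≤ b + n) :
    ENNReal.ofReal h ^ a ≤ ENNReal.ofReal (max h₀ 1) ^ n * ENNReal.ofReal h ^ b := by
  obtain ⟨c, rfl⟩ := Nat.exists_eq_add_of_le hab
  have h1 : (1 : ℝ≥0∞) ≤ ENNReal.ofReal (max h₀ 1) := by
    rw [ENNReal.one_le_ofReal]; exact le_max_right _ _
  rw [pow_add, mul_comm]
  refine mul_le_mul_left ?_ _
  calc ENNReal.ofReal h ^ c ≤ ENNReal.ofReal (max h₀ 1) ^ c := by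
        gcongr; exact hh₀.trans (le_max_left _ _)
    _ ≤ _ := pow_le_pow_right₀ h1 (show c ≤ n by omega)

/-- The squared `H^m`-type norm of a family of derivatives. -/
def familySq {d : ℕ} (m : ℕ) (U : Set (Pt d)) (g : (j : ℕ) → (Fin j → Fin d) → Pt d → ℝ) : ℝ≥0∞ :=
  ∑ j ∈ Finset.range (m + 1), ∑ i : Fin j → Fin d, ∫⁻ x in U, ‖g j i x‖ₑ ^ 2

theorem lintegral_le_familySq {m : ℕ} {U : Set (Pt d)}
    {g : (j : ℕ) → (Fin j → Fin d) → Pt d → ℝ} {j : ℕ} (hj : j ≤ m) :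
    ∑ i : Fin j → Fin d, ∫⁻ x in U, ‖g j i x‖ₑ ^ 2 ≤ familySq m U g :=
  Finset.single_le_sum (f := fun j => ∑ i : Fin j → Fin d, ∫⁻ x in U, ‖g j i x‖ₑ ^ 2)
    (fun _ _ => zero_le) (Finset.mem_range.2 (by omega))

/-- The triangle inequality through the approximating polynomial `q`, first for a fixed family of
weak derivatives. Positivity of the constant is recorded because the later passage to the infimum
needs a nonzero factor. -/
theorem exists_local_estimate (d k : ℕ) (hk : 1 ≤ k) {σ : ℝ} (hσ : 0 < σ) (h₀ : ℝ) (Λ : ℝ) :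
    ∃ C : ℝ≥0, 0 < C ∧ ∀ (M : CutMesh d) (h : ℝ), 0 < h → h ≤ h₀ → M.mesh.QuasiUniform σ h →
      ∀ D : NodalChoice M k, ∀ T ∈ M.active, ∀ z,
      D.dependenceRegion T ⊆ Metric.ball z (Λ * h) →
      ∀ (u : Pt d → ℝ) (g : (j : ℕ) → (Fin j → Fin d) → Pt d → ℝ),
      (∀ j ≤ k + 1, ∀ i : Fin j → Fin d,
        IsWeakDeriv (Metric.ball z (Λ * h)) u (g j i) (List.ofFn i)) →
      (∀ j ≤ k + 1, ∀ i : Fin j → Fin d,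
        MemLp (g j i) 2 (volume.restrict (Metric.ball z (Λ * h)))) →
      ∀ m ≤ k + 1, familySq m (interior (simplex T)) (fun j i x => g j i x -
          polyVal (listDeriv (List.ofFn i) (polyExt k T (D.tildePi (D.clement u)))) x) ≤
        C * (ENNReal.ofReal h ^ (k + 1 - m)) ^ 2 *
          familySq (k + 1) (Metric.ball z (Λ * h)) g := by
  obtain ⟨C₁, hC₁⟩ := exists_poly_error d k hk hσ Λ
  -- At least `1`, so that its powers with exponent up to `k + 1` are all bounded by the last one.
  let c : ℝ≥0 := max ((2 * Λ).toNNReal ^ 2 * 2 ^ d) 1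
  have hc1 : (1 : ℝ≥0∞) ≤ c := by exact_mod_cast le_max_right _ _
  let n : ℝ≥0 := ∑ j ∈ Finset.range (k + 2), (Fintype.card (Fin j → Fin d) : ℝ≥0)
  let C₂ : ℝ≥0 := 4 * (1 + C₁) * c ^ (k + 1) * (max h₀ 1).toNNReal ^ (2 * (k + 1))
  refine ⟨n * C₂ + 1, by positivity, fun M h hh hhh₀ hQ D T hT z hz u g hg hL2 m hm => ?_⟩
  have hTB : simplex T ⊆ Metric.ball z (Λ * h) := (simplex_subset_neighborhood hk hT).trans
    ((D.neighborhood_subset_dependenceRegion T).trans hz)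
  -- `Λ` is arbitrary, but the ball contains the nonempty simplex `T`.
  have hR : 0 < Λ * h := by
    obtain ⟨q, -, hq⟩ := exists_vertex hT
    exact dist_nonneg.trans_lt (Metric.mem_ball.1 (hTB hq))
  obtain ⟨q, hq, happ⟩ := exists_poly_approx hR hg hL2
  set H := ENNReal.ofReal h
  set B := Metric.ball z (Λ * h)
  set P := polyExt k T (D.tildePi (D.clement u))
  set a := ∑ i : Fin (k + 1) → Fin d, ∫⁻ x in B, ‖g (k + 1) i x‖ₑ ^ 2
  have haA : a ≤ familySq (k + 1) B g := lintegral_le_familySq le_rfl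
  have hpc : ∀ l ≤ k + 1, poincareConst d (Λ * h) ^ l ≤ (c : ℝ≥0∞) ^ (k + 1) * H ^ (2 * l) := by
    intro l hl
    have h1 : poincareConst d (Λ * h) ≤ c * H ^ 2 := by
      have h2 : poincareConst d (Λ * h) = ((2 * Λ).toNNReal ^ 2 * 2 ^ d : ℝ≥0) * H ^ 2 := by
        rw [poincareConst, ← mul_assoc, ENNReal.ofReal_mul' hh.le, mul_pow]
        push_cast
        rw [ENNReal.ofReal]
        ring
      rw [h2]
      gcongr
      exact le_max_left _ _
    calc _ ≤ (c * H ^ 2) ^ l := by gcongr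
      _ = (c : ℝ≥0∞) ^ l * H ^ (2 * l) := by rw [mul_pow, pow_mul]
      _ ≤ _ := by gcongr
  -- The weak derivative of order zero is the function itself, which gives the square integrability
  -- of `u` on the ball.
  have hu0 : u =ᵐ[volume.restrict B] g 0 Fin.elim0 := by
    have := hg 0 (Nat.zero_le _) Fin.elim0
    rw [List.ofFn_zero] at this
    exact this.ae_eq_of_nil Metric.isOpen_ball
  have hu : MemLp u 2 (volume.restrict B) :=
    (memLp_congr_ae hu0).2 (hL2 0 (Nat.zero_le _) _)
  have he : ∫⁻ x in B, ‖u x - polyVal q x‖ₑ ^ 2 ≤ (c : ℝ≥0∞) ^ (k + 1) * H ^ (2 * (k + 1)) * a := by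
    have h1 := happ 0 (Nat.zero_le _)
    rw [Nat.sub_zero] at h1
    refine le_trans ?_ (h1.trans (mul_le_mul_left (hpc _ le_rfl) a))
    rw [Fintype.sum_unique]
    refine le_of_eq (lintegral_congr_ae ?_)
    filter_upwards [hu0] with x hx
    rw [List.ofFn_zero, listDeriv_nil, hx, Subsingleton.elim default Fin.elim0]
  have key : ∀ j ≤ m, ∀ i : Fin j → Fin d,
      ∫⁻ x in interior (simplex T), ‖g j i x - polyVal (listDeriv (List.ofFn i) P) x‖ₑ ^ 2 ≤
        C₂ * (H ^ (k + 1 - m)) ^ 2 * a := by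
    intro j hj i
    have hjk : j ≤ k + 1 := hj.trans hm
    have h1 : ∫⁻ x in B, ‖g j i x - polyVal (listDeriv (List.ofFn i) q) x‖ₑ ^ 2 ≤
        (c : ℝ≥0∞) ^ (k + 1) * H ^ (2 * (k + 1 - j)) * a :=
      (Finset.single_le_sum (f := fun i : Fin j → Fin d => ∫⁻ x in B,
        ‖g j i x - polyVal (listDeriv (List.ofFn i) q) x‖ₑ ^ 2) (fun _ _ => zero_le)
        (Finset.mem_univ i)).trans
        ((happ j hjk).trans (mul_le_mul_left (hpc _ (by omega)) a))
    have h2 : ∫⁻ x in simplex T, ‖polyVal (listDeriv (List.ofFn i) (P - q)) x‖ₑ ^ 2 ≤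
        C₁ * ((c : ℝ≥0∞) ^ (k + 1) * H ^ (2 * (k + 1 - j)) * a) := by
      have h3 := hC₁ M h hh hQ D T hT z hz u hu q hq (List.ofFn i) (by simpa using hjk)
      rw [List.length_ofFn] at h3
      -- Cancelling `h ^ (2 * j)` from the factor `h ^ (2 * (k + 1))` of the `L²` error leaves the
      -- same power of `h` as for the derivatives of `u - q`.
      refine (ENNReal.mul_le_mul_iff_left (ofReal_pow_ne_zero hh (2 * j))
        (ofReal_pow_ne_top h (2 * j))).1 (h3.trans ((mul_le_mul_right he _).trans (le_of_eq ?_)))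
      have h4 : 2 * (k + 1) = 2 * (k + 1 - j) + 2 * j := by omega
      rw [h4, pow_add]
      ring
    have hHle : H ^ (2 * (k + 1 - j)) ≤
        ((max h₀ 1).toNNReal : ℝ≥0∞) ^ (2 * (k + 1)) * (H ^ (k + 1 - m)) ^ 2 := by
      rw [← pow_mul, mul_comm (k + 1 - m)]
      exact ofReal_pow_le hhh₀ (by omega) (by omega)
    calc _ ≤ ∫⁻ x in interior (simplex T),
          4 * (‖g j i x - polyVal (listDeriv (List.ofFn i) q) x‖ₑ ^ 2 +
            ‖polyVal (listDeriv (List.ofFn i) (P - q)) x‖ₑ ^ 2) := by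
          refine lintegral_mono fun x => ?_
          rw [map_sub, polyVal_sub]
          exact enorm_sub_sq_le _ _ _
      _ ≤ 4 * ((∫⁻ x in B, ‖g j i x - polyVal (listDeriv (List.ofFn i) q) x‖ₑ ^ 2) +
            ∫⁻ x in simplex T, ‖polyVal (listDeriv (List.ofFn i) (P - q)) x‖ₑ ^ 2) := by
          rw [lintegral_const_mul' _ _ (by norm_num), lintegral_add_right _
            (((continuous_polyVal _).enorm.measurable).pow_const 2)]
          gcongr 4 * (?_ + ?_)
          · exact lintegral_mono_set (interior_subset.trans hTB)
          · exact lintegral_mono_set interior_subset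
      _ ≤ 4 * ((c : ℝ≥0∞) ^ (k + 1) * H ^ (2 * (k + 1 - j)) * a +
            C₁ * ((c : ℝ≥0∞) ^ (k + 1) * H ^ (2 * (k + 1 - j)) * a)) := by gcongr
      _ = 4 * (1 + C₁) * (c : ℝ≥0∞) ^ (k + 1) * H ^ (2 * (k + 1 - j)) * a := by ring
      _ ≤ 4 * (1 + C₁) * (c : ℝ≥0∞) ^ (k + 1) *
            (((max h₀ 1).toNNReal : ℝ≥0∞) ^ (2 * (k + 1)) * (H ^ (k + 1 - m)) ^ 2) * a := by
          gcongr
      _ = _ := by simp only [C₂]; push_cast; ring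
  calc _ ≤ ∑ j ∈ Finset.range (m + 1), ∑ i : Fin j → Fin d, C₂ * (H ^ (k + 1 - m)) ^ 2 * a := by
        refine Finset.sum_le_sum fun j hj => Finset.sum_le_sum fun i _ => key j ?_ i
        have := Finset.mem_range.1 hj
        omega
    _ ≤ ∑ j ∈ Finset.range (k + 2), ∑ i : Fin j → Fin d, C₂ * (H ^ (k + 1 - m)) ^ 2 * a :=
        Finset.sum_le_sum_of_subset (Finset.range_subset_range.2 (by omega))
    _ = n * C₂ * (H ^ (k + 1 - m)) ^ 2 * a := by
        simp only [Finset.sum_const, Finset.card_univ, nsmul_eq_mul, ← Finset.sum_mul, n]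
        push_cast
        ring
    _ ≤ _ := by
        gcongr
        push_cast
        exact le_add_of_nonneg_right zero_le

end NodalChoice

/-! ### Sobolev norms and families of derivatives -/

open NodalChoice

theorem sobolevNorm_le_of_family {d m : ℕ} {U : Set (Pt d)} {f : Pt d → ℝ}
    {g : (j : ℕ) → (Fin j → Fin d) → Pt d → ℝ}
    (hg : ∀ j ≤ m, ∀ i : Fin j → Fin d, IsWeakDeriv U f (g j i) (List.ofFn i)) :
    sobolevNorm m U f ≤ familySq m U g ^ (1 / 2 : ℝ) := by
  refine (iInf₂_le g fun j hj i => hasWeakDeriv_iff.2 (hg j hj i)).trans (le_of_eq ?_)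
  simp only [familySq, eLpNorm_two_sq]

/-- A finite nonzero factor commutes with the infimum, and a family of infinite norm makes the
right-hand side infinite. So only square-integrable families need to be considered. -/
theorem le_mul_sobolevNorm {d m : ℕ} {U : Set (Pt d)} {f : Pt d → ℝ} {c Y : ℝ≥0∞}
    (hc0 : c ≠ 0) (hct : c ≠ ⊤)
    (h : ∀ g : (j : ℕ) → (Fin j → Fin d) → Pt d → ℝ,
      (∀ j ≤ m, ∀ i : Fin j → Fin d, IsWeakDeriv U f (g j i) (List.ofFn i)) →
      (∀ j ≤ m, ∀ i : Fin j → Fin d, MemLp (g j i) 2 (volume.restrict U)) →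
      Y ≤ c * familySq m U g ^ (1 / 2 : ℝ)) : Y ≤ c * sobolevNorm m U f := by
  rw [sobolevNorm, ENNReal.mul_iInf_of_ne hc0 hct]
  refine le_iInf fun g => ?_
  rw [ENNReal.mul_iInf_of_ne hc0 hct]
  refine le_iInf fun hg => ?_
  simp only [eLpNorm_two_sq]
  change Y ≤ c * familySq m U g ^ (1 / 2 : ℝ)
  by_cases htop : familySq m U g = ⊤
  · rw [htop, ENNReal.top_rpow_of_pos (by norm_num), ENNReal.mul_top hc0]
    exact le_top
  · refine h g (fun j hj i => hasWeakDeriv_iff.1 (hg j hj i)) fun j hj i => ⟨?_, ?_⟩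
    · exact (hg j hj i).2.1.aestronglyMeasurable
    · have h1 : ∫⁻ x in U, ‖g j i x‖ₑ ^ 2 ≤ familySq m U g :=
        (Finset.single_le_sum (f := fun i : Fin j → Fin d => ∫⁻ x in U, ‖g j i x‖ₑ ^ 2)
          (fun _ _ => zero_le) (Finset.mem_univ i)).trans (lintegral_le_familySq hj)
      rw [← eLpNorm_two_sq] at h1
      have h2 := h1.trans_lt (lt_top_iff_ne_top.2 htop)
      exact (ENNReal.pow_lt_top_iff.1 h2).resolve_right (by norm_num)

theorem sq_mul_rpow_half (C : ℝ≥0) (a b : ℝ≥0∞) :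
    (C * a ^ 2 * b) ^ (1 / 2 : ℝ) = (NNReal.sqrt C : ℝ≥0∞) * a * b ^ (1 / 2 : ℝ) := by
  rw [ENNReal.mul_rpow_of_nonneg _ _ (by norm_num), ENNReal.mul_rpow_of_nonneg _ _ (by norm_num)]
  congr 2
  · rw [NNReal.sqrt_eq_rpow, ENNReal.coe_rpow_of_nonneg _ (by norm_num)]
  · rw [← ENNReal.rpow_natCast, ← ENNReal.rpow_mul]; simp

theorem exists_local_sobolev_estimate (d k : ℕ) (hk : 1 ≤ k) {σ : ℝ} (hσ : 0 < σ) (h₀ : ℝ)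
    (Λ : ℝ) :
    ∃ C : ℝ≥0, ∀ (M : CutMesh d) (h : ℝ), 0 < h → h ≤ h₀ → M.mesh.QuasiUniform σ h →
      ∀ D : NodalChoice M k, ∀ T ∈ M.active, ∀ z,
      D.dependenceRegion T ⊆ Metric.ball z (Λ * h) → ∀ (u : Pt d → ℝ), ∀ m ≤ k + 1,
      sobolevNorm m (interior (simplex T)) (fun x => u x - D.tildePi (D.clement u) x) ≤
        C * ENNReal.ofReal h ^ (k + 1 - m) * sobolevNorm (k + 1) (Metric.ball z (Λ * h)) u := by
  obtain ⟨C, hC0, hC⟩ := exists_local_estimate d k hk hσ h₀ Λ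
  refine ⟨NNReal.sqrt C, fun M h hh hhh₀ hQ D T hT z hz u m hm => ?_⟩
  have hTB : simplex T ⊆ Metric.ball z (Λ * h) := (simplex_subset_neighborhood hk hT).trans
    ((D.neighborhood_subset_dependenceRegion T).trans hz)
  refine le_mul_sobolevNorm
    (mul_ne_zero (by simpa using hC0.ne') (ofReal_pow_ne_zero hh _))
    (ENNReal.mul_ne_top ENNReal.coe_ne_top (ofReal_pow_ne_top h _)) fun g hg hL2 => ?_
  rw [← sq_mul_rpow_half]
  refine (sobolevNorm_le_of_family fun j hj i => ?_).trans (ENNReal.rpow_le_rpow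
    (hC M h hh hhh₀ hQ D T hT z hz u g hg hL2 m hm) (by norm_num))
  refine (((hg j (hj.trans hm) i).mono (interior_subset.trans hTB)).sub
    (isWeakDeriv_polyVal (polyExt k T (D.tildePi (D.clement u))) _ _)).congr ?_ (ae_eq_refl _)
  refine (ae_restrict_iff' isOpen_interior.measurableSet).2 (Filter.Eventually.of_forall
    fun x hx => ?_)
  change u x - _ = u x - _
  rw [CutMesh.eq_polyExt (D.tildePi_mem hk _) hT (interior_subset hx)]

/-! ### Functions that are piecewise Lipschitz on a finite closed cover -/

/-- Continuous induction along the segment from `x` to `y`. Just after any time `t`, some one piece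
is visited at times arbitrarily close to `t`; being closed it also contains the point at `t`, so its
Lipschitz bound extends the estimate past `t`. -/
theorem lipschitzWith_of_finite_closed_cover {E ι : Type*} [NormedAddCommGroup E]
    [NormedSpace ℝ E] [Finite ι] {K : ι → Set E} (hK : ∀ i, IsClosed (K i))
    (hcover : ⋃ i, K i = Set.univ) {F : E → ℝ} {f : ι → E → ℝ} {C : ℝ≥0}
    (hf : ∀ i, LipschitzWith C (f i)) (hF : ∀ i, Set.EqOn F (f i) (K i)) : LipschitzWith C F := by
  have hcont : Continuous F := (locallyFinite_of_finite K).continuous hcover hK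
    fun i => (hf i).continuous.continuousOn.congr (hF i)
  refine LipschitzWith.of_dist_le_mul fun x y => ?_
  let γ : ℝ → E := AffineMap.lineMap x y
  have hγ : Continuous γ := AffineMap.lineMap_continuous
  let s : Set ℝ := {t | dist (F x) (F (γ t)) ≤ C * (t * dist x y)}
  have hs : IsClosed s := isClosed_le (by fun_prop) (by fun_prop)
  have hsub : Set.Icc (0 : ℝ) 1 ⊆ s := by
    refine (hs.inter isClosed_Icc).Icc_subset_of_forall_exists_gt (by simp [s, γ]) ?_
    rintro t ⟨hts, ht⟩ r hr
    have h1 : ∃ i, ∃ᶠ t' in nhdsWithin t (Set.Ioi t), γ t' ∈ K i := by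
      rw [← Filter.frequently_exists]
      refine (Filter.Eventually.of_forall fun t' => ?_).frequently
      exact Set.mem_iUnion.1 (hcover ▸ Set.mem_univ _)
    obtain ⟨i, hi⟩ := h1
    have hti : γ t ∈ K i := (hK i).mem_of_frequently_of_tendsto hi
      (hγ.continuousAt.tendsto.mono_left nhdsWithin_le_nhds)
    obtain ⟨t', ht', htt'⟩ := (hi.and_eventually (Ioc_mem_nhdsGT hr)).exists
    refine ⟨t', ?_, htt'⟩
    have h2 : dist (F (γ t)) (F (γ t')) ≤ C * ((t' - t) * dist x y) := by
      rw [hF i hti, hF i ht']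
      refine ((hf i).dist_le_mul _ _).trans (le_of_eq ?_)
      rw [dist_lineMap_lineMap, Real.dist_eq, abs_sub_comm, abs_of_pos (sub_pos.2 htt'.1)]
    have h3 : dist (F x) (F (γ t)) ≤ C * (t * dist x y) := hts
    refine (dist_triangle _ (F (γ t)) _).trans ((add_le_add h3 h2).trans (le_of_eq ?_))
    ring
  have := hsub (Set.right_mem_Icc.2 zero_le_one)
  simpa [s, γ] using this

theorem lineDeriv_const {E : Type*} [AddCommGroup E] [Module ℝ E] (c : ℝ) (x v : E) :
    lineDeriv ℝ (fun _ => c) x v = 0 := by simp [lineDeriv]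

/-- Integration by parts against a cutoff that is constantly `1` near the support of `F`. -/
theorem integral_lineDeriv_eq_zero {d : ℕ} {F : Pt d → ℝ} {C : ℝ≥0} (hF : LipschitzWith C F)
    (hc : HasCompactSupport F) (v : Pt d) : ∫ x, lineDeriv ℝ F x v = 0 := by
  obtain ⟨r, hr⟩ := hc.isCompact.isBounded.subset_ball (0 : Pt d)
  let g : ContDiffBump (0 : Pt d) := ⟨max r 1, max r 1 + 1, by positivity, by linarith⟩
  have hsub : tsupport F ⊆ Metric.ball (0 : Pt d) g.rIn :=
    hr.trans (Metric.ball_subset_ball (le_max_left _ _))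
  obtain ⟨D, hD⟩ := (g.contDiff (n := 1)).lipschitzWith_of_hasCompactSupport (𝕂 := ℝ)
    g.hasCompactSupport one_ne_zero
  have h1 := hF.integral_lineDeriv_mul_eq (μ := volume) hD g.hasCompactSupport v
  have h2 : ∀ x, lineDeriv ℝ F x v * g x = lineDeriv ℝ F x v := fun x => by
    by_cases hx : x ∈ tsupport F
    · rw [g.one_of_mem_closedBall (Metric.ball_subset_closedBall (hsub hx)), mul_one]
    · have : F =ᶠ[nhds x] fun _ => 0 := notMem_tsupport_iff_eventuallyEq.1 hx
      rw [this.lineDeriv_eq, lineDeriv_const, zero_mul]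
  have h3 : ∀ x, lineDeriv ℝ g x (-v) * F x = 0 := fun x => by
    by_cases hx : x ∈ tsupport F
    · have : g =ᶠ[nhds x] fun _ => 1 := by
        filter_upwards [Metric.isOpen_ball.mem_nhds (hsub hx)] with y hy
        exact g.one_of_mem_closedBall (Metric.ball_subset_closedBall hy)
      rw [this.lineDeriv_eq, lineDeriv_const, zero_mul]
    · rw [image_eq_zero_of_notMem_tsupport hx, mul_zero]
  simpa only [h2, h3, integral_zero] using h1

/-! ### Weak derivatives of finite element functions -/

namespace CutMesh

variable {d k : ℕ} {M : CutMesh d}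

/-- Let `p` be a vertex of `T` but not of `T'`. By conformity its barycentric coordinate on `T`
vanishes on the intersection; if that contained an open set, this affine function would be zero, yet
it is `1` at `p`. -/
theorem disjoint_interior {T T' : Finset (Pt d)} (hT : T ∈ M.active) (hT' : T' ∈ M.active)
    (hne : T ≠ T') : Disjoint (interior (simplex T)) (interior (simplex T')) := by
  have hs := isSimplex hT
  have hs' := isSimplex hT'
  obtain ⟨p, hp, hp'⟩ : ∃ p ∈ T, p ∉ T' := by
    by_contra! h
    exact hne (Finset.eq_of_subset_of_card_le h (by rw [hs.card_eq, hs'.card_eq]))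
  rw [Set.disjoint_iff_inter_eq_empty, ← Set.not_nonempty_iff_eq_empty]
  intro hV
  have h0 : affPoly (bary T p) = 0 := by
    refine eq_zero_of_polyVal_eq_zero (isOpen_interior.inter isOpen_interior) hV fun x hx => ?_
    rw [polyVal_affPoly, bary_eq_bary hs hs' p (M.mesh.conforming T (active_subset hT) T'
      (active_subset hT') ⟨interior_subset hx.1, interior_subset hx.2⟩), bary_of_notMem hs' hp']
    rfl
  have h1 := polyVal_affPoly (bary T p) p
  rw [h0, bary_vertex hs p hp, if_pos rfl] at h1
  simp at h1

theorem pairwiseDisjoint_interior :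
    (M.active : Set (Finset (Pt d))).PairwiseDisjoint fun T => interior (simplex T) :=
  fun _ hT _ hT' hne => disjoint_interior hT hT' hne

/-- The frontier of a convex set is a null set. -/
theorem ae_mem_interior :
    ∀ᵐ x, x ∈ M.activeRegion → ∃ T ∈ M.active, x ∈ interior (simplex T) := by
  have h : ∀ᵐ x : Pt d, ∀ T ∈ M.active, x ∉ frontier (simplex T) :=
    (ae_ball_iff M.active.countable_toSet).2 fun T _ =>
      measure_eq_zero_iff_ae_notMem.1 ((convex_simplex T).addHaar_frontier volume)
  filter_upwards [h] with x hx hxM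
  obtain ⟨T, hT, hxT⟩ := Set.mem_iUnion₂.1 hxM
  refine ⟨T, hT, ?_⟩
  by_contra hxi
  exact hx T hT ⟨subset_closure hxT, hxi⟩

variable (M) in
/-- The function that equals the polynomial `p T` in the interior of each active element `T`. -/
def piecewise (p : Finset (Pt d) → MvPolynomial (Fin d) ℝ) (x : Pt d) : ℝ :=
  ∑ T ∈ M.active, (interior (simplex T)).indicator (polyVal (p T)) x

theorem piecewise_eq (p : Finset (Pt d) → MvPolynomial (Fin d) ℝ) {T : Finset (Pt d)}
    (hT : T ∈ M.active) {x : Pt d} (hx : x ∈ interior (simplex T)) :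
    M.piecewise p x = polyVal (p T) x := by
  rw [piecewise, Finset.sum_eq_single_of_mem T hT, Set.indicator_of_mem hx]
  intro T' hT' hne
  exact Set.indicator_of_notMem (fun h => (disjoint_interior hT' hT hne).le_bot ⟨h, hx⟩) _

theorem locallyIntegrable_piecewise (p : Finset (Pt d) → MvPolynomial (Fin d) ℝ) :
    LocallyIntegrable (M.piecewise p) volume :=
  locallyIntegrable_finsetSum _ fun T _ =>
    (continuous_polyVal (p T)).locallyIntegrable.indicator isOpen_interior.measurableSet

theorem isWeakDeriv_nil_piecewise {w : Pt d → ℝ} {p : Finset (Pt d) → MvPolynomial (Fin d) ℝ}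
    (hw : ∀ T ∈ M.active, ∀ x ∈ simplex T, w x = polyVal (p T) x) :
    IsWeakDeriv (interior M.activeRegion) w (M.piecewise p) [] := by
  refine (IsWeakDeriv.nil ((locallyIntegrable_piecewise p).locallyIntegrableOn _)).congr ?_
    (ae_eq_refl _)
  refine (ae_restrict_iff' isOpen_interior.measurableSet).2 ?_
  filter_upwards [ae_mem_interior] with x hx hxM
  obtain ⟨T, hT, hxT⟩ := hx (interior_subset hxM)
  rw [piecewise_eq p hT hxT, hw T hT x (interior_subset hxT)]

/-- The product `w φ` is Lipschitz with compact support, so its directional derivative has integral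
zero; almost everywhere that derivative is given elementwise by the product rule. Agreement with
polynomials on closed elements encodes the continuity that excludes face terms. -/
theorem isWeakDeriv_singleton_piecewise {w : Pt d → ℝ}
    {p : Finset (Pt d) → MvPolynomial (Fin d) ℝ}
    (hw : ∀ T ∈ M.active, ∀ x ∈ simplex T, w x = polyVal (p T) x) (l : Fin d) :
    IsWeakDeriv (interior M.activeRegion) w
      (M.piecewise fun T => MvPolynomial.pderiv l (p T)) [l] := by
  have hleft := (isWeakDeriv_nil_piecewise hw).left
  have hright := (locallyIntegrable_piecewise (M := M)
    fun T => MvPolynomial.pderiv l (p T)).locallyIntegrableOn (interior M.activeRegion)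
  refine ⟨hleft, hright, fun φ hφ => ?_⟩
  have hsmooth : ∀ q : MvPolynomial (Fin d) ℝ, ContDiff ℝ 1 fun x => polyVal q x * φ x :=
    fun q => (contDiff_polyVal q).mul (hφ.smooth.of_le (by exact_mod_cast le_top))
  have hex : ∀ q : MvPolynomial (Fin d) ℝ, ∃ C, LipschitzWith C fun x => polyVal q x * φ x :=
    fun q => (hsmooth q).lipschitzWith_of_hasCompactSupport (𝕂 := ℝ) hφ.compact.mul_left one_ne_zero
  choose C hC using hex
  have hlip : LipschitzWith (∑ T ∈ M.active, C (p T)) fun x => w x * φ x := by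
    -- The closed cover consists of the active elements and the complement of the open region, on
    -- which `φ` vanishes.
    refine lipschitzWith_of_finite_closed_cover (ι := Option M.active)
      (K := fun o => o.elim (interior M.activeRegion)ᶜ fun T => simplex T.1)
      (f := fun o => o.elim (fun _ => 0) fun T x => polyVal (p T.1) x * φ x) ?_ ?_ ?_ ?_
    · rintro (_ | T)
      · exact isOpen_interior.isClosed_compl
      · exact (isCompact_simplex T.1).isClosed
    · refine Set.eq_univ_of_forall fun x => Set.mem_iUnion.2 ?_
      by_cases hx : x ∈ interior M.activeRegion
      · obtain ⟨T, hT, hxT⟩ := Set.mem_iUnion₂.1 (interior_subset hx)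
        exact ⟨some ⟨T, hT⟩, hxT⟩
      · exact ⟨none, hx⟩
    · rintro (_ | T)
      · exact LipschitzWith.const' 0
      · exact (hC (p T.1)).weaken
          (Finset.single_le_sum (f := fun T => C (p T)) (fun _ _ => zero_le) T.2)
    · rintro (_ | T) x hx
      · change w x * φ x = 0
        rw [hφ.eq_zero hx, mul_zero]
      · change w x * φ x = polyVal (p T.1) x * φ x
        rw [hw T.1 T.2 x hx]
  have hzero := integral_lineDeriv_eq_zero hlip hφ.compact.mul_left (EuclideanSpace.single l 1)
  have hae : (fun x => lineDeriv ℝ (fun x => w x * φ x) x (EuclideanSpace.single l 1)) =ᵐ[volume]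
      fun x => w x * dirDeriv l φ x +
        M.piecewise (fun T => MvPolynomial.pderiv l (p T)) x * φ x := by
    filter_upwards [ae_mem_interior] with x hx
    by_cases hxU : x ∈ interior M.activeRegion
    · obtain ⟨T, hT, hxT⟩ := hx (interior_subset hxU)
      have h1 : (fun x => w x * φ x) =ᶠ[nhds x] fun x => polyVal (p T) x * φ x := by
        filter_upwards [isOpen_interior.mem_nhds hxT] with y hy
        rw [hw T hT y (interior_subset hy)]
      have h2 := (hasFDerivAt_polyVal (p T) x).differentiableAt
      have h3 : DifferentiableAt ℝ φ x := hφ.smooth.differentiable (by simp) x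
      rw [h1.lineDeriv_eq, piecewise_eq _ hT hxT, hw T hT x (interior_subset hxT), dirDeriv,
        HasLineDerivAt.lineDeriv ((h2.hasFDerivAt.fun_mul h3.hasFDerivAt).hasLineDerivAt _),
        ← fderiv_polyVal_single]
      simp
      ring
    · have hx' : x ∉ tsupport φ := fun h => hxU (hφ.supp h)
      have h1 : (fun x => w x * φ x) =ᶠ[nhds x] fun _ => 0 := by
        filter_upwards [notMem_tsupport_iff_eventuallyEq.1 hx'] with y hy
        simp [hy]
      rw [h1.lineDeriv_eq, lineDeriv_const, hφ.eq_zero hxU, (hφ.dirDeriv l).eq_zero hxU]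
      simp
  rw [integral_congr_ae hae, integral_add (integrableOn_mul_test hleft (hφ.dirDeriv l))
    (integrableOn_mul_test hright hφ)] at hzero
  rw [setIntegral_mul_test (hφ.testDeriv [l]), setIntegral_mul_test hφ]
  change ∫ x, w x * dirDeriv l φ x = _
  rw [eq_neg_of_add_eq_zero_left hzero]
  simp

theorem isWeakDeriv_piecewise {w : Pt d → ℝ} {p : Finset (Pt d) → MvPolynomial (Fin d) ℝ}
    (hw : ∀ T ∈ M.active, ∀ x ∈ simplex T, w x = polyVal (p T) x) {L : List (Fin d)}
    (hL : L.length ≤ 1) :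
    IsWeakDeriv (interior M.activeRegion) w (M.piecewise fun T => listDeriv L (p T)) L := by
  match L, hL with
  | [], _ => exact isWeakDeriv_nil_piecewise hw
  | [l], _ => exact isWeakDeriv_singleton_piecewise hw l

/-! ### Sums over the active elements -/

theorem setLIntegral_le_sum (f : Pt d → ℝ≥0∞) :
    ∫⁻ x in interior M.activeRegion, f x ≤
      ∑ T ∈ M.active, ∫⁻ x in interior (simplex T), f x := by
  rw [← lintegral_biUnion_finset pairwiseDisjoint_interior
    (fun _ _ => isOpen_interior.measurableSet) f]
  refine lintegral_mono_set' ?_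
  filter_upwards [ae_mem_interior] with x hx hxM
  obtain ⟨T, hT, hxT⟩ := hx (interior_subset hxM)
  exact Set.mem_iUnion₂.2 ⟨T, hT, hxT⟩

theorem familySq_sub_piecewise_le (m : ℕ) (g : (j : ℕ) → (Fin j → Fin d) → Pt d → ℝ)
    (p : Finset (Pt d) → MvPolynomial (Fin d) ℝ) :
    familySq m (interior M.activeRegion)
        (fun j i x => g j i x - M.piecewise (fun T => listDeriv (List.ofFn i) (p T)) x) ≤
      ∑ T ∈ M.active, familySq m (interior (simplex T))
        fun j i x => g j i x - polyVal (listDeriv (List.ofFn i) (p T)) x := by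
  simp only [familySq]
  rw [Finset.sum_comm]
  refine Finset.sum_le_sum fun j _ => ?_
  rw [Finset.sum_comm]
  refine Finset.sum_le_sum fun i _ => (setLIntegral_le_sum _).trans (le_of_eq ?_)
  refine Finset.sum_congr rfl fun T hT => setLIntegral_congr_fun isOpen_interior.measurableSet
    fun x hx => ?_
  rw [piecewise_eq _ hT hx]

/-- Volume packing: the elements whose balls contain `x` all lie within `2 Λ h` of `x`, have
disjoint interiors, and each contains a ball of radius `σ h`. -/
theorem card_mul_volume_le {σ h : ℝ} (hh : 0 < h) (hQ : M.mesh.QuasiUniform σ h) {Λ : ℝ}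
    {z : Finset (Pt d) → Pt d} (hz : ∀ T ∈ M.active, simplex T ⊆ Metric.ball (z T) (Λ * h))
    (x : Pt d) :
    ((M.active.filter fun T => x ∈ Metric.ball (z T) (Λ * h)).card : ℝ≥0∞) *
      volume (Metric.ball (0 : Pt d) σ) ≤ volume (Metric.ball (0 : Pt d) (2 * Λ)) := by
  set A := M.active.filter fun T => x ∈ Metric.ball (z T) (Λ * h)
  have hA : ∀ T ∈ A, T ∈ M.active := fun T hT => (Finset.mem_filter.1 hT).1
  have h1 : ∀ T ∈ A, volume (Metric.ball x (σ * h)) ≤ volume (interior (simplex T)) := by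
    intro T hT
    obtain ⟨-, y, hy⟩ := hQ T (active_subset (hA T hT))
    rw [volume_ball_mul x hh, ← volume_ball_mul y hh]
    exact measure_mono (interior_maximal (Metric.ball_subset_closedBall.trans hy)
      Metric.isOpen_ball)
  have h2 : (⋃ T ∈ A, interior (simplex T)) ⊆ Metric.ball x (2 * Λ * h) := by
    refine Set.iUnion₂_subset fun T hT y hy => ?_
    have hy' := Metric.mem_ball.1 (hz T (hA T hT) (interior_subset hy))
    have hx := Metric.mem_ball.1 (Finset.mem_filter.1 hT).2
    have := dist_triangle_right y x (z T)
    rw [Metric.mem_ball]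
    linarith
  have h3 : ENNReal.ofReal h ^ d * ((A.card : ℝ≥0∞) * volume (Metric.ball (0 : Pt d) σ)) ≤
      ENNReal.ofReal h ^ d * volume (Metric.ball (0 : Pt d) (2 * Λ)) := by
    calc _ = ∑ T ∈ A, volume (Metric.ball x (σ * h)) := by
          rw [Finset.sum_const, nsmul_eq_mul, volume_ball_mul x hh]; ring
      _ ≤ ∑ T ∈ A, volume (interior (simplex T)) := Finset.sum_le_sum h1
      _ = volume (⋃ T ∈ A, interior (simplex T)) := (measure_biUnion_finset
          (pairwiseDisjoint_interior.subset fun T hT => hA T hT)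
          fun _ _ => isOpen_interior.measurableSet).symm
      _ ≤ volume (Metric.ball x (2 * Λ * h)) := measure_mono h2
      _ = _ := volume_ball_mul x hh _
  exact (ENNReal.mul_le_mul_iff_right (ofReal_pow_ne_zero hh d) (ofReal_pow_ne_top h d)).1 h3

theorem exists_overlap_bound (d : ℕ) {σ : ℝ} (hσ : 0 < σ) (Λ : ℝ) :
    ∃ n : ℝ≥0, ∀ (M : CutMesh d) (h : ℝ), 0 < h → M.mesh.QuasiUniform σ h →
      ∀ z : Finset (Pt d) → Pt d, (∀ T ∈ M.active, simplex T ⊆ Metric.ball (z T) (Λ * h)) →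
      ∀ f : Pt d → ℝ≥0∞, AEMeasurable f →
        ∑ T ∈ M.active, ∫⁻ x in Metric.ball (z T) (Λ * h), f x ≤ n * ∫⁻ x, f x := by
  have hV : volume (Metric.ball (0 : Pt d) σ) ≠ 0 := (Metric.measure_ball_pos _ _ hσ).ne'
  have hV' : volume (Metric.ball (0 : Pt d) σ) ≠ ⊤ := measure_ball_lt_top.ne
  have hn : volume (Metric.ball (0 : Pt d) (2 * Λ)) / volume (Metric.ball (0 : Pt d) σ) ≠ ⊤ :=
    ENNReal.div_ne_top measure_ball_lt_top.ne hV
  refine ⟨(volume (Metric.ball (0 : Pt d) (2 * Λ)) / volume (Metric.ball (0 : Pt d) σ)).toNNReal,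
    fun M h hh hQ z hz f hf => ?_⟩
  rw [ENNReal.coe_toNNReal hn]
  simp only [← lintegral_indicator (Metric.isOpen_ball.measurableSet)]
  rw [← lintegral_finsetSum' _ fun T _ => hf.indicator Metric.isOpen_ball.measurableSet,
    ← lintegral_const_mul' _ _ hn]
  refine lintegral_mono fun x => ?_
  simp only [Set.indicator_apply]
  rw [← Finset.sum_filter, Finset.sum_const, nsmul_eq_mul]
  gcongr
  rw [ENNReal.le_div_iff_mul_le (Or.inl hV) (Or.inl hV')]
  exact card_mul_volume_le hh hQ hz x

end CutMesh

/-! ### The global error estimate -/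

open CutMesh

/-- The local estimates for one global family of derivatives are summed in squares, and the overlap
bound absorbs the sum over the balls. The limit `m ≤ 1` is that of `isWeakDeriv_piecewise`. -/
theorem exists_global_sobolev_estimate (d k : ℕ) (hk : 1 ≤ k) {σ : ℝ} (hσ : 0 < σ) (h₀ : ℝ)
    (Λ : ℝ) :
    ∃ C : ℝ≥0, ∀ (M : CutMesh d) (h : ℝ), 0 < h → h ≤ h₀ → M.mesh.QuasiUniform σ h →
      ∀ D : NodalChoice M k,
      (∀ T ∈ M.active, ∃ z, D.dependenceRegion T ⊆ Metric.ball z (Λ * h)) →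
      ∀ (u : Pt d → ℝ), ∀ m ≤ 1,
      sobolevNorm m (interior M.activeRegion) (fun x => u x - D.tildePi (D.clement u) x) ≤
        C * ENNReal.ofReal h ^ (k + 1 - m) * sobolevNorm (k + 1) Set.univ u := by
  obtain ⟨C, hC0, hC⟩ := exists_local_estimate d k hk hσ h₀ Λ
  obtain ⟨n, hn⟩ := exists_overlap_bound d hσ Λ
  -- `n` may be zero, while `le_mul_sobolevNorm` needs a nonzero factor.
  have hCn : 0 < C * (n + 1) := by positivity
  refine ⟨NNReal.sqrt (C * (n + 1)), fun M h hh hhh₀ hQ D hball u m hm => ?_⟩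
  have hm' : m ≤ k + 1 := hm.trans (by omega)
  choose! z hz using hball
  have hzT : ∀ T ∈ M.active, simplex T ⊆ Metric.ball (z T) (Λ * h) := fun T hT =>
    (simplex_subset_neighborhood hk hT).trans
      ((D.neighborhood_subset_dependenceRegion T).trans (hz T hT))
  refine le_mul_sobolevNorm (mul_ne_zero (by simpa using hCn.ne') (ofReal_pow_ne_zero hh _))
    (ENNReal.mul_ne_top ENNReal.coe_ne_top (ofReal_pow_ne_top h _)) fun g hg hL2 => ?_
  rw [← sq_mul_rpow_half]
  set w := D.tildePi (D.clement u)
  set H := ENNReal.ofReal h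
  have hw : ∀ T ∈ M.active, ∀ x ∈ simplex T, w x = polyVal (polyExt k T w) x :=
    fun T hT x hx => eq_polyExt (D.tildePi_mem hk _) hT hx
  refine (sobolevNorm_le_of_family fun j hj i => ((hg j (hj.trans hm') i).mono
    (Set.subset_univ _)).sub (isWeakDeriv_piecewise hw (by simpa using hj.trans hm))).trans
    (ENNReal.rpow_le_rpow ?_ (by norm_num))
  have hsum : ∑ T ∈ M.active, familySq (k + 1) (Metric.ball (z T) (Λ * h)) g ≤
      n * familySq (k + 1) Set.univ g := by
    simp only [familySq, Finset.mul_sum]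
    rw [Finset.sum_comm]
    refine Finset.sum_le_sum fun j hj => ?_
    rw [Finset.sum_comm]
    refine Finset.sum_le_sum fun i _ => ?_
    have hgm := (hL2 j (by have := Finset.mem_range.1 hj; omega) i).1.enorm
    rw [Measure.restrict_univ] at hgm ⊢
    exact hn M h hh hQ z hzT _ (hgm.pow_const 2)
  calc _ ≤ ∑ T ∈ M.active, familySq m (interior (simplex T))
        (fun j i x => g j i x - polyVal (listDeriv (List.ofFn i) (polyExt k T w)) x) :=
        familySq_sub_piecewise_le m g _
    _ ≤ ∑ T ∈ M.active, C * (H ^ (k + 1 - m)) ^ 2 *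
          familySq (k + 1) (Metric.ball (z T) (Λ * h)) g := by
        refine Finset.sum_le_sum fun T hT => hC M h hh hhh₀ hQ D T hT (z T) (hz T hT) u g
          (fun j hj i => (hg j hj i).mono (Set.subset_univ _))
          (fun j hj i => (hL2 j hj i).mono_measure
            (Measure.restrict_mono (Set.subset_univ _) le_rfl)) m hm'
    _ ≤ C * (H ^ (k + 1 - m)) ^ 2 * (n * familySq (k + 1) Set.univ g) := by
        rw [← Finset.mul_sum]
        gcongr
    _ = C * n * (H ^ (k + 1 - m)) ^ 2 * familySq (k + 1) Set.univ g := by ring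
    _ ≤ _ := by
        push_cast
        gcongr
        exact le_add_of_nonneg_right zero_le

end

end CutFEM

/-! ### The approximation lemma -/

theorem mainTheorem2 (d k : ℕ) (hd : 1 ≤ d) (hk : 1 ≤ k) (σ h₀ : ℝ) (hσ : 0 < σ) (hh₀ : 0 < h₀)
    (N : ℕ) :
    ∃ (Λ₀ : ℝ) (C : ℝ → ℝ≥0) (C' : ℝ≥0), 0 < Λ₀ ∧
      ∀ (M : CutFEM.CutMesh d) (h : ℝ), 0 < h → h ≤ h₀ → M.mesh.QuasiUniform σ h →
      ∀ D : CutFEM.NodalChoice M k, D.PathBound N →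
      ∀ E : Lp ℝ 2 (volume.restrict M.Ω) →ₗ[ℝ] Lp ℝ 2 (volume : Measure (CutFEM.Pt d)),
      (∀ v, E v =ᵐ[volume.restrict M.Ω] v) →
        -- nodal values of the operator `Π̃_h`
        (∀ w ∈ M.Vh k, D.tildePi w ∈ M.Vh k ∧
          (∀ i ∈ M.smallNodes k,
            D.tildePi w i = CutFEM.polyVal (CutFEM.polyExt k (D.S (D.stabElem i)) w) i) ∧
          (∀ i ∈ M.largeNodes k, D.tildePi w i = w i)) ∧
        -- `Π_h v` is in the kernel of the stabilization, for every value of the parameters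
        (∀ v, D.bigPi E v ∈ M.Vh k ∧ ∀ τ : ℝ, 0 < τ → ∀ α : ℝ,
          D.stabSeminorm h τ α (D.bigPi E v) = 0 ∧
          ∀ w ∈ M.Vh k, D.stab h τ α (D.bigPi E v) w = 0) ∧
        -- balls `B_{δ,T}` with `δ = Λ₀ h` exist
        (∀ T ∈ M.active, ∃ z, D.dependenceRegion T ⊆ Metric.ball z (Λ₀ * h)) ∧
        -- the local estimate, for all admissible balls with `δ = Λ h`
        (∀ T ∈ M.active, ∀ (z : CutFEM.Pt d) (Λ : ℝ),
          D.dependenceRegion T ⊆ Metric.ball z (Λ * h) → ∀ v, ∀ m ≤ k + 1,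
          CutFEM.sobolevNorm m (interior (CutFEM.simplex T)) (fun x => E v x - D.bigPi E v x) ≤
            C Λ * ENNReal.ofReal h ^ (k + 1 - m) *
              CutFEM.sobolevNorm (k + 1) (Metric.ball z (Λ * h)) (E v)) ∧
        -- locking-freeness: the global optimal order estimate, for a stable extension operator
        (∀ CE : ℝ≥0,
          (∀ v, CutFEM.sobolevNorm (k + 1) Set.univ (E v) ≤
            CE * CutFEM.sobolevNorm (k + 1) (interior M.Ω) v) →
          ∀ v, ∀ m ≤ 1,
          CutFEM.sobolevNorm m (interior M.activeRegion) (fun x => E v x - D.bigPi E v x) ≤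
            C' * CE * ENNReal.ofReal h ^ (k + 1 - m) *
              CutFEM.sobolevNorm (k + 1) (interior M.Ω) v) := by
  choose C hC using CutFEM.exists_local_sobolev_estimate d k hk hσ h₀
  -- The global constant is taken at the radius factor `N + 4`, for which admissible balls always
  -- exist; `CE` enters only at the end, so `C'` is independent of the extension operator.
  obtain ⟨C', hC'⟩ := CutFEM.exists_global_sobolev_estimate d k hk hσ h₀ (N + 4)
  refine ⟨N + 4, C, C', by positivity, fun M h hh hhh₀ hQ D hD E _ => ?_⟩
  have hball : ∀ T ∈ M.active, ∃ z, D.dependenceRegion T ⊆ Metric.ball z ((N + 4 : ℝ) * h) := by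
    intro T hT
    obtain ⟨z, -, hz⟩ := CutFEM.NodalChoice.exists_vertex hT
    exact ⟨z, D.dependenceRegion_subset_ball hd hk hh hQ hD hT hz⟩
  refine ⟨fun w _ => ⟨D.tildePi_mem hk w, fun i hi => D.tildePi_smallNode hk w hi,
    fun i hi => D.tildePi_largeNode hk w hi⟩, fun v => ⟨D.tildePi_mem hk _, fun τ _ α => ⟨?_,
    fun w _ => D.stab_tildePi hk (D.clement_mem hk _) h τ α w⟩⟩, hball,
    fun T hT z Λ hz v m hm => hC Λ M h hh hhh₀ hQ D T hT z hz (E v) m hm,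
    fun CE hCE v m hm => ?_⟩
  · rw [CutFEM.NodalChoice.stabSeminorm, CutFEM.NodalChoice.bigPi,
      D.stab_tildePi hk (D.clement_mem hk _), Real.sqrt_zero]
  · calc _ ≤ C' * ENNReal.ofReal h ^ (k + 1 - m) *
          CutFEM.sobolevNorm (k + 1) Set.univ (E v) :=
          hC' M h hh hhh₀ hQ D hball (E v) m hm
      _ ≤ C' * ENNReal.ofReal h ^ (k + 1 - m) *
          (CE * CutFEM.sobolevNorm (k + 1) (interior M.Ω) v) := by
          gcongr
          exact hCE v
      _ = _ := by ring
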